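/- All graphs are finite and simple. For a graph $G$ let $P(G)=\prod_{uv\in E(G),\,u<v}(u-v)$ be its graph polynomial over $\mathbb{Z}$, where each vertex is also a variable and $<$ is an arbitrary linear order on $V(G)$. Let $G$ be a 2-connected outerplane graph. For vertices $x,y$ of $G$, the fundamental $x$-$y$ subgraph of $G$ is the edge $xy$ if $xy\in E(G)$; otherwise it is the subgraph of $G$ induced by the vertices of those inner faces that lie on the shortest path, in the weak dual of $G$, between a face containing $x$ and a face containing $y$. The graph $G$ is $xy$-fundamental if it equals its fundamental $x$-$y$ subgraph. **Theorem.** Let $G$ be a 2-connected outerplane graph that is $xy$-fundamental and has exactly one non-triangular inner face $f$, and suppose that $f$ contains neither $x$ nor $y$. Let $a,b,c,d$ be distinct vertices of $f$, different from $x$ and $y$, such that $ab$ and $cd$ are the edges that $f$ shares with its neighbouring inner faces, and such that deleting the edges $ab$ and $cd$ from the boundary cycle of $f$ leaves a path connecting $a$ with $c$ and a path connecting $b$ with $d$. Deleting these two paths (their edges and their interior vertices) from $G$ leaves two components; let the labels be chosen so that one of them contains $x,a,b$ and the other contains $y,c,d$. Let $C$ be any proper 3-colouring of what is left (it is unique up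 to permuting the colours in each component). Let $d(\cdot,\cdot)$ denote the distance in $G$. Consider the condition $$(\ast)\qquad \bigl(d(a,c)=1,\ C(x)=C(a)\text{ and }C(y)=C(c)\bigr)\quad\text{or}\quad\bigl(d(b,d)=1,\ C(x)=C(b)\text{ and }C(y)=C(d)\bigr).$$ 1. If $(\ast)$ holds, then some monomial in which $x$ has exponent $0$, $y$ has exponent $1$, and every other vertex has exponent at most $2$ occurs in $P(G)$ with non-zero coefficient. 2. If $(\ast)$ does not hold, then some monomial in which $x$ and $y$ have exponent $0$ and every other vertex has exponent at most $2$ occurs in $P(G)$ with non-zero coefficient. -/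

import Mathlib

/-- A graph is 2-connected if it has at least three vertices, is connected, and stays connected
when any single vertex is deleted. -/
def IsTwoConnected {V : Type*} (G : SimpleGraph V) : Prop :=
  3 ≤ Nat.card V ∧ G.Connected ∧ ∀ v : V, (G.induce {v}ᶜ).Connected

open Classical in
/-- The graph polynomial `∏_{uv ∈ E(G), u < v} (u - v)`, with one variable per vertex and integer
coefficients. -/
noncomputable def graphPolynomial {V : Type*} [Fintype V] [LinearOrder V] (G : SimpleGraph V) :
    MvPolynomial V ℤ :=
  ∏ p : V × V with p.1 < p.2 ∧ G.Adj p.1 p.2, (MvPolynomial.X p.1 - MvPolynomial.X p.2)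

/-- `P(G)` has a non-vanishing monomial in which `x` has exponent `i`, `y` has exponent `j`, and
every other vertex has exponent at most two. -/
def HasMonomial {V : Type*} [Fintype V] [LinearOrder V] (G : SimpleGraph V) (x y : V)
    (i j : ℕ) : Prop :=
  ∃ m : V →₀ ℕ, MvPolynomial.coeff m (graphPolynomial G) ≠ 0 ∧ m x = i ∧ m y = j ∧
    ∀ v, v ≠ x → v ≠ y → m v ≤ 2

/-- A rotation system: the darts (oriented edges) leaving each vertex are arranged in one cyclic
order. -/
structure RotationSystem {V : Type*} (G : SimpleGraph V) where
  /-- The next dart around the initial vertex. -/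
  next : Equiv.Perm G.Dart
  next_fst : ∀ e : G.Dart, (next e).fst = e.fst
  next_sameCycle : ∀ e e' : G.Dart, e.fst = e'.fst → next.SameCycle e e'

namespace RotationSystem

variable {V : Type*} {G : SimpleGraph V} (R : RotationSystem G)

/-- One step of a facial walk: traverse `e`, then leave its end by the dart that follows the
reverse of `e`. -/
def facePerm : Equiv.Perm G.Dart :=
  (SimpleGraph.Dart.symm_involutive (G := G)).toPerm.trans R.next

/-- The faces are the orbits of darts under facial walks. -/
def Face : Type _ := Quotient (Equiv.Perm.SameCycle.setoid R.facePerm)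

/-- The face on whose boundary walk a dart lies. -/
def face (e : G.Dart) : R.Face := Quotient.mk (Equiv.Perm.SameCycle.setoid R.facePerm) e

/-- The number of darts in the boundary walk of a face. -/
noncomputable def faceLength (f : R.Face) : ℕ := Set.ncard {e : G.Dart | R.face e = f}

/-- The vertex `v` lies on the face `f`. -/
def OnFace (v : V) (f : R.Face) : Prop := ∃ e : G.Dart, R.face e = f ∧ e.fst = v

/-- The boundary of a face, as a graph on the vertices of `G`. -/
def boundary (f : R.Face) : SimpleGraph V where
  Adj u v := ∃ e : G.Dart, R.face e = f ∧ e.edge = s(u, v)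
  symm := ⟨fun u v ⟨e, he, h⟩ => ⟨e, he, h.trans Sym2.eq_swap⟩⟩
  loopless := ⟨fun u ⟨e, _, h⟩ => G.loopless.irrefl u (by
    have := e.edge_mem
    rwa [h, SimpleGraph.mem_edgeSet] at this)⟩

end RotationSystem

/-- An outerplane embedding of a connected graph, given combinatorially: a rotation system of
genus zero (Euler's formula `|V| - |E| + |F| = 2`), with a distinguished outer face on which every
vertex lies. -/
structure OuterplaneEmbedding {V : Type*} (G : SimpleGraph V) extends RotationSystem G where
  connected : G.Connected
  euler : Nat.card V + Nat.card toRotationSystem.Face = Nat.card G.edgeSet + 2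
  /-- The outer face. -/
  outer : toRotationSystem.Face
  onFace_outer : ∀ v : V, toRotationSystem.OnFace v outer

namespace OuterplaneEmbedding

variable {V : Type*} {G : SimpleGraph V} (M : OuterplaneEmbedding G)

/-- The inner (bounded) faces. -/
def InnerFace : Type _ := {f : M.Face // f ≠ M.outer}

/-- The weak dual: its vertices are the inner faces, two of them being adjacent if their
boundaries share an edge. -/
def weakDual : SimpleGraph M.InnerFace where
  Adj f g := f ≠ g ∧ ∃ e : G.Dart, M.face e = f.1 ∧ M.face e.symm = g.1
  symm := ⟨fun f g ⟨hne, e, he, he'⟩ => ⟨hne.symm, e.symm, he', by rwa [e.symm_symm]⟩⟩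
  loopless := ⟨fun _ h => h.1 rfl⟩

/-- A walk of the weak dual that starts at a face containing `x`, ends at a face containing `y`,
and is as short as any such walk (hence is a path). -/
def IsShortestFacePath (x y : V) {f g : M.InnerFace} (p : M.weakDual.Walk f g) : Prop :=
  M.OnFace x f.1 ∧ M.OnFace y g.1 ∧
    ∀ (f' g' : M.InnerFace) (q : M.weakDual.Walk f' g'),
      M.OnFace x f'.1 → M.OnFace y g'.1 → p.length ≤ q.length

open Classical in
/-- The fundamental `x-y` subgraph: the edge `xy` if `x` and `y` are adjacent, and otherwise the
subgraph induced by the vertices of the faces on the shortest path of the weak dual between faces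
containing `x` and `y`. -/
noncomputable def fundamentalSubgraph (x y : V) : G.Subgraph :=
  if h : G.Adj x y then G.subgraphOfAdj h
  else (⊤ : G.Subgraph).induce
    {v | ∃ (f g : M.InnerFace) (p : M.weakDual.Walk f g), M.IsShortestFacePath x y p ∧
      ∃ k ∈ p.support, M.OnFace v k.1}

/-- `G` is `xy`-fundamental if it equals its fundamental `x-y` subgraph. -/
def IsFundamental (x y : V) : Prop := M.fundamentalSubgraph x y = ⊤

/-- The edge `uv` is on the boundary of the inner face `f` and of another inner face. -/
def IsSharedEdge (f : M.InnerFace) (u v : V) : Prop :=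
  ∃ g : M.InnerFace, g ≠ f ∧ (M.boundary f.1).Adj u v ∧ (M.boundary g.1).Adj u v

/-- The boundary of `f` without the edges `ab` and `cd`. -/
def connectingPaths (f : M.InnerFace) (a b c d : V) : SimpleGraph V :=
  (M.boundary f.1).deleteEdges {s(a, b), s(c, d)}

/-- What is left of `G` when the two connecting paths are deleted. The interior vertices of these
paths are kept as isolated vertices, which does not matter for colourings. -/
def sides (f : M.InnerFace) (a b c d : V) : SimpleGraph V :=
  G \ M.connectingPaths f a b c d

/-- The labelling of the face `f`: the edges `ab` and `cd` are those shared with the neighbouring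
inner faces, the edge `ab` being on the side of `x` and `cd` on the side of `y`, and the remaining
boundary of `f` connects `a` with `c` and `b` with `d`. -/
structure IsLabelling (f : M.InnerFace) (x y a b c d : V) : Prop where
  nodup : [x, y, a, b, c, d].Nodup
  shared_ab : M.IsSharedEdge f a b
  shared_cd : M.IsSharedEdge f c d
  path_ac : (M.connectingPaths f a b c d).Reachable a c
  path_bd : (M.connectingPaths f a b c d).Reachable b d
  side_x : (M.sides f a b c d).Reachable x a
  side_y : (M.sides f a b c d).Reachable y c

end OuterplaneEmbedding

/-! A coefficient of `P(G)` can be read off one vertex at a time: prescribing the exponent of a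
vertex keeps one coefficient with respect to that variable, and a polynomial in the other variables
is left. Here `G` consists of two strips of triangles, from `x` to the edge `ab` and from `y` to the
edge `cd`, joined by two paths around `f`, from `a` to `c` and from `b` to `d`. Each of these four
pieces can be eliminated on its own.

Eliminating the strip of `x` with exponent 0 at `x` and 2 at the other inner vertices leaves a cubic
form in `a`, `b`. Only its coefficients `α` of `a²b` and `β` of `ab²` matter. One more triangle acts
on them, up to sign, by `(α, β) ↦ (β, -α - β)`, a map of order three that moves in step with the
3-colouring. Up to a scalar and cubes, the form is `a²b` if `x` is coloured like `a`, `ab²` if it is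
coloured like `b`, and `ab(a - b)` otherwise. With exponent 1 at `x` the forms are `a(a - b)`, `b(a
- b)` and `a² - b²`, the first two of which contain `ab` (`exists_eliminates`).

A path with interior vertices can absorb all its edges and leave a non-zero constant, while a single
edge `pq` leaves `p - q` (`exists_arcReduces`). So the question is about coefficients with exponents
at most 2 in a product of two forms and two such factors (`StripDecomposition.hasMonomial`). If both
paths are edges, the coefficient of `a²b²c²d²` is a non-zero multiple of `αβ' + βα'`, which vanishes
exactly when `x`, `y` are coloured like `a`, `c` or like `b`, `d`. In these cases exponent 1 at `y`
helps, because its form then contains `cd`.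

The decomposition comes from counting. Euler's formula and an outer face through all vertices give
`Σ len + 2 ≤ |V| + 2 · #faces` for the inner faces; faces glued together along edges satisfy the
opposite inequality (`Thin`). Equality (`tight_of_cover`) shows that every inner face is on a
shortest face path, and then that one such path through `f` contains all of them
(`mem_support_of_tight`). The faces thus form a chain with `f` strictly inside, each meeting the
union of its predecessors in exactly two vertices (`FaceChain.card_eq`), and the triangles on either
side of `f` are the strips. -/

open MvPolynomial in
/-- The factor `u - v` of an edge `uv`, where `u < v`. -/
noncomputable def edgeFactor {V : Type*} [LinearOrder V] : Sym2 V → MvPolynomial V ℤ :=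
  Sym2.lift ⟨fun u v => X (min u v) - X (max u v), fun u v => by
    simp only [min_comm, max_comm]⟩

/-! ### Edge factors and the graph polynomial -/

section EdgeFactor

open MvPolynomial

variable {V : Type*} [LinearOrder V]

/-- The order on the vertices enters only through this sign, which never affects non-vanishing. -/
lemma edgeFactor_eq_or_neg (u v : V) :
    ∃ s : ℤ, (s = 1 ∨ s = -1) ∧ edgeFactor s(u, v) = C s * (X u - X v) := by
  rcases le_total u v with h | h
  · exact ⟨1, Or.inl rfl, by simp [edgeFactor, h]⟩
  · exact ⟨-1, Or.inr rfl, by simp [edgeFactor, h]⟩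

lemma edgeFactor_mem_supported {u v : V} {s : Set V} (hu : u ∈ s) (hv : v ∈ s) :
    edgeFactor s(u, v) ∈ supported ℤ s := by
  obtain ⟨ε, -, h⟩ := edgeFactor_eq_or_neg u v
  rw [h]
  exact mul_mem (Subalgebra.algebraMap_mem _ ε)
    (sub_mem (X_mem_supported.2 hu) (X_mem_supported.2 hv))

open Classical in
lemma graphPolynomial_eq_prod_edgeFactor [Fintype V] (G : SimpleGraph V) :
    graphPolynomial G = ∏ e ∈ G.edgeFinset, edgeFactor e := by
  unfold graphPolynomial
  refine Finset.prod_bij (fun p _ => s(p.1, p.2)) ?_ ?_ ?_ ?_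
  · rintro ⟨u, v⟩ h
    simp only [Finset.mem_filter, Finset.mem_univ, true_and] at h
    simpa using h.2
  · rintro ⟨u, v⟩ h ⟨u', v'⟩ h' heq
    simp only [Finset.mem_filter, Finset.mem_univ, true_and] at h h'
    rcases Sym2.eq_iff.1 heq with ⟨h1, h2⟩ | ⟨h1, h2⟩
    · simp_all
    · simp only at h1 h2
      subst h1 h2
      exact absurd h.1 (not_lt.2 h'.1.le)
  · intro e
    induction e with
    | h u v =>
      intro h
      have hadj : G.Adj u v := by simpa using h
      rcases lt_or_gt_of_ne hadj.ne with hlt | hlt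
      · exact ⟨(u, v), by simp [hlt, hadj], rfl⟩
      · exact ⟨(v, u), by simp [hlt, hadj.symm], Sym2.eq_swap⟩
  · rintro ⟨u, v⟩ h
    simp only [Finset.mem_filter, Finset.mem_univ, true_and] at h
    simp [edgeFactor, h.1.le]

end EdgeFactor

/-! ### Reading off the coefficient of one variable -/

section Elimination

open MvPolynomial

variable {V : Type*}

lemma coeff_eq_zero_of_supported {R : MvPolynomial V ℤ} {s : Set V} (hR : R ∈ supported ℤ s)
    {m : V →₀ ℕ} {b : V} (hb : b ∉ s) (hm : m b ≠ 0) : coeff m R = 0 := by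
  by_contra h
  refine hb (mem_supported.1 hR ?_)
  simp only [Finset.mem_coe, mem_vars_iff_mem_support]
  exact ⟨m, mem_support_iff.2 h, Finsupp.mem_support_iff.2 hm⟩

/-- Extracting a power of the variable `b` from a polynomial `b ^ k * R` with `R` free of `b`. -/
lemma coeff_X_pow_mul_of_supported {R : MvPolynomial V ℤ} {b : V} (hR : R ∈ supported ℤ {b}ᶜ)
    (m : V →₀ ℕ) (k : ℕ) :
    coeff m (X b ^ k * R) = if m b = k then coeff (m.erase b) R else 0 := by
  classical
  rw [X_pow_eq_monomial, coeff_monomial_mul']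
  by_cases hk : m b = k
  · have hle : Finsupp.single b k ≤ m := by simp [hk]
    rw [if_pos hle, if_pos hk, one_mul]
    congr 1
    ext v
    by_cases hv : v = b
    · subst hv; simp [hk]
    · simp [hv]
  · rw [if_neg hk]
    split_ifs with hle
    · rw [one_mul]
      refine coeff_eq_zero_of_supported hR (b := b) (by simp) ?_
      have : k ≤ m b := by simpa using hle
      simp only [Finsupp.coe_tsub, Pi.sub_apply, Finsupp.single_eq_same]
      omega
    · rfl

/-- The `R k` do not contain `b`, so the exponent of `b` singles out one summand. Every elimination
of a vertex below is an application of this. -/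
lemma coeff_expansion {b : V} (m : V →₀ ℕ) (n : ℕ) (R : ℕ → MvPolynomial V ℤ)
    (hR : ∀ k < n, R k ∈ supported ℤ {b}ᶜ) (hm : m b < n) :
    coeff m (∑ k ∈ Finset.range n, X b ^ k * R k) = coeff (m.erase b) (R (m b)) := by
  rw [coeff_sum, Finset.sum_eq_single (m b)]
  · rw [coeff_X_pow_mul_of_supported (hR _ hm), if_pos rfl]
  · intro k hk hne
    rw [coeff_X_pow_mul_of_supported (hR _ (Finset.mem_range.1 hk)), if_neg hne.symm]
  · intro h
    exact absurd (Finset.mem_range.2 hm) h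

end Elimination

/-! ### Strips of triangles and the forms they leave -/

/-- A strip of triangles which starts with a triangle at `x` and ends with the edge `ab`; here `S`
is the set of vertices and `E` the set of edges. -/
inductive TriangleStrip {V : Type*} [DecidableEq V] (x : V) :
    V → V → Finset V → Finset (Sym2 V) → Prop
  | base {a b : V} : x ≠ a → x ≠ b → a ≠ b →
      TriangleStrip x a b {x, a, b} {s(x, a), s(x, b), s(a, b)}
  -- The triangle `zab` is glued to the end edge and `b` is retired; `swap` allows `a` to be retired
  -- instead.
  | step {a b z : V} {S : Finset V} {E : Finset (Sym2 V)} : TriangleStrip x a b S E → z ∉ S →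
      TriangleStrip x z a (insert z S) (insert s(z, a) (insert s(z, b) E))
  | swap {a b : V} {S : Finset V} {E : Finset (Sym2 V)} : TriangleStrip x a b S E →
      TriangleStrip x b a S E

namespace TriangleStrip

section

variable {V : Type*} [DecidableEq V] {x a b : V} {S : Finset V} {E : Finset (Sym2 V)}

lemma spec (h : TriangleStrip x a b S E) :
    x ∈ S ∧ a ∈ S ∧ b ∈ S ∧ x ≠ a ∧ x ≠ b ∧ a ≠ b ∧ s(a, b) ∈ E ∧
      ∀ e ∈ E, ∀ v ∈ e, v ∈ S := by
  induction h with
  | base h1 h2 h3 => simp_all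
  | @step a b z S E h hz ih =>
    obtain ⟨h1, h2, h3, h4, h5, h6, h7, h8⟩ := ih
    refine ⟨by simp [h1], by simp, by simp [h2], ?_, h4, ?_, by simp, ?_⟩
    · rintro rfl; exact hz h1
    · rintro rfl; exact hz h2
    · intro e he v hv
      simp only [Finset.mem_insert] at he ⊢
      rcases he with rfl | rfl | he
      · rcases Sym2.mem_iff.1 hv with rfl | rfl <;> simp [h2]
      · rcases Sym2.mem_iff.1 hv with rfl | rfl <;> simp [h3]
      · exact Or.inr (h8 e he v hv)
  | swap h ih =>
    obtain ⟨h1, h2, h3, h4, h5, h6, h7, h8⟩ := ih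
    exact ⟨h1, h3, h2, h5, h4, h6.symm, by rwa [Sym2.eq_swap], h8⟩

end

section

open MvPolynomial

variable {V : Type*} [LinearOrder V] {x a b : V} {S : Finset V} {E : Finset (Sym2 V)}

/-- After elimination of the inner vertices of a strip, with exponent `i` at `x` and exponent two
elsewhere, the polynomial `Φ` in the last two vertices is left. -/
def Eliminates (x a b : V) (S : Finset V) (E : Finset (Sym2 V)) (i : ℕ)
    (Φ : MvPolynomial V ℤ) : Prop :=
  ∀ Q ∈ supported ℤ {v : V | v ∉ S ∨ v = a ∨ v = b}, ∀ m : V →₀ ℕ, m x = i →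
    (∀ v ∈ S, v ≠ x → v ≠ a → v ≠ b → m v = 2) →
    coeff m ((∏ e ∈ E, edgeFactor e) * Q) =
      coeff (m.filter (fun v => v ∉ S ∨ v = a ∨ v = b)) (Φ * Q)

lemma Eliminates.swap {i : ℕ} {Φ : MvPolynomial V ℤ} (h : Eliminates x a b S E i Φ) :
    Eliminates x b a S E i Φ := by
  intro Q hQ m hm hm'
  have hset : ∀ v : V, (v ∉ S ∨ v = b ∨ v = a) ↔ (v ∉ S ∨ v = a ∨ v = b) := fun v => by tauto
  simp only [hset] at hQ ⊢
  exact h Q hQ m hm fun v hv h1 h2 h3 => hm' v hv h1 h3 h2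

/-- As a polynomial in `x`, `(x - a)(x - b)(a - b)` has constant coefficient `ab(a - b)` and linear
coefficient `-(a + b)(a - b)`. -/
lemma eliminates_base (hxa : x ≠ a) (hxb : x ≠ b) (hab : a ≠ b) :
    ∃ ε : ℤ, (ε = 1 ∨ ε = -1) ∧
      Eliminates x a b {x, a, b} {s(x, a), s(x, b), s(a, b)} 0
        (C ε * (X a ^ 2 * X b - X a * X b ^ 2)) ∧
      Eliminates x a b {x, a, b} {s(x, a), s(x, b), s(a, b)} 1
        (C ε * (X b ^ 2 - X a ^ 2)) := by
  obtain ⟨s₁, hs₁, h₁⟩ := edgeFactor_eq_or_neg x a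
  obtain ⟨s₂, hs₂, h₂⟩ := edgeFactor_eq_or_neg x b
  obtain ⟨s₃, hs₃, h₃⟩ := edgeFactor_eq_or_neg a b
  have hXa : (X a : MvPolynomial V ℤ) ∈ supported ℤ ({x}ᶜ : Set V) :=
    X_mem_supported.2 (by simpa using hxa.symm)
  have hXb : (X b : MvPolynomial V ℤ) ∈ supported ℤ ({x}ᶜ : Set V) :=
    X_mem_supported.2 (by simpa using hxb.symm)
  have hC : ∀ k : ℤ, (C k : MvPolynomial V ℤ) ∈ supported ℤ ({x}ᶜ : Set V) :=
    fun k => Subalgebra.algebraMap_mem _ k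
  have key : ∀ i < 2, Eliminates x a b {x, a, b} {s(x, a), s(x, b), s(a, b)} i
      (C (s₁ * s₂ * s₃) * (if i = 0 then X a ^ 2 * X b - X a * X b ^ 2
        else X b ^ 2 - X a ^ 2)) := by
    intro i hi Q hQ m hm hm'
    have hQx : Q ∈ supported ℤ ({x}ᶜ : Set V) := by
      refine supported_mono ?_ hQ
      rintro v (hv | rfl | rfl)
      · simp_all
      · simpa using hxa.symm
      · simpa using hxb.symm
    let R : ℕ → MvPolynomial V ℤ := fun k => C (s₁ * s₂ * s₃) *
      (if k = 0 then X a ^ 2 * X b - X a * X b ^ 2 else if k = 1 then X b ^ 2 - X a ^ 2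
        else X a - X b) * Q
    have hexp : (∏ e ∈ {s(x, a), s(x, b), s(a, b)}, edgeFactor e) * Q =
        ∑ k ∈ Finset.range 3, X x ^ k * R k := by
      rw [Finset.prod_insert, Finset.prod_insert, Finset.prod_singleton, h₁, h₂, h₃]
      · simp only [Finset.sum_range_succ, Finset.sum_range_zero, R, map_mul]
        norm_num
        ring
      · simp [hxa, hxb]
      · simp [hxa, hxb, hab]
    have hR : ∀ k < 3, R k ∈ supported ℤ ({x}ᶜ : Set V) := by
      intro k _
      refine mul_mem (mul_mem (hC _) ?_) hQx
      split_ifs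
      · exact sub_mem (mul_mem (pow_mem hXa _) hXb) (mul_mem hXa (pow_mem hXb _))
      · exact sub_mem (pow_mem hXb _) (pow_mem hXa _)
      · exact sub_mem hXa hXb
    rw [hexp, coeff_expansion m 3 R hR (by omega), hm]
    have hfil : m.filter (fun v => v ∉ ({x, a, b} : Finset V) ∨ v = a ∨ v = b) = m.erase x := by
      ext v
      by_cases hv : v = x
      · subst hv
        rw [Finsupp.filter_apply_neg]
        · simp
        · simp [hxa, hxb]
      · rw [Finsupp.filter_apply_pos, Finsupp.erase_ne hv]
        simp [hv]
        tauto
    rw [hfil]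
    simp only [R]
    interval_cases i <;> simp
  refine ⟨s₁ * s₂ * s₃, ?_, ?_, ?_⟩
  · rcases hs₁ with rfl | rfl <;> rcases hs₂ with rfl | rfl <;> rcases hs₃ with rfl | rfl <;> simp
  · simpa using key 0 (by norm_num)
  · simpa using key 1 (by norm_num)

/-- The new edges contribute `(z - a)(z - b)` up to sign, and `b` is retired by taking the
coefficient of `b²` in the product with the old form. The cubes do not reach this coefficient, so
`γ` and `δ` disappear. -/
lemma eliminates_step (h : TriangleStrip x a b S E) {z : V} (hz : z ∉ S) :
    ∃ ε : ℤ, (ε = 1 ∨ ε = -1) ∧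
      (∀ i α β γ δ, Eliminates x a b S E i
          (C α * (X a ^ 2 * X b) + C β * (X a * X b ^ 2) + C γ * X a ^ 3 + C δ * X b ^ 3) →
        Eliminates x z a (insert z S) (insert s(z, a) (insert s(z, b) E)) i
          (C (ε * β) * (X z ^ 2 * X a) + C (ε * (-α - β)) * (X z * X a ^ 2) + C 0 * X z ^ 3 +
            C (ε * α) * X a ^ 3)) ∧
      (∀ i α β γ, Eliminates x a b S E i
          (C α * X a ^ 2 + C β * (X a * X b) + C γ * X b ^ 2) →
        Eliminates x z a (insert z S) (insert s(z, a) (insert s(z, b) E)) i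
          (C (ε * γ) * X z ^ 2 + C (ε * (-β - γ)) * (X z * X a) + C (ε * β) * X a ^ 2)) := by
  obtain ⟨hx, ha, hb, hxa, hxb, hab, -, hE⟩ := h.spec
  obtain ⟨s₁, hs₁, h₁⟩ := edgeFactor_eq_or_neg z a
  obtain ⟨s₂, hs₂, h₂⟩ := edgeFactor_eq_or_neg z b
  have hza : z ≠ a := by rintro rfl; exact hz ha
  have hzb : z ≠ b := by rintro rfl; exact hz hb
  have hzx : z ≠ x := by rintro rfl; exact hz hx
  have hXa : (X a : MvPolynomial V ℤ) ∈ supported ℤ ({b}ᶜ : Set V) :=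
    X_mem_supported.2 (by simpa using hab)
  have hXz : (X z : MvPolynomial V ℤ) ∈ supported ℤ ({b}ᶜ : Set V) :=
    X_mem_supported.2 (by simpa using hzb)
  have hC : ∀ (t : Set V) (k : ℤ), (C k : MvPolynomial V ℤ) ∈ supported ℤ t :=
    fun t k => Subalgebra.algebraMap_mem _ k
  have hprod : (∏ e ∈ insert s(z, a) (insert s(z, b) E), edgeFactor e) =
      (∏ e ∈ E, edgeFactor e) * (C (s₁ * s₂) * ((X z - X a) * (X z - X b))) := by
    rw [Finset.prod_insert, Finset.prod_insert, h₁, h₂]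
    · simp only [map_mul]; ring
    · intro he
      exact hz (hE _ he z (by simp))
    · simp only [Finset.mem_insert, not_or]
      refine ⟨by simp [hab, hza.symm, hzb], fun he => hz (hE _ he z (by simp))⟩
  -- The forms to be used have degree at most three in `b` and the new factor has degree one, hence
  -- five coefficients; the exponent two of `b` selects `R 2`.
  have key : ∀ (i : ℕ) (Φ Ψ : MvPolynomial V ℤ) (R : ℕ → MvPolynomial V ℤ),
      Eliminates x a b S E i Φ → (∀ k < 5, R k ∈ supported ℤ ({b}ᶜ : Set V)) →
      Φ * (C (s₁ * s₂) * ((X z - X a) * (X z - X b))) = ∑ k ∈ Finset.range 5, X b ^ k * R k →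
      R 2 = Ψ →
      Eliminates x z a (insert z S) (insert s(z, a) (insert s(z, b) E)) i Ψ := by
    rintro i Φ _ R hΦ hR hexp rfl Q hQ m hm hm'
    have hQb : Q ∈ supported ℤ ({b}ᶜ : Set V) := by
      refine supported_mono ?_ hQ
      rintro v (hv | rfl | rfl)
      · simp only [Finset.mem_insert, not_or] at hv
        rintro rfl
        exact hv.2 hb
      · simpa using hzb
      · simpa using hab
    have hQ' : C (s₁ * s₂) * ((X z - X a) * (X z - X b)) * Q ∈
        supported ℤ {v : V | v ∉ S ∨ v = a ∨ v = b} := by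
      refine mul_mem (mul_mem (hC _ _) (mul_mem ?_ ?_)) (supported_mono ?_ hQ)
      · exact sub_mem (X_mem_supported.2 (Or.inl hz)) (X_mem_supported.2 (by simp))
      · exact sub_mem (X_mem_supported.2 (Or.inl hz)) (X_mem_supported.2 (by simp))
      · rintro v (hv | rfl | rfl)
        · simp only [Finset.mem_insert, not_or] at hv
          exact Or.inl hv.2
        · exact Or.inl hz
        · simp
    have hm2 : ∀ v ∈ S, v ≠ x → v ≠ a → m v = 2 := fun v hv h1 h2 =>
      hm' v (by simp [hv]) h1 (by rintro rfl; exact hz hv) h2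
    rw [hprod, mul_assoc, hΦ _ hQ' m hm (fun v hv h1 h2 _ => hm2 v hv h1 h2), ← mul_assoc, hexp,
      Finset.sum_mul]
    have hmb : (m.filter (fun v => v ∉ S ∨ v = a ∨ v = b)) b = 2 := by
      rw [Finsupp.filter_apply_pos _ _ (by simp)]
      exact hm2 b hb hxb.symm hab.symm
    have := coeff_expansion (m.filter (fun v => v ∉ S ∨ v = a ∨ v = b)) 5 (fun k => R k * Q)
      (b := b) (fun k hk => mul_mem (hR k hk) hQb) (by omega)
    simp only [← mul_assoc, hmb] at this
    rw [this]
    congr 1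
    ext v
    by_cases hvb : v = b
    · subst hvb
      rw [Finsupp.erase_same, Finsupp.filter_apply_neg]
      simp [hb, hab.symm, hzb.symm]
    · rw [Finsupp.erase_ne hvb]
      by_cases hv : v ∉ S ∨ v = a
      · rw [Finsupp.filter_apply_pos _ _ (by tauto), Finsupp.filter_apply_pos]
        rcases hv with hv | rfl
        · simp only [Finset.mem_insert]; tauto
        · simp
      · rw [Finsupp.filter_apply_neg _ _ (by tauto), Finsupp.filter_apply_neg]
        simp only [not_or, not_not] at hv
        rintro (hv' | rfl | hv')
        · exact hv' (Finset.mem_insert_of_mem hv.1)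
        · exact hz hv.1
        · exact hv.2 hv'
  refine ⟨s₁ * s₂, ?_, ?_, ?_⟩
  · rcases hs₁ with rfl | rfl <;> rcases hs₂ with rfl | rfl <;> simp
  · intro i α β γ δ hΦ
    refine key i _ _ (fun k => C (s₁ * s₂) * (X z - X a) *
      (match k with
        | 0 => C γ * X a ^ 3 * X z
        | 1 => C α * X a ^ 2 * X z - C γ * X a ^ 3
        | 2 => C β * X a * X z - C α * X a ^ 2
        | 3 => C δ * X z - C β * X a
        | _ => - C δ)) hΦ ?_ ?_ ?_
    · intro k _
      refine mul_mem (mul_mem (hC _ _) (sub_mem hXz hXa)) ?_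
      match k with
      | 0 => exact mul_mem (mul_mem (hC _ _) (pow_mem hXa _)) hXz
      | 1 => exact sub_mem (mul_mem (mul_mem (hC _ _) (pow_mem hXa _)) hXz)
              (mul_mem (hC _ _) (pow_mem hXa _))
      | 2 => exact sub_mem (mul_mem (mul_mem (hC _ _) hXa) hXz) (mul_mem (hC _ _) (pow_mem hXa _))
      | 3 => exact sub_mem (mul_mem (hC _ _) hXz) (mul_mem (hC _ _) hXa)
      | k + 4 => exact neg_mem (hC _ _)
    · simp only [Finset.sum_range_succ, Finset.sum_range_zero]
      ring
    · simp only [map_mul, map_sub, map_neg, map_zero]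
      ring
  · intro i α β γ hΦ
    refine key i _ _ (fun k => C (s₁ * s₂) * (X z - X a) *
      (match k with
        | 0 => C α * X a ^ 2 * X z
        | 1 => C β * X a * X z - C α * X a ^ 2
        | 2 => C γ * X z - C β * X a
        | 3 => - C γ
        | _ => 0)) hΦ ?_ ?_ ?_
    · intro k _
      refine mul_mem (mul_mem (hC _ _) (sub_mem hXz hXa)) ?_
      match k with
      | 0 => exact mul_mem (mul_mem (hC _ _) (pow_mem hXa _)) hXz
      | 1 => exact sub_mem (mul_mem (mul_mem (hC _ _) hXa) hXz) (mul_mem (hC _ _) (pow_mem hXa _))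
      | 2 => exact sub_mem (mul_mem (hC _ _) hXz) (mul_mem (hC _ _) hXa)
      | 3 => exact neg_mem (hC _ _)
      | k + 4 => exact zero_mem _
    · simp only [Finset.sum_range_succ, Finset.sum_range_zero]
      ring
    · simp only [map_mul, map_sub, map_neg]
      ring

/-- The polynomials left after eliminating a strip, in terms of a proper 3-colouring. -/
theorem exists_eliminates (h : TriangleStrip x a b S E) (c : V → Fin 3)
    (hc : ∀ u v, s(u, v) ∈ E → c u ≠ c v) :
    ∃ ε α β γ δ α' β' γ' : ℤ, ε ≠ 0 ∧
      (c x = c a ∧ α = ε ∧ β = 0 ∧ β' ≠ 0 ∨ c x = c b ∧ α = 0 ∧ β = ε ∧ β' ≠ 0 ∨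
        c x ≠ c a ∧ c x ≠ c b ∧ α = ε ∧ β = -ε) ∧
      Eliminates x a b S E 0
        (C α * (X a ^ 2 * X b) + C β * (X a * X b ^ 2) + C γ * X a ^ 3 + C δ * X b ^ 3) ∧
      Eliminates x a b S E 1 (C α' * X a ^ 2 + C β' * (X a * X b) + C γ' * X b ^ 2) := by
  -- The induction needs the whole quadratic form and not only `β' ≠ 0`. The two scalars are
  -- separate because a step may change their signs differently.
  suffices H : ∃ ε ε' α β γ δ α' β' γ' : ℤ, ε ≠ 0 ∧ ε' ≠ 0 ∧
      (c x = c a ∧ α = ε ∧ β = 0 ∧ α' = ε' ∧ β' = -ε' ∧ γ' = 0 ∨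
        c x = c b ∧ α = 0 ∧ β = ε ∧ α' = 0 ∧ β' = ε' ∧ γ' = -ε' ∨
        c x ≠ c a ∧ c x ≠ c b ∧ α = ε ∧ β = -ε ∧ α' = ε' ∧ β' = 0 ∧ γ' = -ε') ∧
      Eliminates x a b S E 0
        (C α * (X a ^ 2 * X b) + C β * (X a * X b ^ 2) + C γ * X a ^ 3 + C δ * X b ^ 3) ∧
      Eliminates x a b S E 1 (C α' * X a ^ 2 + C β' * (X a * X b) + C γ' * X b ^ 2) by
    obtain ⟨ε, ε', α, β, γ, δ, α', β', γ', hε, hε', h1, h2, h3⟩ := H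
    refine ⟨ε, α, β, γ, δ, α', β', γ', hε, ?_, h2, h3⟩
    rcases h1 with ⟨h1, h2, h3, h4, h5, h6⟩ | ⟨h1, h2, h3, h4, h5, h6⟩ |
      ⟨h1, h2, h3, h4, h5, h6, h7⟩
    · exact Or.inl ⟨h1, h2, h3, by simpa [h5] using hε'⟩
    · exact Or.inr (Or.inl ⟨h1, h2, h3, by simpa [h5] using hε'⟩)
    · exact Or.inr (Or.inr ⟨h1, h2, h3, h4⟩)
  induction h with
  | @base a b h1 h2 h3 =>
    obtain ⟨ε, hε, he0, he1⟩ := eliminates_base h1 h2 h3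
    have hε0 : ε ≠ 0 := by rcases hε with rfl | rfl <;> norm_num
    refine ⟨ε, -ε, ε, -ε, 0, 0, -ε, 0, ε, hε0, neg_ne_zero.2 hε0,
      Or.inr (Or.inr ⟨hc x a (by simp), hc x b (by simp), by simp⟩), ?_, ?_⟩
    · convert he0 using 1
      simp only [map_neg, map_zero]; ring
    · convert he1 using 1
      simp only [map_neg, map_zero]; ring
  | @step a b z S E h hz ih =>
    obtain ⟨ε, ε', α, β, γ, δ, α', β', γ', hε, hε', hcol, he0, he1⟩ :=
      ih fun u v huv => hc u v (by simp [huv])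
    obtain ⟨s, hs, hs0, hs1⟩ := eliminates_step h hz
    have hs' : s ≠ 0 := by rcases hs with rfl | rfl <;> norm_num
    have hza : c z ≠ c a := hc z a (by simp)
    have hzb : c z ≠ c b := hc z b (by simp)
    have hab : c a ≠ c b := hc a b (by simp [h.spec.2.2.2.2.2.2.1])
    -- The end edge changes from `ab` to `za`. If `x` is coloured like `a`, it is now coloured like
    -- the second end; if like `b`, then like neither end; if like neither, then like `z`, as only
    -- three colours exist. The coefficient vectors run through the same cycle.
    rcases hcol with ⟨h1, rfl, rfl, rfl, rfl, rfl⟩ | ⟨h1, rfl, rfl, rfl, rfl, rfl⟩ |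
      ⟨h1, h2, rfl, rfl, rfl, rfl, rfl⟩
    · refine ⟨_, s * α', _, _, _, _, _, _, _, mul_ne_zero hs' (neg_ne_zero.2 hε),
        mul_ne_zero hs' hε', Or.inr (Or.inl ⟨h1, ?_, ?_, ?_, ?_, ?_⟩), hs0 _ _ _ _ _ he0,
        hs1 _ _ _ _ he1⟩ <;> ring
    · refine ⟨s * β, s * -β', _, _, _, _, _, _, _, mul_ne_zero hs' hε,
        mul_ne_zero hs' (neg_ne_zero.2 hε'),
        Or.inr (Or.inr ⟨by rw [h1]; exact hzb.symm, by rw [h1]; exact hab.symm,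
          ?_, ?_, ?_, ?_, ?_⟩), hs0 _ _ _ _ _ he0, hs1 _ _ _ _ he1⟩ <;> ring
    · have h3 : c x = c z := by
        generalize c x = p at *
        generalize c a = q at *
        generalize c b = r at *
        generalize c z = t at *
        clear * - h1 h2 hza hzb hab
        revert p q r t
        decide
      refine ⟨s * -α, s * -α', _, _, _, _, _, _, _, mul_ne_zero hs' (neg_ne_zero.2 hε),
        mul_ne_zero hs' (neg_ne_zero.2 hε'),
        Or.inl ⟨h3, ?_, ?_, ?_, ?_, ?_⟩, hs0 _ _ _ _ _ he0, hs1 _ _ _ _ he1⟩ <;> ring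
  | @swap a b S E h ih =>
    obtain ⟨ε, ε', α, β, γ, δ, α', β', γ', hε, hε', hcol, he0, he1⟩ := ih hc
    have he0' := he0.swap
    have he1' := he1.swap
    have e0 : ∀ α β γ δ : ℤ, (C α * (X a ^ 2 * X b) + C β * (X a * X b ^ 2) + C γ * X a ^ 3 +
        C δ * X b ^ 3 : MvPolynomial V ℤ) =
        C β * (X b ^ 2 * X a) + C α * (X b * X a ^ 2) + C δ * X b ^ 3 + C γ * X a ^ 3 := by
      intros; ring
    have e1 : ∀ α β γ : ℤ, (C α * X a ^ 2 + C β * (X a * X b) + C γ * X b ^ 2 :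
        MvPolynomial V ℤ) = C γ * X b ^ 2 + C β * (X b * X a) + C α * X a ^ 2 := by
      intros; ring
    rw [e0] at he0'
    rw [e1] at he1'
    rcases hcol with ⟨h1, rfl, rfl, rfl, rfl, rfl⟩ | ⟨h1, rfl, rfl, rfl, rfl, rfl⟩ |
      ⟨h1, h2, rfl, rfl, rfl, rfl, rfl⟩
    · exact ⟨α, -α', _, _, _, _, _, _, _, hε, neg_ne_zero.2 hε',
        Or.inr (Or.inl ⟨h1, rfl, rfl, rfl, by ring, by ring⟩), he0', he1'⟩
    · exact ⟨β, -β', _, _, _, _, _, _, _, hε, neg_ne_zero.2 hε',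
        Or.inl ⟨h1, rfl, rfl, by ring, by ring, rfl⟩, he0', he1'⟩
    · exact ⟨-α, -α', _, _, _, _, _, _, _, neg_ne_zero.2 hε, neg_ne_zero.2 hε',
        Or.inr (Or.inr ⟨h2, h1, by ring, by ring, by ring, by ring, by ring⟩), he0', he1'⟩

end

end TriangleStrip

/-! ### Elimination of the paths around the face -/

section Arcs

open MvPolynomial

variable {V : Type*} [LinearOrder V]

/-- The vertex `u 0` occurs only in the first edge, so exponent one forces it to be chosen there.
This removes that edge, and `u 1` is then in the same position: each vertex is chosen from the edge
ahead of it. -/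
lemma coeff_path_mul (n : ℕ) : ∀ u : ℕ → V, Set.InjOn u (Set.Iic n) →
    ∃ ε : ℤ, ε ≠ 0 ∧ ∀ Q ∈ supported ℤ {v : V | v ∉ (Finset.range n).image u}, ∀ m : V →₀ ℕ,
      (∀ v ∈ (Finset.range n).image u, m v = 1) →
      coeff m ((∏ j ∈ Finset.range n, edgeFactor s(u j, u (j + 1))) * Q) =
        coeff (m.filter (fun v => v ∉ (Finset.range n).image u)) (C ε * Q) := by
  induction n with
  | zero =>
    intro u _
    refine ⟨1, one_ne_zero, fun Q _ m _ => ?_⟩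
    simp only [Finset.range_zero, Finset.prod_empty, one_mul, map_one, Finset.image_empty]
    congr 1
    ext v
    simp
  | succ n ih =>
    intro u hu
    have hu' : Set.InjOn (fun j => u (j + 1)) (Set.Iic n) := by
      intro i hi j hj hij
      have := hu (x₁ := i + 1) (x₂ := j + 1) (by simpa using hi) (by simpa using hj) hij
      omega
    obtain ⟨ε, hε, h⟩ := ih _ hu'
    obtain ⟨s, hs, hs'⟩ := edgeFactor_eq_or_neg (u 0) (u 1)
    refine ⟨ε * s, mul_ne_zero hε (by rcases hs with rfl | rfl <;> norm_num), ?_⟩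
    intro Q hQ m hm
    have hne : ∀ j, 1 ≤ j → j ≤ n + 1 → u j ≠ u 0 := fun j h1 h2 h3 => by
      have := hu (x₁ := j) (x₂ := 0) (by simpa using h2) (by simp) h3
      omega
    have himg : ∀ v, v ∈ (Finset.range (n + 1)).image u ↔
        v = u 0 ∨ v ∈ (Finset.range n).image (fun j => u (j + 1)) := by
      intro v
      simp only [Finset.mem_image, Finset.mem_range]
      constructor
      · rintro ⟨_ | j, hj, rfl⟩
        · exact Or.inl rfl
        · exact Or.inr ⟨j, by omega, rfl⟩
      · rintro (rfl | ⟨j, hj, rfl⟩)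
        · exact ⟨0, by omega, rfl⟩
        · exact ⟨j + 1, by omega, rfl⟩
    have hQ0 : Q ∈ supported ℤ ({u 0}ᶜ : Set V) := by
      refine supported_mono ?_ hQ
      rintro v hv rfl
      exact hv ((himg _).2 (Or.inl rfl))
    have hQ1 : Q ∈ supported ℤ {v : V | v ∉ (Finset.range n).image (fun j => u (j + 1))} := by
      refine supported_mono ?_ hQ
      intro v hv hv'
      exact hv ((himg _).2 (Or.inr hv'))
    set T := ∏ j ∈ Finset.range n, edgeFactor s(u (j + 1), u (j + 1 + 1)) with hT
    have hT0 : T ∈ supported ℤ ({u 0}ᶜ : Set V) := by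
      refine prod_mem fun j hj => ?_
      have := Finset.mem_range.1 hj
      exact edgeFactor_mem_supported (hne _ (by omega) (by omega)) (hne _ (by omega) (by omega))
    have h1 : (X (u 1) : MvPolynomial V ℤ) ∈ supported ℤ ({u 0}ᶜ : Set V) :=
      X_mem_supported.2 (hne 1 le_rfl (by omega))
    have hexp : (∏ j ∈ Finset.range (n + 1), edgeFactor s(u j, u (j + 1))) * Q =
        ∑ k ∈ Finset.range 2, X (u 0) ^ k *
          ((if k = 0 then - X (u 1) else 1) * (T * (C s * Q))) := by
      rw [Finset.prod_range_succ', ← hT, zero_add, hs']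
      simp only [Finset.sum_range_succ, Finset.sum_range_zero]
      norm_num
      ring
    have hm0 : m (u 0) = 1 := hm _ ((himg _).2 (Or.inl rfl))
    have hC : (C s : MvPolynomial V ℤ) ∈ supported ℤ ({u 0}ᶜ : Set V) :=
      Subalgebra.algebraMap_mem _ s
    rw [hexp, coeff_expansion m 2 _ ?_ (by omega), hm0, if_neg one_ne_zero, one_mul, h]
    · rw [map_mul, mul_assoc]
      congr 1
      ext v
      by_cases hv : v = u 0
      · subst hv
        simp only [Finsupp.filter_apply, himg, true_or, not_true_eq_false, if_false,
          Finsupp.erase_same, ite_self]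
      · simp only [Finsupp.filter_apply, himg, hv, false_or, Finsupp.erase_ne hv]
    · exact mul_mem (Subalgebra.algebraMap_mem _ s) hQ1
    · intro v hv
      rw [Finsupp.erase_ne]
      · exact hm v ((himg _).2 (Or.inr hv))
      · rintro rfl
        obtain ⟨j, hj, hj'⟩ := Finset.mem_image.1 hv
        have := Finset.mem_range.1 hj
        exact hne _ (by omega) (by omega) hj'
    · intro k _
      refine mul_mem ?_ (mul_mem hT0 (mul_mem hC hQ0))
      split_ifs
      · exact neg_mem h1
      · exact one_mem _

/-- After elimination of the inner vertices `I` of a path from `p` to `q` with polynomial `P`,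
the factor `ρ` is left, which is constant unless the path is an edge. -/
def ArcReduces (G : SimpleGraph V) (p q : V) (I : Finset V) (P ρ : MvPolynomial V ℤ) : Prop :=
  P ∈ supported ℤ {v : V | v ∈ I ∨ v = p ∨ v = q} ∧
  (∃ ε : ℤ, ε ≠ 0 ∧ (ρ = C ε ∨ G.Adj p q ∧ ρ = C ε * (X p - X q))) ∧
  ∃ t : V → ℕ, (∀ v, t v ≤ 2) ∧
    ∀ Q ∈ supported ℤ {v : V | v ∉ I}, ∀ m : V →₀ ℕ, (∀ v ∈ I, m v = t v) →
      coeff m (P * Q) = coeff (m.filter (· ∉ I)) (ρ * Q)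

lemma ArcReduces.symm {G : SimpleGraph V} {p q : V} {I : Finset V} {P ρ : MvPolynomial V ℤ}
    (h : ArcReduces G p q I P ρ) : ArcReduces G q p I P ρ := by
  obtain ⟨h1, ⟨ε, hε, h2⟩, h3⟩ := h
  refine ⟨supported_mono (fun v hv => by rcases hv with h | h | h <;> simp [h]) h1, ?_, h3⟩
  rcases h2 with h2 | ⟨hadj, h2⟩
  · exact ⟨ε, hε, Or.inl h2⟩
  · refine ⟨-ε, neg_ne_zero.2 hε, Or.inr ⟨hadj.symm, ?_⟩⟩
    rw [h2, map_neg]; ring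

/-- If there are interior vertices, `u 1` absorbs both its edges with exponent two and each later
interior vertex absorbs the edge ahead of it, so the ends receive nothing and a constant is left. A
single edge has nothing to absorb it, and its factor survives. -/
theorem exists_arcReduces (G : SimpleGraph V) (k : ℕ) (hk : 1 ≤ k) (u : ℕ → V)
    (hu : Set.InjOn u (Set.Iic k)) (hadj : ∀ j < k, G.Adj (u j) (u (j + 1))) :
    ∃ ρ, ArcReduces G (u 0) (u k) ((Finset.Ioo 0 k).image u)
      (∏ j ∈ Finset.range k, edgeFactor s(u j, u (j + 1))) ρ := by
  have hsupp : (∏ j ∈ Finset.range k, edgeFactor s(u j, u (j + 1))) ∈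
      supported ℤ {v : V | v ∈ (Finset.Ioo 0 k).image u ∨ v = u 0 ∨ v = u k} := by
    have hmem : ∀ j ≤ k, u j ∈ {v : V | v ∈ (Finset.Ioo 0 k).image u ∨ v = u 0 ∨ v = u k} := by
      intro j hj
      rcases Nat.eq_zero_or_pos j with rfl | h0
      · simp
      · rcases hj.eq_or_lt with rfl | h1
        · simp
        · exact Or.inl (Finset.mem_image_of_mem _ (Finset.mem_Ioo.2 ⟨h0, h1⟩))
    refine prod_mem fun j hj => ?_
    have := Finset.mem_range.1 hj
    exact edgeFactor_mem_supported (hmem _ (by omega)) (hmem _ (by omega))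
  obtain rfl | ⟨n, rfl⟩ : k = 1 ∨ ∃ n, k = n + 2 := by
    rcases hk.eq_or_lt with h | h
    · exact Or.inl h.symm
    · exact Or.inr ⟨k - 2, by omega⟩
  · obtain ⟨s, hs, hs'⟩ := edgeFactor_eq_or_neg (u 0) (u 1)
    refine ⟨C s * (X (u 0) - X (u 1)), hsupp,
      ⟨s, by rcases hs with rfl | rfl <;> norm_num, Or.inr ⟨hadj 0 one_pos, rfl⟩⟩,
      fun _ => 0, by simp, fun Q _ m _ => ?_⟩
    have : Finset.Ioo 0 1 = ∅ := by decide
    rw [Finset.prod_range_one, hs', this]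
    congr 1
    ext v
    simp
  · have hu' : Set.InjOn (fun j => u (j + 2)) (Set.Iic n) := by
      intro i hi j hj hij
      have := hu (x₁ := i + 2) (x₂ := j + 2) (by simpa using hi) (by simpa using hj) hij
      omega
    have hne : ∀ j, j ≠ 1 → j ≤ n + 2 → u j ≠ u 1 := fun j h1 h2 h3 => by
      have := hu (x₁ := j) (x₂ := 1) (by simpa using h2) (by simp) h3
      omega
    obtain ⟨ε, hε, h⟩ := coeff_path_mul n _ hu'
    obtain ⟨s₁, hs₁, h₁⟩ := edgeFactor_eq_or_neg (u 0) (u 1)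
    obtain ⟨s₂, hs₂, h₂⟩ := edgeFactor_eq_or_neg (u 1) (u 2)
    have himg : ∀ v, v ∈ (Finset.Ioo 0 (n + 2)).image u ↔
        v = u 1 ∨ v ∈ (Finset.range n).image (fun j => u (j + 2)) := by
      intro v
      simp only [Finset.mem_image, Finset.mem_Ioo, Finset.mem_range]
      constructor
      · rintro ⟨j, ⟨h1, h2⟩, rfl⟩
        rcases (Nat.succ_le_of_lt h1).eq_or_lt with h | h
        · exact Or.inl (by rw [← h])
        · exact Or.inr ⟨j - 2, by omega, by congr 1; omega⟩
      · rintro (rfl | ⟨j, hj, rfl⟩)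
        · exact ⟨1, by omega, rfl⟩
        · exact ⟨j + 2, by omega, rfl⟩
    refine ⟨C (ε * -(s₁ * s₂)), hsupp, ⟨_, mul_ne_zero hε (neg_ne_zero.2 (mul_ne_zero ?_ ?_)),
      Or.inl rfl⟩, fun v => if v = u 1 then 2 else 1, fun v => by dsimp only; split_ifs <;> norm_num, ?_⟩
    · rcases hs₁ with rfl | rfl <;> norm_num
    · rcases hs₂ with rfl | rfl <;> norm_num
    intro Q hQ m hm
    dsimp only at hm
    have hQ1 : Q ∈ supported ℤ ({u 1}ᶜ : Set V) := by
      refine supported_mono ?_ hQ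
      rintro v hv rfl
      exact hv ((himg _).2 (Or.inl rfl))
    have hQ2 : Q ∈ supported ℤ {v : V | v ∉ (Finset.range n).image (fun j => u (j + 2))} := by
      refine supported_mono ?_ hQ
      intro v hv hv'
      exact hv ((himg _).2 (Or.inr hv'))
    set T := ∏ j ∈ Finset.range n, edgeFactor s(u (j + 2), u (j + 1 + 2)) with hT
    have hT1 : T ∈ supported ℤ ({u 1}ᶜ : Set V) := by
      refine prod_mem fun j hj => ?_
      have := Finset.mem_range.1 hj
      exact edgeFactor_mem_supported (hne _ (by omega) (by omega)) (hne _ (by omega) (by omega))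
    have hX0 : (X (u 0) : MvPolynomial V ℤ) ∈ supported ℤ ({u 1}ᶜ : Set V) :=
      X_mem_supported.2 (hne 0 (by omega) (by omega))
    have hX2 : (X (u 2) : MvPolynomial V ℤ) ∈ supported ℤ ({u 1}ᶜ : Set V) :=
      X_mem_supported.2 (hne 2 (by omega) (by omega))
    have hC : ∀ s : ℤ, (C s : MvPolynomial V ℤ) ∈ supported ℤ ({u 1}ᶜ : Set V) :=
      fun s => Subalgebra.algebraMap_mem _ s
    have hexp : (∏ j ∈ Finset.range (n + 2), edgeFactor s(u j, u (j + 1))) * Q =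
        ∑ k ∈ Finset.range 3, X (u 1) ^ k *
          ((if k = 0 then X (u 0) * X (u 2) else if k = 1 then - (X (u 0) + X (u 2)) else 1) *
            (T * (C (-(s₁ * s₂)) * Q))) := by
      rw [Finset.prod_range_succ', Finset.prod_range_succ', zero_add, h₁, h₂]
      have : (∏ j ∈ Finset.range n, edgeFactor s(u (j + 1 + 1), u (j + 1 + 1 + 1))) = T := rfl
      rw [this]
      simp only [Finset.sum_range_succ, Finset.sum_range_zero, map_mul, map_neg]
      norm_num
      ring
    have hm1 : m (u 1) = 2 := by rw [hm _ ((himg _).2 (Or.inl rfl)), if_pos rfl]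
    rw [hexp, coeff_expansion m 3 _ ?_ (by omega), hm1, if_neg two_ne_zero, if_neg (by norm_num),
      one_mul, h]
    · rw [← mul_assoc, ← map_mul]
      congr 1
      ext v
      by_cases hv : v = u 1
      · subst hv
        simp only [Finsupp.filter_apply, himg, true_or, not_true_eq_false, if_false,
          Finsupp.erase_same, ite_self]
      · simp only [Finsupp.filter_apply, himg, hv, false_or, Finsupp.erase_ne hv]
    · exact mul_mem (Subalgebra.algebraMap_mem _ _) hQ2
    · intro v hv
      have hv1 : v ≠ u 1 := by
        rintro rfl
        obtain ⟨j, hj, hj'⟩ := Finset.mem_image.1 hv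
        have := Finset.mem_range.1 hj
        exact hne _ (by omega) (by omega) hj'
      rw [Finsupp.erase_ne hv1, hm v ((himg _).2 (Or.inr hv)), if_neg hv1]
    · intro k _
      refine mul_mem ?_ (mul_mem hT1 (mul_mem (hC _) hQ1))
      split_ifs
      · exact mul_mem hX0 hX2
      · exact neg_mem (add_mem hX0 hX2)
      · exact one_mem _

end Arcs

/-! ### Joining the four pieces -/

section Decomposition

open MvPolynomial

variable {V : Type*} [LinearOrder V]

/-- A decomposition of the edges of `G` into two strips of triangles, from `x` to `ab` and from `y`
to `cd`, and two disjoint paths, from `a` to `c` and from `b` to `d`. -/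
structure StripDecomposition [Fintype V] (G : SimpleGraph V) (x y a b c d : V)
    (SL SR IA IB : Finset V) (EL ER : Finset (Sym2 V)) (PA PB ρA ρB : MvPolynomial V ℤ) :
    Prop where
  left : TriangleStrip x a b SL EL
  right : TriangleStrip y c d SR ER
  arc_ac : ArcReduces G a c IA PA ρA
  arc_bd : ArcReduces G b d IB PB ρB
  disj : Disjoint SL SR
  disj_left_ac : Disjoint SL IA
  disj_left_bd : Disjoint SL IB
  disj_right_ac : Disjoint SR IA
  disj_right_bd : Disjoint SR IB
  disj_ac_bd : Disjoint IA IB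
  cover : ∀ v, v ∈ SL ∨ v ∈ SR ∨ v ∈ IA ∨ v ∈ IB
  prod_eq : graphPolynomial G =
    (∏ e ∈ EL, edgeFactor e) * (∏ e ∈ ER, edgeFactor e) * PA * PB

namespace StripDecomposition

variable {G : SimpleGraph V} {x y a b c d : V} {SL SR IA IB : Finset V}
  {EL ER : Finset (Sym2 V)} {PA PB ρA ρB : MvPolynomial V ℤ}

lemma prod_mem_supported {S : Finset V} {E : Finset (Sym2 V)} (h : TriangleStrip x a b S E)
    {s : Set V} (hs : ∀ v ∈ S, v ∈ s) : (∏ e ∈ E, edgeFactor e) ∈ supported ℤ s := by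
  refine prod_mem fun e he => ?_
  have := h.spec.2.2.2.2.2.2.2 e he
  induction e with
  | h u v => exact edgeFactor_mem_supported (hs _ (this u (by simp))) (hs _ (this v (by simp)))

lemma arc_mem_supported {p q : V} {ε : ℤ} {ρ : MvPolynomial V ℤ}
    (h : ρ = C ε ∨ G.Adj p q ∧ ρ = C ε * (X p - X q)) {s : Set V} (hp : p ∈ s) (hq : q ∈ s) :
    ρ ∈ supported ℤ s := by
  rcases h with rfl | ⟨-, rfl⟩
  · exact Subalgebra.algebraMap_mem _ _
  · exact mul_mem (Subalgebra.algebraMap_mem _ _)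
      (sub_mem (X_mem_supported.2 hp) (X_mem_supported.2 hq))

variable [Fintype V]

lemma swap (D : StripDecomposition G x y a b c d SL SR IA IB EL ER PA PB ρA ρB) :
    StripDecomposition G x y b a d c SL SR IB IA EL ER PB PA ρB ρA where
  left := D.left.swap
  right := D.right.swap
  arc_ac := D.arc_bd
  arc_bd := D.arc_ac
  disj := D.disj
  disj_left_ac := D.disj_left_bd
  disj_left_bd := D.disj_left_ac
  disj_right_ac := D.disj_right_bd
  disj_right_bd := D.disj_right_ac
  disj_ac_bd := D.disj_ac_bd.symm
  cover v := by have := D.cover v; tauto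
  prod_eq := by rw [D.prod_eq]; ring

/-- The exponent vector with the exponents `i, j, k, l` at `a, b, c, d`. -/
noncomputable def exponents (a b c d : V) (n : ℕ × ℕ × ℕ × ℕ) : V →₀ ℕ :=
  Finsupp.single a n.1 + Finsupp.single b n.2.1 + Finsupp.single c n.2.2.1 +
    Finsupp.single d n.2.2.2

/-- The pieces overlap at most in `a, b, c, d`, so each can be eliminated with the others taking the
place of the free factor `Q`. What remains is a coefficient in these four variables. -/
theorem hasMonomial (D : StripDecomposition G x y a b c d SL SR IA IB EL ER PA PB ρA ρB)
    {j : ℕ} {Φ Ψ : MvPolynomial V ℤ} (hΦ : TriangleStrip.Eliminates x a b SL EL 0 Φ)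
    (hΨ : TriangleStrip.Eliminates y c d SR ER j Ψ)
    (hΦs : ∀ s : Set V, a ∈ s → b ∈ s → Φ ∈ supported ℤ s)
    (hΨs : ∀ s : Set V, c ∈ s → d ∈ s → Ψ ∈ supported ℤ s)
    (n : ℕ × ℕ × ℕ × ℕ) (hna : n.1 ≤ 2) (hnb : n.2.1 ≤ 2) (hnc : n.2.2.1 ≤ 2) (hnd : n.2.2.2 ≤ 2)
    (hn : coeff (exponents a b c d n) (Φ * Ψ * ρA * ρB) ≠ 0) : HasMonomial G x y 0 j := by
  obtain ⟨hPA, ⟨εA, -, hρA⟩, tA, htA, hA⟩ := D.arc_ac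
  obtain ⟨hPB, ⟨εB, -, hρB⟩, tB, htB, hB⟩ := D.arc_bd
  obtain ⟨hx, ha, hb, hxa, hxb, hab, -⟩ := D.left.spec
  obtain ⟨hy, hc, hd, hyc, hyd, hcd, -⟩ := D.right.spec
  have d1 : ∀ v, v ∈ SL → v ∉ SR := Finset.disjoint_left.1 D.disj
  have d2 : ∀ v, v ∈ SL → v ∉ IA := Finset.disjoint_left.1 D.disj_left_ac
  have d3 : ∀ v, v ∈ SL → v ∉ IB := Finset.disjoint_left.1 D.disj_left_bd
  have d4 : ∀ v, v ∈ SR → v ∉ IA := Finset.disjoint_left.1 D.disj_right_ac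
  have d5 : ∀ v, v ∈ SR → v ∉ IB := Finset.disjoint_left.1 D.disj_right_bd
  have d6 : ∀ v, v ∈ IA → v ∉ IB := Finset.disjoint_left.1 D.disj_ac_bd
  have hlr : ∀ u ∈ SL, ∀ v ∈ SR, u ≠ v := by
    rintro u hu _ hv rfl
    exact d1 u hu hv
  -- Away from `a, b, c, d` each vertex gets the exponent demanded by the elimination of its piece;
  -- the default 2 is for the other vertices of the strips.
  let m : V →₀ ℕ := Finsupp.equivFunOnFinite.symm fun v =>
    if v = a then n.1 else if v = b then n.2.1 else if v = c then n.2.2.1 else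
    if v = d then n.2.2.2 else if v = x then 0 else if v = y then j else
    if v ∈ IA then tA v else if v ∈ IB then tB v else 2
  have hm : ∀ v, m v = if v = a then n.1 else if v = b then n.2.1 else if v = c then n.2.2.1 else
    if v = d then n.2.2.2 else if v = x then 0 else if v = y then j else
    if v ∈ IA then tA v else if v ∈ IB then tB v else 2 := fun v => rfl
  have hac := hlr a ha c hc
  have had := hlr a ha d hd
  have hbc := hlr b hb c hc
  have hbd := hlr b hb d hd
  have hxc := hlr x hx c hc
  have hxd := hlr x hx d hd
  have hxy := hlr x hx y hy
  have hay := hlr a ha y hy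
  have hby := hlr b hb y hy
  have hmx : m x = 0 := by simp [hm, *]
  have hmy : m y = j := by simp [hm, hay.symm, hby.symm, hxy.symm, *]
  refine ⟨m, ?_, hmx, hmy, ?_⟩
  · have hmL : ∀ v ∈ SL, v ≠ x → v ≠ a → v ≠ b → m v = 2 := by
      intro v hv h1 h2 h3
      rw [hm, if_neg h2, if_neg h3, if_neg (hlr v hv c hc), if_neg (hlr v hv d hd), if_neg h1,
        if_neg (hlr v hv y hy), if_neg (d2 v hv), if_neg (d3 v hv)]
    have hmR : ∀ v ∈ SR, v ≠ y → v ≠ c → v ≠ d → m v = 2 := by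
      intro v hv h1 h2 h3
      rw [hm, if_neg (hlr a ha v hv).symm, if_neg (hlr b hb v hv).symm, if_neg h2, if_neg h3,
        if_neg (hlr x hx v hv).symm, if_neg h1, if_neg (d4 v hv), if_neg (d5 v hv)]
    have hmA : ∀ v ∈ IA, m v = tA v := by
      intro v hv
      have h1 : ∀ u ∈ SL, v ≠ u := by rintro u hu rfl; exact d2 v hu hv
      have h2 : ∀ u ∈ SR, v ≠ u := by rintro u hu rfl; exact d4 v hu hv
      rw [hm, if_neg (h1 a ha), if_neg (h1 b hb), if_neg (h2 c hc), if_neg (h2 d hd),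
        if_neg (h1 x hx), if_neg (h2 y hy), if_pos hv]
    have hmB : ∀ v ∈ IB, m v = tB v := by
      intro v hv
      have h1 : ∀ u ∈ SL, v ≠ u := by rintro u hu rfl; exact d3 v hu hv
      have h2 : ∀ u ∈ SR, v ≠ u := by rintro u hu rfl; exact d5 v hu hv
      rw [hm, if_neg (h1 a ha), if_neg (h1 b hb), if_neg (h2 c hc), if_neg (h2 d hd),
        if_neg (h1 x hx), if_neg (h2 y hy), if_neg (fun h => d6 v h hv), if_pos hv]
    have hnotL : ∀ v, v ∉ SL → v ∈ {v : V | v ∉ SL ∨ v = a ∨ v = b} := fun v hv => Or.inl hv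
    have hnotR : ∀ v, v ∉ SR → v ∈ {v : V | v ∉ SR ∨ v = c ∨ v = d} := fun v hv => Or.inl hv
    have hab_L : a ∈ {v : V | v ∉ SL ∨ v = a ∨ v = b} ∧ b ∈ {v : V | v ∉ SL ∨ v = a ∨ v = b} := by
      simp
    have hcd_R : c ∈ {v : V | v ∉ SR ∨ v = c ∨ v = d} ∧ d ∈ {v : V | v ∉ SR ∨ v = c ∨ v = d} := by
      simp
    have haR : a ∉ SR := fun h => d1 a ha h
    have hbR : b ∉ SR := fun h => d1 b hb h
    have hcL : c ∉ SL := fun h => d1 c h hc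
    have hdL : d ∉ SL := fun h => d1 d h hd
    have step1 : coeff m (graphPolynomial G) =
        coeff (m.filter (fun v => v ∉ SL ∨ v = a ∨ v = b))
          (Φ * ((∏ e ∈ ER, edgeFactor e) * (PA * PB))) := by
      rw [D.prod_eq, mul_assoc, mul_assoc]
      refine hΦ _ (mul_mem (prod_mem_supported D.right fun v hv => hnotL v fun h => d1 v h hv)
        (mul_mem (supported_mono ?_ hPA) (supported_mono ?_ hPB))) m hmx hmL
      · rintro v (hv | rfl | rfl)
        · exact hnotL v fun h => d2 v h hv
        · exact hab_L.1
        · exact hnotL v hcL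
      · rintro v (hv | rfl | rfl)
        · exact hnotL v fun h => d3 v h hv
        · exact hab_L.2
        · exact hnotL v hdL
    set m1 := m.filter (fun v => v ∉ SL ∨ v = a ∨ v = b) with hm1
    have e1 : ∀ v, v ∉ SL → m1 v = m v := fun v hv => Finsupp.filter_apply_pos _ _ (Or.inl hv)
    have step2 : coeff m (graphPolynomial G) =
        coeff (m1.filter (fun v => v ∉ SR ∨ v = c ∨ v = d)) (Ψ * (Φ * (PA * PB))) := by
      rw [step1, mul_left_comm]
      refine hΨ _ (mul_mem (hΦs _ (hnotR a haR) (hnotR b hbR))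
        (mul_mem (supported_mono ?_ hPA) (supported_mono ?_ hPB))) m1 ?_ ?_
      · rintro v (hv | rfl | rfl)
        · exact hnotR v fun h => d4 v h hv
        · exact hnotR v haR
        · exact hcd_R.1
      · rintro v (hv | rfl | rfl)
        · exact hnotR v fun h => d5 v h hv
        · exact hnotR v hbR
        · exact hcd_R.2
      · rw [e1 y fun h => d1 y h hy, hmy]
      · intro v hv h1 h2 h3
        rw [e1 v fun h => d1 v h hv, hmR v hv h1 h2 h3]
    set m2 := m1.filter (fun v => v ∉ SR ∨ v = c ∨ v = d) with hm2
    have e2 : ∀ v, v ∉ SR → m2 v = m1 v := fun v hv => Finsupp.filter_apply_pos _ _ (Or.inl hv)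
    have haA : a ∉ IA := d2 a ha
    have hbA : b ∉ IA := d2 b hb
    have hcA : c ∉ IA := d4 c hc
    have hdA : d ∉ IA := d4 d hd
    have haB : a ∉ IB := d3 a ha
    have hbB : b ∉ IB := d3 b hb
    have hcB : c ∉ IB := d5 c hc
    have hdB : d ∉ IB := d5 d hd
    have step3 : coeff m (graphPolynomial G) =
        coeff (m2.filter (· ∉ IA)) (ρA * (Ψ * (Φ * PB))) := by
      rw [step2]
      have : Ψ * (Φ * (PA * PB)) = PA * (Ψ * (Φ * PB)) := by ring
      rw [this]
      refine hA _ (mul_mem (hΨs _ hcA hdA) (mul_mem (hΦs _ haA hbA) (supported_mono ?_ hPB))) m2 ?_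
      · rintro v (hv | rfl | rfl)
        · exact fun h => d6 v h hv
        · exact hbA
        · exact hdA
      · intro v hv
        rw [e2 v fun h => d4 v h hv, e1 v fun h => d2 v h hv, hmA v hv]
    set m3 := m2.filter (· ∉ IA) with hm3
    have e3 : ∀ v, v ∉ IA → m3 v = m2 v := fun v hv => Finsupp.filter_apply_pos _ _ hv
    have step4 : coeff m (graphPolynomial G) =
        coeff (m3.filter (· ∉ IB)) (ρB * (ρA * (Ψ * Φ))) := by
      rw [step3]
      have : ρA * (Ψ * (Φ * PB)) = PB * (ρA * (Ψ * Φ)) := by ring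
      rw [this]
      refine hB _ (mul_mem (arc_mem_supported hρA haB hcB)
        (mul_mem (hΨs _ hcB hdB) (hΦs _ haB hbB))) m3 ?_
      intro v hv
      rw [e3 v fun h => d6 v h hv, e2 v fun h => d5 v h hv, e1 v fun h => d3 v h hv, hmB v hv]
    have hfin : m3.filter (· ∉ IB) = exponents a b c d n := by
      ext v
      simp only [hm3, hm2, hm1, Finsupp.filter_apply, exponents, Finsupp.add_apply]
      by_cases h1 : v = a
      · subst h1
        simp [hm, Finsupp.single_apply, *, hac.symm, had.symm, hab.symm]
      by_cases h2 : v = b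
      · subst h2
        simp [hm, Finsupp.single_apply, *, hbc.symm, hbd.symm]
      by_cases h3 : v = c
      · subst h3
        simp [hm, Finsupp.single_apply, *, hcd.symm]
      by_cases h4 : v = d
      · subst h4
        simp [hm, Finsupp.single_apply, *]
      have := D.cover v
      simp only [Finsupp.single_apply, Ne.symm h1, Ne.symm h2, Ne.symm h3, Ne.symm h4, if_false,
        h1, h2, h3, h4, or_false]
      rcases this with h | h | h | h <;> simp [h]
    rw [step4, hfin]
    convert hn using 2
    ring
  · intro v hvx hvy
    rw [hm]
    have := htA v
    have := htB v
    split_ifs <;> first | omega | contradiction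

end StripDecomposition

end Decomposition

/-! ### Coefficients of the remaining products -/

namespace StripDecomposition

open MvPolynomial

variable {V : Type*} {a b c d : V}

lemma exponents_inj (hab : a ≠ b) (hac : a ≠ c) (had : a ≠ d) (hbc : b ≠ c) (hbd : b ≠ d)
    (hcd : c ≠ d) (n n' : ℕ × ℕ × ℕ × ℕ) :
    exponents a b c d n = exponents a b c d n' ↔ n = n' := by
  refine ⟨fun h => ?_, fun h => h ▸ rfl⟩
  obtain ⟨i, j, k, l⟩ := n
  obtain ⟨i', j', k', l'⟩ := n'
  have ha := DFunLike.congr_fun h a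
  have hb := DFunLike.congr_fun h b
  have hc := DFunLike.congr_fun h c
  have hd := DFunLike.congr_fun h d
  simp [exponents, hab, hac, had, hbc, hbd, hcd, hab.symm, hac.symm,
    had.symm, hbc.symm, hbd.symm, hcd.symm] at ha hb hc hd
  simp [ha, hb, hc, hd]

lemma exponents_add (n n' : ℕ × ℕ × ℕ × ℕ) :
    exponents a b c d n + exponents a b c d n' = exponents a b c d (n + n') := by
  simp only [exponents, Prod.fst_add, Prod.snd_add, Finsupp.single_add]
  abel

lemma nsmul_exponents (k : ℕ) (n : ℕ × ℕ × ℕ × ℕ) :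
    k • exponents a b c d n = exponents a b c d (k • n) := by
  simp only [exponents, Prod.smul_fst, Prod.smul_snd, smul_add, Finsupp.smul_single]

/-- A polynomial `α a²b + β ab² + γ a³ + δ b³`. -/
noncomputable def cubic (a b : V) (α β γ δ : ℤ) : MvPolynomial V ℤ :=
  C α * (X a ^ 2 * X b) + C β * (X a * X b ^ 2) + C γ * X a ^ 3 + C δ * X b ^ 3

/-- A polynomial `α a² + β ab + γ b²`. -/
noncomputable def quadratic (a b : V) (α β γ : ℤ) : MvPolynomial V ℤ :=
  C α * X a ^ 2 + C β * (X a * X b) + C γ * X b ^ 2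

lemma cubic_mem_supported {s : Set V} (ha : a ∈ s) (hb : b ∈ s) (α β γ δ : ℤ) :
    cubic a b α β γ δ ∈ supported ℤ s := by
  have hC : ∀ r : ℤ, (C r : MvPolynomial V ℤ) ∈ supported ℤ s := fun r =>
    Subalgebra.algebraMap_mem _ r
  have hA := X_mem_supported (R := ℤ).2 ha
  have hB := X_mem_supported (R := ℤ).2 hb
  exact add_mem (add_mem (add_mem (mul_mem (hC _) (mul_mem (pow_mem hA _) hB))
    (mul_mem (hC _) (mul_mem hA (pow_mem hB _)))) (mul_mem (hC _) (pow_mem hA _)))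
    (mul_mem (hC _) (pow_mem hB _))

lemma quadratic_mem_supported {s : Set V} (ha : a ∈ s) (hb : b ∈ s) (α β γ : ℤ) :
    quadratic a b α β γ ∈ supported ℤ s := by
  have hC : ∀ r : ℤ, (C r : MvPolynomial V ℤ) ∈ supported ℤ s := fun r =>
    Subalgebra.algebraMap_mem _ r
  have hA := X_mem_supported (R := ℤ).2 ha
  have hB := X_mem_supported (R := ℤ).2 hb
  exact add_mem (add_mem (mul_mem (hC _) (pow_mem hA _)) (mul_mem (hC _) (mul_mem hA hB)))
    (mul_mem (hC _) (pow_mem hB _))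

section Coefficients

/-- Encoding monomials by quadruples of exponents reduces the coefficient computations below to
comparisons of numerals. -/
lemma X_eq_monomial_exponents :
    (X a : MvPolynomial V ℤ) = monomial (exponents a b c d (1, 0, 0, 0)) 1 ∧
    (X b : MvPolynomial V ℤ) = monomial (exponents a b c d (0, 1, 0, 0)) 1 ∧
    (X c : MvPolynomial V ℤ) = monomial (exponents a b c d (0, 0, 1, 0)) 1 ∧
    (X d : MvPolynomial V ℤ) = monomial (exponents a b c d (0, 0, 0, 1)) 1 ∧
    ∀ r : ℤ, (C r : MvPolynomial V ℤ) = monomial (exponents a b c d (0, 0, 0, 0)) r := by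
  refine ⟨?_, ?_, ?_, ?_, fun r => ?_⟩ <;> simp [exponents, X]

lemma coeff_arc_arc (hab : a ≠ b) (hac : a ≠ c) (had : a ≠ d) (hbc : b ≠ c)
    (hbd : b ≠ d) (hcd : c ≠ d) (α β γ δ α' β' γ' δ' s t : ℤ) :
    coeff (exponents a b c d (2, 1, 2, 1))
      (cubic a b α β γ δ * cubic c d α' β' γ' δ' * C s * C t) = α * α' * s * t ∧
    coeff (exponents a b c d (2, 1, 1, 2))
      (cubic a b α β γ δ * cubic c d α' β' γ' δ' * C s * C t) = α * β' * s * t ∧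
    coeff (exponents a b c d (1, 2, 2, 1))
      (cubic a b α β γ δ * cubic c d α' β' γ' δ' * C s * C t) = β * α' * s * t ∧
    coeff (exponents a b c d (1, 2, 1, 2))
      (cubic a b α β γ δ * cubic c d α' β' γ' δ' * C s * C t) = β * β' * s * t := by
  classical
  obtain ⟨hXa, hXb, hXc, hXd, hC⟩ := X_eq_monomial_exponents (a := a) (b := b) (c := c) (d := d)
  have hinj := exponents_inj hab hac had hbc hbd hcd
  refine ⟨?_, ?_, ?_, ?_⟩
  all_goals
    simp only [cubic, quadratic, hXa, hXb, hXc, hXd, hC, monomial_pow, monomial_mul, nsmul_exponents,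
      exponents_add, mul_add, add_mul, mul_sub, sub_mul, coeff_add, coeff_sub, coeff_monomial, hinj]
    simp
    try ring

/-- There is no counterpart for `ab² · cd²`: multiplying it by `b` or by `d` produces an exponent
three. This is where the condition on the colours comes from when only `bd` is an edge. -/
lemma coeff_arc_edge (hab : a ≠ b) (hac : a ≠ c) (had : a ≠ d) (hbc : b ≠ c)
    (hbd : b ≠ d) (hcd : c ≠ d) (α β γ δ α' β' γ' δ' s t : ℤ) :
    coeff (exponents a b c d (2, 2, 2, 1))
      (cubic a b α β γ δ * cubic c d α' β' γ' δ' * C s * (C t * (X b - X d))) = α * α' * s * t ∧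
    coeff (exponents a b c d (1, 2, 2, 2))
      (cubic a b α β γ δ * cubic c d α' β' γ' δ' * C s * (C t * (X b - X d))) = -(β * α' * s * t) ∧
    coeff (exponents a b c d (2, 2, 1, 2))
      (cubic a b α β γ δ * cubic c d α' β' γ' δ' * C s * (C t * (X b - X d))) = α * β' * s * t := by
  classical
  obtain ⟨hXa, hXb, hXc, hXd, hC⟩ := X_eq_monomial_exponents (a := a) (b := b) (c := c) (d := d)
  have hinj := exponents_inj hab hac had hbc hbd hcd
  refine ⟨?_, ?_, ?_⟩
  all_goals
    simp only [cubic, quadratic, hXa, hXb, hXc, hXd, hC, monomial_pow, monomial_mul, nsmul_exponents,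
      exponents_add, mul_add, add_mul, mul_sub, sub_mul, coeff_add, coeff_sub, coeff_monomial, hinj]
    simp
    try ring

/-- Of the terms of `(a - c)(b - d)` only `-ad` and `-bc` contribute: the first completes `ab² ·
c²d`, the second `a²b · cd²`. -/
lemma coeff_edge_edge (hab : a ≠ b) (hac : a ≠ c) (had : a ≠ d) (hbc : b ≠ c)
    (hbd : b ≠ d) (hcd : c ≠ d) (α β γ δ α' β' γ' δ' s t : ℤ) :
    coeff (exponents a b c d (2, 2, 2, 2))
      (cubic a b α β γ δ * cubic c d α' β' γ' δ' * (C s * (X a - X c)) * (C t * (X b - X d))) = -((α * β' + β * α') * s * t) := by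
  classical
  obtain ⟨hXa, hXb, hXc, hXd, hC⟩ := X_eq_monomial_exponents (a := a) (b := b) (c := c) (d := d)
  have hinj := exponents_inj hab hac had hbc hbd hcd
  simp only [cubic, quadratic, hXa, hXb, hXc, hXd, hC, monomial_pow, monomial_mul, nsmul_exponents,
    exponents_add, mul_add, add_mul, mul_sub, sub_mul, coeff_add, coeff_sub, coeff_monomial, hinj]
  simp
  try ring

lemma coeff_arc_arc_quadratic (hab : a ≠ b) (hac : a ≠ c) (had : a ≠ d) (hbc : b ≠ c)
    (hbd : b ≠ d) (hcd : c ≠ d) (α β γ δ α' β' γ' s t : ℤ) :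
    coeff (exponents a b c d (2, 1, 1, 1))
      (cubic a b α β γ δ * quadratic c d α' β' γ' * C s * C t) = α * β' * s * t := by
  classical
  obtain ⟨hXa, hXb, hXc, hXd, hC⟩ := X_eq_monomial_exponents (a := a) (b := b) (c := c) (d := d)
  have hinj := exponents_inj hab hac had hbc hbd hcd
  simp only [cubic, quadratic, hXa, hXb, hXc, hXd, hC, monomial_pow, monomial_mul, nsmul_exponents,
    exponents_add, mul_add, add_mul, mul_sub, sub_mul, coeff_add, coeff_sub, coeff_monomial, hinj]
  simp
  try ring

lemma coeff_arc_edge_quadratic (hab : a ≠ b) (hac : a ≠ c) (had : a ≠ d) (hbc : b ≠ c)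
    (hbd : b ≠ d) (hcd : c ≠ d) (α β γ δ α' β' γ' s t : ℤ) :
    coeff (exponents a b c d (2, 2, 1, 1))
      (cubic a b α β γ δ * quadratic c d α' β' γ' * C s * (C t * (X b - X d))) = α * β' * s * t := by
  classical
  obtain ⟨hXa, hXb, hXc, hXd, hC⟩ := X_eq_monomial_exponents (a := a) (b := b) (c := c) (d := d)
  have hinj := exponents_inj hab hac had hbc hbd hcd
  simp only [cubic, quadratic, hXa, hXb, hXc, hXd, hC, monomial_pow, monomial_mul, nsmul_exponents,
    exponents_add, mul_add, add_mul, mul_sub, sub_mul, coeff_add, coeff_sub, coeff_monomial, hinj]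
  simp
  try ring

lemma coeff_edge_arc_quadratic (hab : a ≠ b) (hac : a ≠ c) (had : a ≠ d) (hbc : b ≠ c)
    (hbd : b ≠ d) (hcd : c ≠ d) (α β γ δ α' β' γ' s t : ℤ) :
    coeff (exponents a b c d (2, 1, 2, 1))
      (cubic a b α β γ δ * quadratic c d α' β' γ' * (C s * (X a - X c)) * C t) = -(α * β' * s * t) := by
  classical
  obtain ⟨hXa, hXb, hXc, hXd, hC⟩ := X_eq_monomial_exponents (a := a) (b := b) (c := c) (d := d)
  have hinj := exponents_inj hab hac had hbc hbd hcd
  simp only [cubic, quadratic, hXa, hXb, hXc, hXd, hC, monomial_pow, monomial_mul, nsmul_exponents,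
    exponents_add, mul_add, add_mul, mul_sub, sub_mul, coeff_add, coeff_sub, coeff_monomial, hinj]
  simp
  try ring

lemma coeff_edge_edge_quadratic (hab : a ≠ b) (hac : a ≠ c) (had : a ≠ d) (hbc : b ≠ c)
    (hbd : b ≠ d) (hcd : c ≠ d) (α β γ δ α' β' γ' s t : ℤ) :
    coeff (exponents a b c d (2, 2, 2, 1))
      (cubic a b α β γ δ * quadratic c d α' β' γ' * (C s * (X a - X c)) * (C t * (X b - X d))) = -((α * β' + β * α') * s * t) := by
  classical
  obtain ⟨hXa, hXb, hXc, hXd, hC⟩ := X_eq_monomial_exponents (a := a) (b := b) (c := c) (d := d)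
  have hinj := exponents_inj hab hac had hbc hbd hcd
  simp only [cubic, quadratic, hXa, hXb, hXc, hXd, hC, monomial_pow, monomial_mul, nsmul_exponents,
    exponents_add, mul_add, add_mul, mul_sub, sub_mul, coeff_add, coeff_sub, coeff_monomial, hinj]
  simp
  try ring

end Coefficients

end StripDecomposition

/-! ### Choice of a non-vanishing monomial -/

namespace StripDecomposition

open MvPolynomial

variable {V : Type*} [LinearOrder V] [Fintype V] {G : SimpleGraph V} {x y a b c d : V}
  {SL SR IA IB : Finset V} {EL ER : Finset (Sym2 V)} {PA PB ρA ρB : MvPolynomial V ℤ}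

lemma pairwise_ne (D : StripDecomposition G x y a b c d SL SR IA IB EL ER PA PB ρA ρB) :
    a ≠ b ∧ a ≠ c ∧ a ≠ d ∧ b ≠ c ∧ b ≠ d ∧ c ≠ d := by
  obtain ⟨-, ha, hb, -, -, hab, -⟩ := D.left.spec
  obtain ⟨-, hc, hd, -, -, hcd, -⟩ := D.right.spec
  have hlr : ∀ u ∈ SL, ∀ v ∈ SR, u ≠ v := by
    rintro u hu _ hv rfl
    exact Finset.disjoint_left.1 D.disj hu hv
  exact ⟨hab, hlr a ha c hc, hlr a ha d hd, hlr b hb c hc, hlr b hb d hd, hcd⟩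

/-- The colours give `α ≠ 0`, `β = 0` for the cubic form and `β' ≠ 0` for the quadratic one. The
product `a²b · cd` can then be extended for every type of the two arcs; the only competing term, for
two edges, has the factor `β`. -/
theorem hasMonomial_zero_one
    (D : StripDecomposition G x y a b c d SL SR IA IB EL ER PA PB ρA ρB) (κ : V → Fin 3)
    (hκL : ∀ u v, s(u, v) ∈ EL → κ u ≠ κ v) (hκR : ∀ u v, s(u, v) ∈ ER → κ u ≠ κ v)
    (hxa : κ x = κ a) (hyc : κ y = κ c) : HasMonomial G x y 0 1 := by
  obtain ⟨hab, hac, had, hbc, hbd, hcd⟩ := D.pairwise_ne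
  obtain ⟨ε, α, β, γ, δ, _, _, _, hε, hcol, hΦ, -⟩ := D.left.exists_eliminates κ hκL
  obtain ⟨ε', _, _, _, _, α', β', γ', hε', hcol', -, hΨ⟩ := D.right.exists_eliminates κ hκR
  have hκab : κ a ≠ κ b := hκL a b D.left.spec.2.2.2.2.2.2.1
  have hκcd : κ c ≠ κ d := hκR c d D.right.spec.2.2.2.2.2.2.1
  obtain ⟨rfl, rfl⟩ : α = ε ∧ β = 0 := by
    rcases hcol with h | h | h
    · exact ⟨h.2.1, h.2.2.1⟩
    · exact absurd (hxa.symm.trans h.1) hκab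
    · exact absurd hxa h.1
  have hβ' : β' ≠ 0 := by
    rcases hcol' with h | h | h
    · exact h.2.2.2
    · exact absurd (hyc.symm.trans h.1) hκcd
    · exact absurd hyc h.1
  have key := D.hasMonomial (j := 1) (Φ := cubic a b α 0 γ δ) (Ψ := quadratic c d α' β' γ') hΦ hΨ
    (fun s h1 h2 => cubic_mem_supported h1 h2 _ _ _ _)
    (fun s h1 h2 => quadratic_mem_supported h1 h2 _ _ _)
  obtain ⟨-, ⟨s, hs, hρA⟩, -⟩ := D.arc_ac
  obtain ⟨-, ⟨t, ht, hρB⟩, -⟩ := D.arc_bd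
  have hne : α * β' * s * t ≠ 0 := mul_ne_zero (mul_ne_zero (mul_ne_zero hε hβ') hs) ht
  rcases hρA with rfl | ⟨-, rfl⟩ <;> rcases hρB with rfl | ⟨-, rfl⟩
  · refine key (2, 1, 1, 1) (by simp) (by simp) (by simp) (by simp) ?_
    rwa [coeff_arc_arc_quadratic hab hac had hbc hbd hcd]
  · refine key (2, 2, 1, 1) (by simp) (by simp) (by simp) (by simp) ?_
    rwa [coeff_arc_edge_quadratic hab hac had hbc hbd hcd]
  · refine key (2, 1, 2, 1) (by simp) (by simp) (by simp) (by simp) ?_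
    rw [coeff_edge_arc_quadratic hab hac had hbc hbd hcd]
    exact neg_ne_zero.2 hne
  · refine key (2, 2, 2, 1) (by simp) (by simp) (by simp) (by simp) ?_
    rw [coeff_edge_edge_quadratic hab hac had hbc hbd hcd, zero_mul, add_zero]
    exact neg_ne_zero.2 hne

/-- If neither arc leaves a linear factor, any non-zero coefficients of the two cubics serve. If
`bd` is an edge, only the pair `ab²`, `cd²` is useless, and one is forced to use it only if `x`, `y`
are coloured like `b`, `d`. -/
lemma hasMonomial_zero_zero_of_arc
    (D : StripDecomposition G x y a b c d SL SR IA IB EL ER PA PB ρA ρB) (κ : V → Fin 3)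
    (hκL : ∀ u v, s(u, v) ∈ EL → κ u ≠ κ v) (hκR : ∀ u v, s(u, v) ∈ ER → κ u ≠ κ v)
    {s : ℤ} (hs : s ≠ 0) (hρA : ρA = C s)
    (h : ¬ (G.Adj b d ∧ κ x = κ b ∧ κ y = κ d)) : HasMonomial G x y 0 0 := by
  obtain ⟨hab, hac, had, hbc, hbd, hcd⟩ := D.pairwise_ne
  obtain ⟨ε, α, β, γ, δ, _, _, _, hε, hcol, hΦ, -⟩ := D.left.exists_eliminates κ hκL
  obtain ⟨ε', α', β', γ', δ', _, _, _, hε', hcol', hΨ, -⟩ := D.right.exists_eliminates κ hκR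
  have key := D.hasMonomial (j := 0) (Φ := cubic a b α β γ δ) (Ψ := cubic c d α' β' γ' δ') hΦ hΨ
    (fun s h1 h2 => cubic_mem_supported h1 h2 _ _ _ _)
    (fun s h1 h2 => cubic_mem_supported h1 h2 _ _ _ _)
  obtain ⟨-, ⟨t, ht, hρB⟩, -⟩ := D.arc_bd
  have hα : α ≠ 0 ∨ β ≠ 0 ∧ κ x = κ b := by
    rcases hcol with h | h | h
    · exact Or.inl (h.2.1 ▸ hε)
    · exact Or.inr ⟨h.2.2.1 ▸ hε, h.1⟩
    · exact Or.inl (h.2.2.1 ▸ hε)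
  have hα' : α' ≠ 0 ∨ β' ≠ 0 ∧ κ y = κ d := by
    rcases hcol' with h | h | h
    · exact Or.inl (h.2.1 ▸ hε')
    · exact Or.inr ⟨h.2.2.1 ▸ hε', h.1⟩
    · exact Or.inl (h.2.2.1 ▸ hε')
  have hne : ∀ p q : ℤ, p ≠ 0 → q ≠ 0 → p * q * s * t ≠ 0 := fun p q hp hq =>
    mul_ne_zero (mul_ne_zero (mul_ne_zero hp hq) hs) ht
  subst hρA
  rcases hρB with rfl | ⟨hadj, rfl⟩
  · obtain ⟨e1, e2, e3, e4⟩ := coeff_arc_arc hab hac had hbc hbd hcd α β γ δ α' β' γ' δ' s t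
    rcases hα with h1 | ⟨h1, -⟩ <;> rcases hα' with h2 | ⟨h2, -⟩
    · exact key (2, 1, 2, 1) (by simp) (by simp) (by simp) (by simp) (e1 ▸ hne _ _ h1 h2)
    · exact key (2, 1, 1, 2) (by simp) (by simp) (by simp) (by simp) (e2 ▸ hne _ _ h1 h2)
    · exact key (1, 2, 2, 1) (by simp) (by simp) (by simp) (by simp) (e3 ▸ hne _ _ h1 h2)
    · exact key (1, 2, 1, 2) (by simp) (by simp) (by simp) (by simp) (e4 ▸ hne _ _ h1 h2)
  · obtain ⟨e1, e2, e3⟩ := coeff_arc_edge hab hac had hbc hbd hcd α β γ δ α' β' γ' δ' s t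
    rcases hα with h1 | ⟨h1, h1'⟩ <;> rcases hα' with h2 | ⟨h2, h2'⟩
    · exact key (2, 2, 2, 1) (by simp) (by simp) (by simp) (by simp) (e1 ▸ hne _ _ h1 h2)
    · exact key (2, 2, 1, 2) (by simp) (by simp) (by simp) (by simp) (e3 ▸ hne _ _ h1 h2)
    · exact key (1, 2, 2, 2) (by simp) (by simp) (by simp) (by simp)
        (e2 ▸ neg_ne_zero.2 (hne _ _ h1 h2))
    · exact absurd ⟨hadj, h1', h2'⟩ h

theorem hasMonomial_zero_zero
    (D : StripDecomposition G x y a b c d SL SR IA IB EL ER PA PB ρA ρB) (κ : V → Fin 3)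
    (hκL : ∀ u v, s(u, v) ∈ EL → κ u ≠ κ v) (hκR : ∀ u v, s(u, v) ∈ ER → κ u ≠ κ v)
    (h1 : ¬ (G.Adj a c ∧ κ x = κ a ∧ κ y = κ c)) (h2 : ¬ (G.Adj b d ∧ κ x = κ b ∧ κ y = κ d)) :
    HasMonomial G x y 0 0 := by
  obtain ⟨-, ⟨s, hs, hρA⟩, -⟩ := D.arc_ac
  obtain ⟨-, ⟨t, ht, hρB⟩, -⟩ := D.arc_bd
  rcases hρA with hρA | ⟨hadjA, rfl⟩
  · exact hasMonomial_zero_zero_of_arc D κ hκL hκR hs hρA h2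
  rcases hρB with hρB | ⟨hadjB, rfl⟩
  · exact hasMonomial_zero_zero_of_arc D.swap κ hκL hκR ht hρB h1
  obtain ⟨hab, hac, had, hbc, hbd, hcd⟩ := D.pairwise_ne
  obtain ⟨ε, α, β, γ, δ, _, _, _, hε, hcol, hΦ, -⟩ := D.left.exists_eliminates κ hκL
  obtain ⟨ε', α', β', γ', δ', _, _, _, hε', hcol', hΨ, -⟩ := D.right.exists_eliminates κ hκR
  refine D.hasMonomial (j := 0) (Φ := cubic a b α β γ δ) (Ψ := cubic c d α' β' γ' δ') hΦ hΨ
    (fun s h1 h2 => cubic_mem_supported h1 h2 _ _ _ _)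
    (fun s h1 h2 => cubic_mem_supported h1 h2 _ _ _ _) (2, 2, 2, 2) (by simp) (by simp) (by simp)
    (by simp) ?_
  rw [coeff_edge_edge hab hac had hbc hbd hcd]
  refine neg_ne_zero.2 (mul_ne_zero (mul_ne_zero ?_ hs) ht)
  have hne := mul_ne_zero hε hε'
  -- Among the nine pairs of forms, `αβ' + βα'` is zero only for `a²b, c²d` and `ab², cd²`, which
  -- are the excluded colourings. For two forms of the third kind it is `-2εε'`.
  rcases hcol with ⟨hx, rfl, rfl, -⟩ | ⟨hx, rfl, rfl, -⟩ | ⟨-, -, rfl, rfl⟩ <;>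
  rcases hcol' with ⟨hy, rfl, rfl, -⟩ | ⟨hy, rfl, rfl, -⟩ | ⟨-, -, rfl, rfl⟩
  · exact absurd ⟨hadjA, hx, hy⟩ h1
  · simpa using hne
  · simpa using hne
  · simpa using hne
  · exact absurd ⟨hadjB, hx, hy⟩ h2
  · simpa using hne
  · simpa using hne
  · simpa using hne
  · intro h
    apply hne
    linarith

end StripDecomposition

/-! ### Faces of a rotation system -/

namespace RotationSystem

variable {V : Type*} {G : SimpleGraph V} (R : RotationSystem G)

lemma facePerm_apply (e : G.Dart) : R.facePerm e = R.next e.symm := rfl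

lemma face_eq_iff {e e' : G.Dart} : R.face e = R.face e' ↔ R.facePerm.SameCycle e e' :=
  Quotient.eq

lemma face_facePerm (e : G.Dart) : R.face (R.facePerm e) = R.face e :=
  R.face_eq_iff.2 (Equiv.Perm.sameCycle_apply_left.2 (Equiv.Perm.SameCycle.refl _ _))

lemma face_facePerm_pow (n : ℕ) (e : G.Dart) : R.face ((R.facePerm ^ n) e) = R.face e :=
  R.face_eq_iff.2 (Equiv.Perm.sameCycle_pow_left.2 (Equiv.Perm.SameCycle.refl _ _))

lemma face_next (e : G.Dart) : R.face (R.next e) = R.face e.symm := by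
  rw [← R.face_facePerm e.symm, R.facePerm_apply, e.symm_symm]

lemma facePerm_fst (e : G.Dart) : (R.facePerm e).fst = e.snd := by
  rw [R.facePerm_apply, R.next_fst]
  rfl

lemma onFace_fst (e : G.Dart) : R.OnFace e.fst (R.face e) := ⟨e, rfl, rfl⟩

lemma onFace_snd (e : G.Dart) : R.OnFace e.snd (R.face e) :=
  ⟨R.facePerm e, R.face_facePerm e, R.facePerm_fst e⟩

lemma face_surjective : Function.Surjective R.face := Quotient.mk_surjective

instance [Finite V] : Finite G.Dart :=
  Finite.of_injective (fun e : G.Dart => e.toProd) fun _ _ h => SimpleGraph.Dart.ext _ _ h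

instance [Finite V] : Finite R.Face := Finite.of_surjective R.face R.face_surjective

lemma card_onFace_le [Finite V] (f : R.Face) : {v | R.OnFace v f}.ncard ≤ R.faceLength f := by
  have : {v | R.OnFace v f} = (fun e : G.Dart => e.fst) '' {e | R.face e = f} := by
    ext v
    simp [OnFace]
  rw [this]
  exact Set.ncard_image_le (Set.toFinite _)

lemma sum_faceLength [Fintype V] [Fintype R.Face] :
    ∑ f : R.Face, R.faceLength f = 2 * Nat.card G.edgeSet := by
  classical
  have h1 := SimpleGraph.dart_card_eq_twice_card_edges (G := G)
  have h2 : Nat.card G.edgeSet = G.edgeFinset.card := by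
    rw [Nat.card_eq_fintype_card, SimpleGraph.edgeFinset_card]
  rw [h2, ← h1, ← Finset.card_univ,
    Finset.card_eq_sum_card_fiberwise (f := R.face) (t := Finset.univ) (by simp)]
  refine Finset.sum_congr rfl fun f _ => ?_
  rw [faceLength, ← Set.ncard_coe_finset]
  congr 1
  ext e
  simp

end RotationSystem

/-! ### Euler's formula and thin sets of faces -/

namespace OuterplaneEmbedding

variable {V : Type*} [Fintype V] {G : SimpleGraph V} (M : OuterplaneEmbedding G)

instance : Finite M.InnerFace := Subtype.finite

noncomputable instance : Fintype M.InnerFace := Fintype.ofFinite _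

noncomputable instance : DecidableEq M.InnerFace := Classical.decEq _

omit [Fintype V] in
lemma InnerFace.ext {f g : M.InnerFace} (h : f.1 = g.1) : f = g := Subtype.ext h

/-- The number of darts of an inner face. -/
noncomputable def len (h : M.InnerFace) : ℕ := M.faceLength h.1

open Classical in
/-- The vertices on an inner face. -/
noncomputable def verts (h : M.InnerFace) : Finset V := {v | M.OnFace v h.1}

lemma mem_verts {h : M.InnerFace} {v : V} : v ∈ M.verts h ↔ M.OnFace v h.1 := by
  simp [verts]

lemma card_verts_le (h : M.InnerFace) : (M.verts h).card ≤ M.len h := by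
  rw [← Set.ncard_coe_finset]
  refine le_of_eq_of_le ?_ (M.card_onFace_le h.1)
  congr 1
  ext v
  simp [mem_verts]

lemma card_le_faceLength_outer : Fintype.card V ≤ M.faceLength M.outer := by
  have h := M.card_onFace_le M.outer
  have : {v | M.OnFace v M.outer} = Set.univ := Set.eq_univ_of_forall M.onFace_outer
  rwa [this, Set.ncard_univ, Nat.card_eq_fintype_card] at h

/-- Euler's formula in terms of the lengths of the faces. -/
lemma sum_len_add : ∑ h, M.len h + M.faceLength M.outer + 2 =
    2 * Fintype.card V + 2 * Fintype.card M.InnerFace := by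
  classical
  have : Fintype M.Face := Fintype.ofFinite _
  have h1 := M.sum_faceLength
  have h2 := M.euler
  have h3 : ∑ h, M.len h + M.faceLength M.outer = ∑ f : M.Face, M.faceLength f := by
    rw [← Finset.sum_erase_add _ _ (Finset.mem_univ M.outer)]
    congr 1
    symm
    refine Finset.sum_subtype _ (p := fun f => f ≠ M.outer) (by simp) _
  have h4 : Nat.card M.Face = Fintype.card M.InnerFace + 1 := by
    have := Fintype.card_subtype_compl (fun f : M.Face => f = M.outer)
    rw [Fintype.card_subtype_eq] at this
    have h5 : Fintype.card M.InnerFace = Fintype.card {f : M.Face // ¬ f = M.outer} :=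
      Fintype.card_congr (Equiv.refl _)
    have h6 : 0 < Fintype.card M.Face := Fintype.card_pos_iff.2 ⟨M.outer⟩
    rw [Nat.card_eq_fintype_card]
    omega
  rw [Nat.card_eq_fintype_card] at h2
  omega

variable {M}

lemma fst_mem_verts {h : M.InnerFace} {e : G.Dart} (he : M.face e = h.1) : e.fst ∈ M.verts h :=
  M.mem_verts.2 (he ▸ M.onFace_fst e)

lemma snd_mem_verts {h : M.InnerFace} {e : G.Dart} (he : M.face e = h.1) : e.snd ∈ M.verts h :=
  M.mem_verts.2 (he ▸ M.onFace_snd e)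

variable [DecidableEq V]

/-- A set of inner faces is thin if it has as few vertices as if the faces were glued together one
after the other along edges. -/
def Thin (A : Finset M.InnerFace) : Prop :=
  (A.biUnion M.verts).card + 2 * A.card ≤ ∑ h ∈ A, M.len h + 2

lemma thin_singleton (h : M.InnerFace) : Thin {h} := by
  have := M.card_verts_le h
  simp only [Thin, Finset.singleton_biUnion, Finset.card_singleton, Finset.sum_singleton]
  omega

/-- Both ends of the shared edge are already present, so the new face brings at most `len - 2` new
vertices. -/
lemma Thin.insert {A : Finset M.InnerFace} (hA : Thin A) {g h : M.InnerFace} (hg : g ∈ A)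
    (hadj : M.weakDual.Adj g h) : Thin (insert h A) := by
  by_cases hh : h ∈ A
  · rwa [Finset.insert_eq_of_mem hh]
  obtain ⟨-, e, h1, h2⟩ := hadj
  have hcard : 2 ≤ (M.verts h ∩ A.biUnion M.verts).card := by
    rw [← Finset.card_pair e.adj.ne]
    refine Finset.card_le_card fun v hv => ?_
    rw [Finset.mem_insert, Finset.mem_singleton] at hv
    refine Finset.mem_inter.2 ⟨?_, Finset.mem_biUnion.2 ⟨g, hg, ?_⟩⟩
    · rcases hv with rfl | rfl
      · exact snd_mem_verts h2
      · exact fst_mem_verts h2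
    · rcases hv with rfl | rfl
      · exact fst_mem_verts h1
      · exact snd_mem_verts h1
  have h3 := Finset.card_union_add_card_inter (M.verts h) (A.biUnion M.verts)
  have h4 := M.card_verts_le h
  unfold Thin at hA ⊢
  rw [Finset.biUnion_insert, Finset.card_insert_of_notMem hh, Finset.sum_insert hh]
  omega

lemma Thin.union_support {g h : M.InnerFace} (p : M.weakDual.Walk g h) :
    ∀ {A : Finset M.InnerFace}, Thin A → g ∈ A → Thin (A ∪ p.support.toFinset) := by
  induction p with
  | @nil u =>
    intro A hA hg
    simpa [Finset.union_eq_left.2 (Finset.singleton_subset_iff.2 hg)] using hA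
  | @cons u v w huv p ih =>
    intro A hA hg
    have := ih (hA.insert hg huv) (Finset.mem_insert_self v A)
    convert this using 1
    ext k
    simp only [SimpleGraph.Walk.support_cons, List.toFinset_cons, Finset.mem_union,
      Finset.mem_insert, List.mem_toFinset]
    have : v ∈ p.support := p.start_mem_support
    constructor
    · rintro (h | rfl | h)
      · exact Or.inl (Or.inr h)
      · exact Or.inl (Or.inr hg)
      · exact Or.inr h
    · rintro ((rfl | h) | h)
      · exact Or.inr (Or.inr this)
      · exact Or.inl h
      · exact Or.inr (Or.inr h)

lemma thin_support {g h : M.InnerFace} (p : M.weakDual.Walk g h) : Thin p.support.toFinset := by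
  have := (thin_singleton g).union_support p (Finset.mem_singleton_self g)
  rwa [Finset.union_eq_right.2] at this
  simp

/-- The two common vertices `x` and `y` do the work of a common edge. This serves shortest paths
that have no face in common. -/
lemma Thin.union {A B : Finset M.InnerFace} (hA : Thin A) (hB : Thin B) (hAB : Disjoint A B)
    {x y : V} (hxy : x ≠ y) (hxA : x ∈ A.biUnion M.verts) (hyA : y ∈ A.biUnion M.verts)
    (hxB : x ∈ B.biUnion M.verts) (hyB : y ∈ B.biUnion M.verts) : Thin (A ∪ B) := by
  have hcard : 2 ≤ (A.biUnion M.verts ∩ B.biUnion M.verts).card := by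
    rw [← Finset.card_pair hxy]
    refine Finset.card_le_card fun v hv => ?_
    rw [Finset.mem_insert, Finset.mem_singleton] at hv
    rcases hv with rfl | rfl
    · exact Finset.mem_inter.2 ⟨hxA, hxB⟩
    · exact Finset.mem_inter.2 ⟨hyA, hyB⟩
  have h3 := Finset.card_union_add_card_inter (A.biUnion M.verts) (B.biUnion M.verts)
  unfold Thin at *
  rw [Finset.union_biUnion, Finset.card_union_of_disjoint hAB, Finset.sum_union hAB]
  omega

/-- The face `h` is on a shortest path between faces containing `x` and `y`. -/
def OnShortestPath (M : OuterplaneEmbedding G) (x y : V) (h : M.InnerFace) : Prop :=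
  ∃ (f g : M.InnerFace) (p : M.weakDual.Walk f g), M.IsShortestFacePath x y p ∧ h ∈ p.support

lemma mem_biUnion_support {x y : V} {f g : M.InnerFace} {p : M.weakDual.Walk f g}
    (hp : M.IsShortestFacePath x y p) :
    x ∈ p.support.toFinset.biUnion M.verts ∧ y ∈ p.support.toFinset.biUnion M.verts :=
  ⟨Finset.mem_biUnion.2 ⟨f, by simp, M.mem_verts.2 hp.1⟩,
    Finset.mem_biUnion.2 ⟨g, by simp, M.mem_verts.2 hp.2.1⟩⟩

/-- If the faces on shortest paths from `x` to `y` cover all vertices, then they form a thin set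
of faces which covers all vertices. -/
lemma exists_thin_of_cover {x y : V} (hxy : x ≠ y)
    (hcover : ∀ v, ∃ h, M.OnShortestPath x y h ∧ v ∈ M.verts h) :
    ∃ A : Finset M.InnerFace, Thin A ∧ (∀ h, h ∈ A ↔ M.OnShortestPath x y h) ∧
      A.biUnion M.verts = Finset.univ := by
  classical
  -- A largest set with this property absorbs every shortest path. Requiring `x` and `y` on it makes
  -- `Thin.union` applicable to a disjoint path.
  let P : Finset M.InnerFace → Prop := fun A => Thin A ∧ (∀ h ∈ A, M.OnShortestPath x y h) ∧
    x ∈ A.biUnion M.verts ∧ y ∈ A.biUnion M.verts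
  obtain ⟨A, hA, hmax⟩ := Finset.exists_max_image (Finset.univ.filter P) Finset.card (by
    obtain ⟨h, ⟨f, g, p, hp, -⟩, -⟩ := hcover x
    exact ⟨p.support.toFinset, Finset.mem_filter.2 ⟨Finset.mem_univ _, thin_support p,
      fun h hh => ⟨f, g, p, hp, List.mem_toFinset.1 hh⟩, mem_biUnion_support hp⟩⟩)
  obtain ⟨-, hthin, hshort, hxA, hyA⟩ := Finset.mem_filter.1 hA
  have hall : ∀ h, M.OnShortestPath x y h → h ∈ A := by
    rintro h ⟨f, g, p, hp, hh⟩
    have hthin' : Thin (A ∪ p.support.toFinset) := by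
      by_cases hdis : Disjoint A p.support.toFinset
      · exact hthin.union (thin_support p) hdis hxy hxA hyA (mem_biUnion_support hp).1
          (mem_biUnion_support hp).2
      · obtain ⟨u, huA, hup⟩ := Finset.not_disjoint_iff.1 hdis
        have hup' := List.mem_toFinset.1 hup
        -- From the common face `u` one glues along `p` backwards to its start and then forwards to
        -- its end.
        have h1 := (hthin.union_support (p.takeUntil u hup').reverse huA).union_support
          (p.dropUntil u hup') (Finset.mem_union_left _ huA)
        convert h1 using 1
        ext k
        have : k ∈ p.support ↔ k ∈ ((p.takeUntil u hup').append (p.dropUntil u hup')).support := by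
          rw [p.take_spec hup']
        simp only [Finset.mem_union, List.mem_toFinset, this,
          SimpleGraph.Walk.mem_support_append_iff, SimpleGraph.Walk.support_reverse,
          List.mem_reverse, or_assoc]
    have hP : P (A ∪ p.support.toFinset) := by
      refine ⟨hthin', fun k hk => ?_, ?_, ?_⟩
      · rcases Finset.mem_union.1 hk with hk | hk
        · exact hshort k hk
        · exact ⟨f, g, p, hp, List.mem_toFinset.1 hk⟩
      · exact Finset.biUnion_subset_biUnion_of_subset_left _ Finset.subset_union_left hxA
      · exact Finset.biUnion_subset_biUnion_of_subset_left _ Finset.subset_union_left hyA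
    have hle := hmax _ (Finset.mem_filter.2 ⟨Finset.mem_univ _, hP⟩)
    have := Finset.eq_of_subset_of_card_le Finset.subset_union_left hle
    rw [this]
    exact Finset.mem_union_right _ (List.mem_toFinset.2 hh)
  refine ⟨A, hthin, fun h => ⟨hshort h, hall h⟩, ?_⟩
  refine Finset.eq_univ_of_forall fun v => ?_
  obtain ⟨h, hh, hv⟩ := hcover v
  exact Finset.mem_biUnion.2 ⟨h, hall h hh, hv⟩

/-- If the faces on shortest paths from `x` to `y` cover all vertices, then every inner face is on
such a path, the outer face visits each vertex once, and the set of all inner faces is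
tight with respect to thinness. -/
theorem tight_of_cover {x y : V} (hxy : x ≠ y) (hlen : ∀ h : M.InnerFace, 3 ≤ M.len h)
    (hcover : ∀ v, ∃ h, M.OnShortestPath x y h ∧ v ∈ M.verts h) :
    (∀ h, M.OnShortestPath x y h) ∧ M.faceLength M.outer = Fintype.card V ∧
      Fintype.card V + 2 * Fintype.card M.InnerFace = ∑ h, M.len h + 2 := by
  obtain ⟨A, hthin, hmem, hcov⟩ := exists_thin_of_cover hxy hcover
  have h1 := M.sum_len_add
  have h2 := M.card_le_faceLength_outer
  unfold Thin at hthin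
  rw [hcov, Finset.card_univ] at hthin
  have h3 := Finset.sum_add_sum_compl A M.len
  have h4 := Finset.card_add_card_compl A
  have h5 : Aᶜ.card * 3 ≤ ∑ h ∈ Aᶜ, M.len h := by
    rw [← smul_eq_mul]
    exact Finset.card_nsmul_le_sum _ _ _ fun h _ => hlen h
  -- Euler's formula gives `Σ len + 2 ≤ |V| + 2 · #faces`, thinness the opposite bound for `A`
  -- alone. A face outside `A` adds at least 3 on the left and only 2 on the right, so there is
  -- none, and all inequalities become equalities.
  have h6 : Aᶜ.card = 0 := by omega
  refine ⟨fun h => ?_, by omega, by omega⟩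
  rw [Finset.card_eq_zero, Finset.compl_eq_empty_iff] at h6
  exact (hmem h).1 (h6 ▸ Finset.mem_univ h)

end OuterplaneEmbedding

namespace RotationSystem

variable {V : Type*} [Finite V] {G : SimpleGraph V} (R : RotationSystem G)

/-- A facial walk closes after as many steps as the face has darts, and not before. -/
lemma face_iterate (e : G.Dart) :
    0 < R.faceLength (R.face e) ∧ (R.facePerm ^ R.faceLength (R.face e)) e = e ∧
    Set.InjOn (fun j => (R.facePerm ^ j) e) (Set.Iio (R.faceLength (R.face e))) ∧
    ∀ e', R.face e' = R.face e ↔ ∃ j < R.faceLength (R.face e), (R.facePerm ^ j) e = e' := by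
  have hpos : 0 < Function.minimalPeriod R.facePerm e := by
    refine Function.IsPeriodicPt.minimalPeriod_pos (orderOf_pos R.facePerm) ?_
    rw [Function.IsPeriodicPt, Function.IsFixedPt, Equiv.Perm.iterate_eq_pow, pow_orderOf_eq_one]
    rfl
  have hmem : ∀ e', R.face e' = R.face e ↔
      ∃ j < Function.minimalPeriod R.facePerm e, (R.facePerm ^ j) e = e' := by
    intro e'
    constructor
    · intro h
      obtain ⟨i, hi⟩ := (R.face_eq_iff.1 h.symm).exists_nat_pow_eq
      refine ⟨i % Function.minimalPeriod R.facePerm e, Nat.mod_lt _ hpos, ?_⟩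
      rw [← Equiv.Perm.iterate_eq_pow, Function.iterate_mod_minimalPeriod_eq,
        Equiv.Perm.iterate_eq_pow, hi]
    · rintro ⟨j, -, rfl⟩
      exact R.face_facePerm_pow j e
  have hinj : Set.InjOn (fun j => (R.facePerm ^ j) e)
      (Set.Iio (Function.minimalPeriod R.facePerm e)) := by
    have := Function.iterate_injOn_Iio_minimalPeriod (f := R.facePerm) (x := e)
    simpa only [Equiv.Perm.iterate_eq_pow] using this
  have hN : R.faceLength (R.face e) = Function.minimalPeriod R.facePerm e := by
    have h1 : {e' | R.face e' = R.face e} = (fun j => (R.facePerm ^ j) e) ''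
        (Set.Iio (Function.minimalPeriod R.facePerm e)) := by
      ext e'
      simp only [Set.mem_image, Set.mem_Iio]
      exact hmem e'
    rw [faceLength, h1, hinj.ncard_image, ← Finset.coe_Iio, Set.ncard_coe_finset, Nat.card_Iio]
  rw [hN]
  refine ⟨hpos, ?_, hinj, hmem⟩
  rw [← Equiv.Perm.iterate_eq_pow, Function.iterate_minimalPeriod]

end RotationSystem

namespace OuterplaneEmbedding

variable {V : Type*} [Fintype V] {G : SimpleGraph V} {M : OuterplaneEmbedding G}

lemma exists_dart_of_mem_verts {v : V} {h : M.InnerFace} (hv : v ∈ M.verts h) :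
    ∃ e : G.Dart, M.face e = h.1 ∧ e.fst = v := M.mem_verts.1 hv

lemma weakDual_adj {g h : M.InnerFace} {e : G.Dart} (hne : g ≠ h) (hg : M.face e = g.1)
    (hh : M.face e.symm = h.1) : M.weakDual.Adj g h := ⟨hne, e, hg, hh⟩

/-! ### Connectedness of the weak dual -/

section Connected

variable (hout : M.faceLength M.outer = Fintype.card V) (hcov : ∀ v, ∃ h, v ∈ M.verts h)

include hout in
lemma outer_dart_unique {e e' : G.Dart} (he : M.face e = M.outer) (he' : M.face e' = M.outer)
    (h : e.fst = e'.fst) : e = e' := by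
  have h1 : (fun e : G.Dart => e.fst) '' {e | M.face e = M.outer} = Set.univ := by
    refine Set.eq_univ_of_forall fun v => ?_
    obtain ⟨e, he, hv⟩ := M.onFace_outer v
    exact ⟨e, he, hv⟩
  have h2 : Set.InjOn (fun e : G.Dart => e.fst) {e | M.face e = M.outer} := by
    rw [← Set.ncard_image_iff (Set.toFinite _), h1, Set.ncard_univ, Nat.card_eq_fintype_card,
      ← hout]
    rfl
  exact h2 he he' h

-- With the outer face on both sides of `d`, `next d` is an outer dart at the same vertex and hence
-- equal to `d`. Then `d` is the only dart there, and the vertex is on no inner face.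
include hout hcov in
lemma not_outer_of_outer_symm {d : G.Dart} (h1 : M.face d = M.outer) :
    M.face d.symm ≠ M.outer := by
  intro h2
  have h3 : M.next d = d :=
    outer_dart_unique hout ((M.face_next d).trans h2) h1 (M.next_fst d)
  obtain ⟨h, hh⟩ := hcov d.fst
  obtain ⟨e, he, hv⟩ := exists_dart_of_mem_verts hh
  obtain ⟨k, hk⟩ := M.next_sameCycle d e hv.symm
  rw [Equiv.Perm.zpow_apply_eq_self_of_apply_eq_self h3] at hk
  exact h.2 (by rw [← he, ← hk, h1])

-- In a turn around `v`, successive darts bound faces that share an edge, and the outer face appears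
-- only at the unique outer dart `d₀`. So the inner faces at `v` form a walk in the weak dual.
include hout in
lemma reachable_of_mem_verts {v : V} {g h : M.InnerFace} (hg : v ∈ M.verts g)
    (hh : v ∈ M.verts h) : M.weakDual.Reachable g h := by
  obtain ⟨d₀, hd₀, rfl⟩ := M.onFace_outer v
  have hd1 : ∀ k : ℕ, ((M.next ^ k) (M.next d₀)).fst = d₀.fst := by
    intro k
    induction k with
    | zero => exact M.next_fst d₀
    | succ k ih => rw [pow_succ', Equiv.Perm.mul_apply, M.next_fst, ih]
  -- The invariant survives a full turn: after `d₀` comes `next d₀` again, whose face is `f`.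
  have key : ∀ (f : M.InnerFace), M.face (M.next d₀) = f.1 → ∀ k : ℕ,
      (M.next ^ k) (M.next d₀) = d₀ ∨
      ∃ h : M.InnerFace, M.face ((M.next ^ k) (M.next d₀)) = h.1 ∧ M.weakDual.Reachable f h := by
    intro f hf k
    induction k with
    | zero => exact Or.inr ⟨f, hf, SimpleGraph.Reachable.refl _⟩
    | succ k ih =>
      rw [pow_succ', Equiv.Perm.mul_apply]
      rcases ih with ih | ⟨h, hh, hr⟩
      · rw [ih]
        exact Or.inr ⟨f, hf, SimpleGraph.Reachable.refl _⟩
      · by_cases ho : M.face (M.next ((M.next ^ k) (M.next d₀))) = M.outer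
        · exact Or.inl (outer_dart_unique hout ho hd₀ (by rw [M.next_fst, hd1]))
        · refine Or.inr ⟨⟨_, ho⟩, rfl, ?_⟩
          by_cases heq : h = ⟨_, ho⟩
          · rwa [← heq]
          · exact hr.trans (weakDual_adj heq hh (M.face_next _).symm).reachable
  have hinner : ∃ f : M.InnerFace, M.face (M.next d₀) = f.1 := by
    by_contra hcon
    push Not at hcon
    have ho : M.face (M.next d₀) = M.outer := by
      by_contra ho
      exact hcon ⟨_, ho⟩ rfl
    have h3 : M.next d₀ = d₀ := outer_dart_unique hout ho hd₀ (M.next_fst d₀)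
    obtain ⟨e, he, hv⟩ := exists_dart_of_mem_verts hg
    obtain ⟨k, hk⟩ := M.next_sameCycle d₀ e hv.symm
    rw [Equiv.Perm.zpow_apply_eq_self_of_apply_eq_self h3] at hk
    exact g.2 (by rw [← he, ← hk, hd₀])
  obtain ⟨f, hf⟩ := hinner
  have hall : ∀ h : M.InnerFace, d₀.fst ∈ M.verts h → M.weakDual.Reachable f h := by
    intro h hh
    obtain ⟨e, he, hv⟩ := exists_dart_of_mem_verts hh
    obtain ⟨k, hk⟩ := (M.next_sameCycle (M.next d₀) e
      ((M.next_fst d₀).trans hv.symm)).exists_nat_pow_eq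
    rcases key f hf k with h1 | ⟨h', hh', hr⟩
    · exact absurd (by rw [← he, ← hk, h1, hd₀]) h.2
    · rw [hk] at hh'
      rwa [InnerFace.ext M (hh'.symm.trans he)] at hr
  exact (hall g hg).symm.trans (hall h hh)

include hout hcov in
lemma weakDual_preconnected : M.weakDual.Preconnected := by
  have key : ∀ (v w : V) (p : G.Walk v w) (g h : M.InnerFace), v ∈ M.verts g → w ∈ M.verts h →
      M.weakDual.Reachable g h := by
    intro v w p
    induction p with
    | nil => exact fun g h hg hh => reachable_of_mem_verts hout hg hh
    | @cons v u w hvu p ih =>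
      intro g h hg hh
      have : ∃ k : M.InnerFace, v ∈ M.verts k ∧ u ∈ M.verts k := by
        let d : G.Dart := ⟨(v, u), hvu⟩
        by_cases hd : M.face d = M.outer
        · have := not_outer_of_outer_symm hout hcov hd
          exact ⟨⟨_, this⟩, snd_mem_verts (h := ⟨_, this⟩) (e := d.symm) rfl,
            fst_mem_verts (h := ⟨_, this⟩) (e := d.symm) rfl⟩
        · exact ⟨⟨_, hd⟩, fst_mem_verts (h := ⟨_, hd⟩) (e := d) rfl,
            snd_mem_verts (h := ⟨_, hd⟩) (e := d) rfl⟩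
      obtain ⟨k, hk, hk'⟩ := this
      exact (reachable_of_mem_verts hout hg hk).trans (ih k h hk' hh)
  intro g h
  obtain ⟨e, he⟩ := M.face_surjective g.1
  obtain ⟨e', he'⟩ := M.face_surjective h.1
  obtain ⟨p⟩ := M.connected.preconnected e.fst e'.fst
  exact key _ _ p g h (fst_mem_verts he) (fst_mem_verts he')

end Connected

/-! ### Shortest face paths are induced paths -/

section ShortestPath

variable {x y : V} {f g : M.InnerFace} {p : M.weakDual.Walk f g}

/-- Replacing the stretch of `p` from position `i` to position `j` by `r` gives a competitor of `p`.
With `r` empty or a single step, this excludes repeated faces and chords. -/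
lemma IsShortestFacePath.length_le_shortcut (hp : M.IsShortestFacePath x y p) {i j : ℕ}
    (hj : j ≤ p.length) (r : M.weakDual.Walk (p.getVert i) (p.getVert j)) :
    j ≤ i + r.length := by
  have h := hp.2.2 _ _ (((p.take i).append r).append (p.drop j)) hp.1 hp.2.1
  simp only [SimpleGraph.Walk.length_append, SimpleGraph.Walk.take_length,
    SimpleGraph.Walk.drop_length] at h
  have := min_le_left i p.length
  omega

lemma IsShortestFacePath.eq_zero (hp : M.IsShortestFacePath x y p) {i : ℕ} (hi : i ≤ p.length)
    (hx : x ∈ M.verts (p.getVert i)) : i = 0 := by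
  have h := hp.2.2 _ _ (p.drop i) (M.mem_verts.1 hx) hp.2.1
  rw [SimpleGraph.Walk.drop_length] at h
  omega

lemma IsShortestFacePath.eq_length (hp : M.IsShortestFacePath x y p) {i : ℕ} (hi : i ≤ p.length)
    (hy : y ∈ M.verts (p.getVert i)) : i = p.length := by
  have h := hp.2.2 _ _ (p.take i) hp.1 (M.mem_verts.1 hy)
  rw [SimpleGraph.Walk.take_length] at h
  have := min_le_left i p.length
  omega

lemma IsShortestFacePath.getVert_inj (hp : M.IsShortestFacePath x y p) {i j : ℕ}
    (hi : i ≤ p.length) (hj : j ≤ p.length) (hij : p.getVert i = p.getVert j) : i = j := by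
  have h1 := hp.length_le_shortcut hj (i := i) (SimpleGraph.Walk.nil.copy rfl hij)
  have h2 := hp.length_le_shortcut hi (i := j) (SimpleGraph.Walk.nil.copy rfl hij.symm)
  simp only [SimpleGraph.Walk.length_copy, SimpleGraph.Walk.length_nil] at h1 h2
  omega

lemma IsShortestFacePath.of_adj (hp : M.IsShortestFacePath x y p) {i j : ℕ}
    (hi : i ≤ p.length) (hj : j ≤ p.length)
    (hadj : M.weakDual.Adj (p.getVert i) (p.getVert j)) : j = i + 1 ∨ i = j + 1 := by
  have h1 := hp.length_le_shortcut hj (i := i) hadj.toWalk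
  have h2 := hp.length_le_shortcut hi (i := j) hadj.symm.toWalk
  have h3 : i ≠ j := by
    rintro rfl
    exact hadj.ne rfl
  simp only [SimpleGraph.Walk.length_cons, SimpleGraph.Walk.length_nil] at h1 h2
  omega

end ShortestPath

/-! ### One shortest path contains all inner faces -/

section Cover

variable [DecidableEq V]

/-- Take a largest proper thin superset of `A₀`. By connectedness some face outside is adjacent to
it, and gluing that face on keeps it thin, so maximality makes the result everything. -/
lemma exists_last_face {A₀ : Finset M.InnerFace} (h₀ : Thin A₀) (hne : A₀.Nonempty)
    (hA₀ : A₀ ≠ Finset.univ) (hconn : M.weakDual.Preconnected) :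
    ∃ (A : Finset M.InnerFace) (g h : M.InnerFace), A₀ ⊆ A ∧ Thin A ∧ g ∈ A ∧ h ∉ A ∧
      insert h A = Finset.univ ∧ M.weakDual.Adj g h := by
  classical
  obtain ⟨A, hA, hmax⟩ := Finset.exists_max_image (Finset.univ.filter fun A : Finset M.InnerFace =>
    A₀ ⊆ A ∧ Thin A ∧ A ≠ Finset.univ) Finset.card
    ⟨A₀, Finset.mem_filter.2 ⟨Finset.mem_univ _, subset_rfl, h₀, hA₀⟩⟩
  obtain ⟨-, hsub, hthin, hA⟩ := Finset.mem_filter.1 hA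
  obtain ⟨u, hu⟩ := hne
  obtain ⟨w, hw⟩ : ∃ w, w ∉ A := by
    by_contra hcon
    push Not at hcon
    exact hA (Finset.eq_univ_of_forall hcon)
  obtain ⟨p⟩ := hconn u w
  obtain ⟨d, -, hd1, hd2⟩ := p.exists_boundary_dart (A : Set M.InnerFace)
    (Finset.mem_coe.2 (hsub hu)) (by simpa using hw)
  rw [Finset.mem_coe] at hd1 hd2
  refine ⟨A, d.fst, d.snd, hsub, hthin, hd1, hd2, ?_, d.adj⟩
  by_contra hcon
  have := hmax (insert d.snd A) (Finset.mem_filter.2 ⟨Finset.mem_univ _,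
    hsub.trans (Finset.subset_insert _ _), hthin.insert hd1 d.adj, hcon⟩)
  rw [Finset.card_insert_of_notMem hd2] at this
  omega

/-- A triangular face with a vertex on no other inner face has at most one neighbour, which
contains the other vertices of the face. -/
lemma triangle_with_private_vertex {h g : M.InnerFace} (hlen : M.len h = 3) {z : V}
    (hz : z ∈ M.verts h) (hz' : ∀ k, z ∈ M.verts k → k = h) (hadj : M.weakDual.Adj g h) :
    (∀ k, M.weakDual.Adj k h → k = g) ∧ ∀ v ∈ M.verts h, v ≠ z → v ∈ M.verts g := by
  obtain ⟨e, he, rfl⟩ := exists_dart_of_mem_verts hz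
  have hN : M.faceLength (M.face e) = 3 := by rw [he]; exact hlen
  obtain ⟨-, h3, -, hall⟩ := M.face_iterate e
  rw [hN] at h3 hall
  have hsnd : ((M.facePerm ^ 2) e).snd = e.fst := by
    rw [← M.facePerm_fst, ← Equiv.Perm.mul_apply, ← pow_succ', h3]
  -- Two of the three sides end in the private vertex, so only the opposite side, that of `facePerm
  -- e`, can be shared.
  have key : ∀ k, M.weakDual.Adj k h → M.face (M.facePerm e).symm = k.1 := by
    rintro k ⟨hne, d, hd, hd'⟩
    obtain ⟨j, hj, hj'⟩ := (hall d.symm).1 (hd'.trans he.symm)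
    interval_cases j
    · exfalso
      refine hne (hz' k ?_)
      have h1 : d.snd = e.fst := by
        rw [show e = d.symm from hj']; rfl
      rw [← h1]
      exact snd_mem_verts hd
    · rw [pow_one] at hj'
      rw [hj', d.symm_symm, hd]
    · exfalso
      refine hne (hz' k ?_)
      have h1 : d.fst = e.fst := by
        rw [← hsnd, hj']; rfl
      rw [← h1]
      exact fst_mem_verts hd
  have hg := key g hadj
  refine ⟨fun k hk => InnerFace.ext M ((key k hk).symm.trans hg), fun v hv hvz => ?_⟩
  obtain ⟨d, hd, rfl⟩ := exists_dart_of_mem_verts hv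
  obtain ⟨j, hj, rfl⟩ := (hall d).1 (hd.trans he.symm)
  interval_cases j
  · exact absurd rfl hvz
  · exact snd_mem_verts hg
  · have h1 : ((M.facePerm ^ 2) e).fst = (M.facePerm e).snd := by
      rw [pow_two, Equiv.Perm.mul_apply, M.facePerm_fst]
    rw [h1]
    exact fst_mem_verts hg

/-- A shortest face path through all non-triangular faces goes through all inner faces. -/
theorem mem_support_of_tight {x y : V} {s t f : M.InnerFace} {p : M.weakDual.Walk s t}
    (hall : ∀ h, M.OnShortestPath x y h) (hconn : M.weakDual.Preconnected)
    (hcov : ∀ v, ∃ h, v ∈ M.verts h)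
    (htight : Fintype.card V + 2 * Fintype.card M.InnerFace = ∑ h, M.len h + 2)
    (htri : ∀ h, h ≠ f → M.len h = 3) (hp : M.IsShortestFacePath x y p) (hf : f ∈ p.support)
    (hx : x ∉ M.verts f) (hy : y ∉ M.verts f) (h : M.InnerFace) : h ∈ p.support := by
  by_contra hh
  obtain ⟨A, g, h, hsub, hthin, hg, hhA, huniv, hadj⟩ := exists_last_face (thin_support p)
    ⟨f, List.mem_toFinset.2 hf⟩ (fun hcon => hh (List.mem_toFinset.1 (hcon ▸ Finset.mem_univ h)))
    hconn
  have hfh : h ≠ f := by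
    rintro rfl
    exact hhA (hsub (List.mem_toFinset.2 hf))
  have hlen := htri h hfh
  -- If `A` covered all vertices, its thinness together with `len h = 3` would violate tightness by
  -- one.
  obtain ⟨z, hz⟩ : ∃ z, z ∉ A.biUnion M.verts := by
    by_contra hcon
    push Not at hcon
    unfold Thin at hthin
    rw [Finset.eq_univ_of_forall hcon, Finset.card_univ] at hthin
    rw [← huniv, Finset.sum_insert hhA, ← Finset.card_univ (α := M.InnerFace), ← huniv,
      Finset.card_insert_of_notMem hhA] at htight
    omega
  have hzk : ∀ k, z ∈ M.verts k → k = h := by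
    intro k hk
    have : k ∈ insert h A := huniv ▸ Finset.mem_univ k
    rcases Finset.mem_insert.1 this with h1 | h1
    · exact h1
    · exact absurd (Finset.mem_biUnion.2 ⟨k, h1, hk⟩) hz
  have hzh : z ∈ M.verts h := by
    obtain ⟨k, hk⟩ := hcov z
    rwa [hzk k hk] at hk
  have hxy := mem_biUnion_support hp
  have hxz : x ≠ z := by
    rintro rfl
    exact hz (Finset.biUnion_subset_biUnion_of_subset_left _ hsub hxy.1)
  have hyz : y ≠ z := by
    rintro rfl
    exact hz (Finset.biUnion_subset_biUnion_of_subset_left _ hsub hxy.2)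
  obtain ⟨huniq, hverts⟩ := triangle_with_private_vertex hlen hzh hzk hadj
  obtain ⟨s', t', q, hq, hhq⟩ := hall h
  -- Neither `x` nor `y` is on `f`, so `f` is an interior face of `p`, and `q` is no shorter than
  -- `p`.
  have hlen_q : 2 ≤ q.length := by
    have h1 : p.length ≤ q.length := hp.2.2 _ _ q hq.1 hq.2.1
    obtain ⟨i, hi, hi'⟩ := SimpleGraph.Walk.mem_support_iff_exists_getVert.1 hf
    have h2 : i ≠ 0 := by
      rintro rfl
      rw [SimpleGraph.Walk.getVert_zero] at hi
      exact hx (hi ▸ M.mem_verts.2 hp.1)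
    have h3 : i ≠ p.length := by
      rintro rfl
      rw [SimpleGraph.Walk.getVert_length] at hi
      exact hy (hi ▸ M.mem_verts.2 hp.2.1)
    omega
  obtain ⟨i, hi, hi'⟩ := SimpleGraph.Walk.mem_support_iff_exists_getVert.1 hhq
  have hnext : i < q.length → q.getVert (i + 1) = g := fun hlt =>
    huniq _ (by rw [← hi]; exact (q.adj_getVert_succ hlt).symm)
  have hprev : ∀ j, i = j + 1 → q.getVert j = g := fun j hj =>
    huniq _ (by rw [← hi, hj]; exact q.adj_getVert_succ (by omega))
  -- The only neighbour of `h` is `g`. At an end of `q`, the vertex `x` or `y` would already be on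
  -- `g`, so `q` could be shortened; in the interior, `q` would visit `g` twice.
  rcases Nat.eq_zero_or_pos i with rfl | hpos
  · have h1 : x ∈ M.verts h := by
      rw [← hi, SimpleGraph.Walk.getVert_zero]
      exact M.mem_verts.2 hq.1
    have h2 := hverts x h1 hxz
    rw [← hnext (by omega)] at h2
    have := hq.eq_zero (by omega) h2
    omega
  · obtain ⟨j, rfl⟩ : ∃ j, i = j + 1 := ⟨i - 1, by omega⟩
    rcases hi'.eq_or_lt with heq | hlt
    · have h1 : y ∈ M.verts h := by
        rw [← hi, heq, SimpleGraph.Walk.getVert_length]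
        exact M.mem_verts.2 hq.2.1
      have h2 := hverts y h1 hyz
      rw [← hprev j rfl] at h2
      have := hq.eq_length (by omega) h2
      omega
    · have := hq.getVert_inj (by omega) (by omega) ((hprev j rfl).trans (hnext hlt).symm)
      omega

end Cover

end OuterplaneEmbedding

/-! ### Chains of faces and their triangle strips -/

namespace OuterplaneEmbedding

variable {V : Type*} [Fintype V] {G : SimpleGraph V} {M : OuterplaneEmbedding G}

/-- The inner faces are arranged in a sequence in which exactly the consecutive ones are adjacent. -/
structure FaceChain (M : OuterplaneEmbedding G) (n : ℕ) (F : ℕ → M.InnerFace) : Prop where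
  surj : ∀ h, ∃ i ≤ n, F i = h
  inj : ∀ i ≤ n, ∀ j ≤ n, F i = F j → i = j
  adj : ∀ i < n, M.weakDual.Adj (F i) (F (i + 1))
  of_adj : ∀ i ≤ n, ∀ j ≤ n, M.weakDual.Adj (F i) (F j) → j = i + 1 ∨ i = j + 1

lemma IsShortestFacePath.faceChain {x y : V} {f g : M.InnerFace} {p : M.weakDual.Walk f g}
    (hp : M.IsShortestFacePath x y p) (hall : ∀ h, h ∈ p.support) :
    FaceChain M p.length p.getVert where
  surj h := by
    obtain ⟨i, hi, hi'⟩ := SimpleGraph.Walk.mem_support_iff_exists_getVert.1 (hall h)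
    exact ⟨i, hi', hi⟩
  inj _ hi _ hj := hp.getVert_inj hi hj
  adj _ hi := p.adj_getVert_succ hi
  of_adj _ hi _ hj := hp.of_adj hi hj

open Classical in
/-- The edges on the boundary of an inner face. -/
noncomputable def faceEdges (h : M.InnerFace) : Finset (Sym2 V) :=
  {s | ∃ d : G.Dart, M.face d = h.1 ∧ d.edge = s}

lemma mem_faceEdges {h : M.InnerFace} {s : Sym2 V} :
    s ∈ faceEdges h ↔ ∃ d : G.Dart, M.face d = h.1 ∧ d.edge = s := by
  simp [faceEdges]

lemma mem_verts_of_mem_faceEdges {h : M.InnerFace} {s : Sym2 V} (hs : s ∈ faceEdges h) {v : V}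
    (hv : v ∈ s) : v ∈ M.verts h := by
  obtain ⟨d, hd, rfl⟩ := mem_faceEdges.1 hs
  rcases Sym2.mem_iff.1 hv with rfl | rfl
  · exact fst_mem_verts hd
  · exact snd_mem_verts hd

lemma exists_triangle {h : M.InnerFace} (hlen : M.len h = 3) {d : G.Dart} (hd : M.face d = h.1) :
    ∃ z, z ≠ d.fst ∧ z ≠ d.snd ∧ (∀ v, v ∈ M.verts h ↔ v = d.fst ∨ v = d.snd ∨ v = z) ∧
      (∀ s, s ∈ faceEdges h ↔ s = s(d.fst, d.snd) ∨ s = s(d.snd, z) ∨ s = s(z, d.fst)) ∧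
      ∀ d', M.face d' = h.1 → d' = d ∨ (d'.fst = d.snd ∧ d'.snd = z) ∨
        (d'.fst = z ∧ d'.snd = d.fst) := by
  have hN : M.faceLength (M.face d) = 3 := by rw [hd]; exact hlen
  obtain ⟨-, h3, -, hall⟩ := M.face_iterate d
  rw [hN] at h3 hall
  have e1 : (M.facePerm d).fst = d.snd := M.facePerm_fst d
  have e2 : ((M.facePerm ^ 2) d).fst = (M.facePerm d).snd := by
    rw [pow_two, Equiv.Perm.mul_apply, M.facePerm_fst]
  have e3 : ((M.facePerm ^ 2) d).snd = d.fst := by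
    rw [← M.facePerm_fst, ← Equiv.Perm.mul_apply, ← pow_succ', h3]
  have hdarts : ∀ d', M.face d' = h.1 ↔
      d' = d ∨ d' = M.facePerm d ∨ d' = (M.facePerm ^ 2) d := by
    intro d'
    rw [← hd, hall]
    constructor
    · rintro ⟨j, hj, rfl⟩
      interval_cases j <;> simp
    · rintro (rfl | rfl | rfl)
      · exact ⟨0, by omega, rfl⟩
      · exact ⟨1, by omega, rfl⟩
      · exact ⟨2, by omega, rfl⟩
  refine ⟨(M.facePerm d).snd, ?_, ?_, ?_, ?_, ?_⟩
  · rw [← e2, ← e3]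
    exact ((M.facePerm ^ 2) d).adj.ne
  · rw [← e1]
    exact (M.facePerm d).adj.ne'
  · intro v
    rw [mem_verts]
    simp only [RotationSystem.OnFace, hdarts]
    constructor
    · rintro ⟨e, rfl | rfl | rfl, rfl⟩
      · exact Or.inl rfl
      · exact Or.inr (Or.inl e1)
      · exact Or.inr (Or.inr e2)
    · rintro (rfl | rfl | rfl)
      · exact ⟨_, Or.inl rfl, rfl⟩
      · exact ⟨_, Or.inr (Or.inl rfl), e1⟩
      · exact ⟨_, Or.inr (Or.inr rfl), e2⟩
  · intro s
    have hedge : ∀ e : G.Dart, e.edge = s(e.fst, e.snd) := fun e => rfl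
    simp only [mem_faceEdges, hdarts]
    constructor
    · rintro ⟨e, rfl | rfl | rfl, rfl⟩
      · exact Or.inl rfl
      · exact Or.inr (Or.inl (by rw [hedge, e1]))
      · exact Or.inr (Or.inr (by rw [hedge, e2, e3]))
    · rintro (rfl | rfl | rfl)
      · exact ⟨_, Or.inl rfl, rfl⟩
      · exact ⟨_, Or.inr (Or.inl rfl), by rw [hedge, e1]⟩
      · exact ⟨_, Or.inr (Or.inr rfl), by rw [hedge, e2, e3]⟩
  · intro d' hd'
    rcases (hdarts d').1 hd' with rfl | rfl | rfl
    · exact Or.inl rfl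
    · exact Or.inr (Or.inl ⟨e1, rfl⟩)
    · exact Or.inr (Or.inr ⟨e2, e3⟩)

namespace FaceChain

variable {n : ℕ} {F : ℕ → M.InnerFace}

lemma reverse (hF : FaceChain M n F) : FaceChain M n (fun i => F (n - i)) where
  surj h := by
    obtain ⟨i, hi, rfl⟩ := hF.surj h
    exact ⟨n - i, by omega, by congr 1; omega⟩
  inj i hi j hj hij := by
    have := hF.inj _ (by omega) _ (by omega) hij
    omega
  adj i hi := by
    have := (hF.adj (n - (i + 1)) (by omega)).symm
    rwa [show n - (i + 1) + 1 = n - i by omega] at this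
  of_adj i hi j hj hadj := by
    have := hF.of_adj _ (by omega) _ (by omega) hadj
    omega

lemma exists_dart (hF : FaceChain M n F) {k : ℕ} (hk : k < n) :
    ∃ e : G.Dart, M.face e = (F k).1 ∧ M.face e.symm = (F (k + 1)).1 := (hF.adj k hk).2

variable [DecidableEq V]

/-- The vertices on the faces `F 0, …, F k`. -/
noncomputable def vertsUpTo (F : ℕ → M.InnerFace) (k : ℕ) : Finset V :=
  (Finset.range (k + 1)).biUnion fun i => M.verts (F i)

/-- The edges on the faces `F 0, …, F k`. -/
noncomputable def edgesUpTo (F : ℕ → M.InnerFace) (k : ℕ) : Finset (Sym2 V) :=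
  (Finset.range (k + 1)).biUnion fun i => faceEdges (F i)

lemma mem_vertsUpTo {k : ℕ} {v : V} : v ∈ vertsUpTo F k ↔ ∃ i ≤ k, v ∈ M.verts (F i) := by
  simp [vertsUpTo]

lemma mem_edgesUpTo {k : ℕ} {s : Sym2 V} : s ∈ edgesUpTo F k ↔ ∃ i ≤ k, s ∈ faceEdges (F i) := by
  simp [edgesUpTo]

lemma vertsUpTo_succ (k : ℕ) : vertsUpTo F (k + 1) = M.verts (F (k + 1)) ∪ vertsUpTo F k := by
  rw [vertsUpTo, Finset.range_add_one, Finset.biUnion_insert]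
  rfl

lemma edgesUpTo_succ (k : ℕ) : edgesUpTo F (k + 1) = faceEdges (F (k + 1)) ∪ edgesUpTo F k := by
  rw [edgesUpTo, Finset.range_add_one, Finset.biUnion_insert]
  rfl

lemma two_le_card_inter (hF : FaceChain M n F) {k : ℕ} (hk : k < n) :
    2 ≤ (M.verts (F (k + 1)) ∩ vertsUpTo F k).card := by
  obtain ⟨e, h1, h2⟩ := hF.exists_dart hk
  rw [← Finset.card_pair e.adj.ne]
  refine Finset.card_le_card fun v hv => ?_
  rw [Finset.mem_insert, Finset.mem_singleton] at hv
  rcases hv with rfl | rfl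
  · exact Finset.mem_inter.2 ⟨snd_mem_verts h2, mem_vertsUpTo.2 ⟨k, le_rfl, fst_mem_verts h1⟩⟩
  · exact Finset.mem_inter.2 ⟨fst_mem_verts h2, mem_vertsUpTo.2 ⟨k, le_rfl, snd_mem_verts h1⟩⟩

variable (htight : Fintype.card V + 2 * Fintype.card M.InnerFace = ∑ h, M.len h + 2)
  (hcov : ∀ v, ∃ h, v ∈ M.verts h)

-- Summing the vertex numbers along the chain counts `V` plus the overlaps. Each overlap is at least
-- two and each face has at most `len` vertices; tightness makes the totals agree, so each single
-- inequality is an equality.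
include htight hcov in
theorem card_eq (hF : FaceChain M n F) : (∀ h, (M.verts h).card = M.len h) ∧
    ∀ k < n, (M.verts (F (k + 1)) ∩ vertsUpTo F k).card = 2 := by
  have huniv : Finset.univ = (Finset.range (n + 1)).image F := by
    symm
    refine Finset.eq_univ_of_forall fun h => ?_
    obtain ⟨i, hi, rfl⟩ := hF.surj h
    exact Finset.mem_image_of_mem _ (Finset.mem_range.2 (by omega))
  have hinj : Set.InjOn F (Finset.range (n + 1)) := by
    intro i hi j hj hij
    simp only [Finset.coe_range, Set.mem_Iio] at hi hj
    exact hF.inj i (by omega) j (by omega) hij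
  have hcard : Fintype.card M.InnerFace = n + 1 := by
    rw [← Finset.card_univ, huniv, Finset.card_image_of_injOn hinj, Finset.card_range]
  have hsum : ∑ h, M.len h = ∑ i ∈ Finset.range (n + 1), M.len (F i) := by
    rw [huniv, Finset.sum_image hinj]
  have htel : ∀ k ≤ n, (vertsUpTo F k).card +
      ∑ i ∈ Finset.range k, (M.verts (F (i + 1)) ∩ vertsUpTo F i).card =
      ∑ i ∈ Finset.range (k + 1), (M.verts (F i)).card := by
    intro k
    induction k with
    | zero => simp [vertsUpTo]
    | succ k ih =>
      intro hk
      have h1 := ih (by omega)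
      have h2 := Finset.card_union_add_card_inter (M.verts (F (k + 1))) (vertsUpTo F k)
      rw [Finset.sum_range_succ _ (k + 1), Finset.sum_range_succ _ k, vertsUpTo_succ]
      omega
  have hall : vertsUpTo F n = Finset.univ := by
    refine Finset.eq_univ_of_forall fun v => ?_
    obtain ⟨h, hh⟩ := hcov v
    obtain ⟨i, hi, rfl⟩ := hF.surj h
    exact mem_vertsUpTo.2 ⟨i, hi, hh⟩
  have h1 := htel n le_rfl
  rw [hall, Finset.card_univ] at h1
  have h2 : ∀ i ∈ Finset.range n, 2 ≤ (M.verts (F (i + 1)) ∩ vertsUpTo F i).card :=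
    fun i hi => hF.two_le_card_inter (Finset.mem_range.1 hi)
  have h3 : ∀ i ∈ Finset.range (n + 1), (M.verts (F i)).card ≤ M.len (F i) :=
    fun i _ => M.card_verts_le _
  have h2' := Finset.sum_le_sum h2
  have h3' := Finset.sum_le_sum h3
  have hconst : ∑ i ∈ Finset.range n, 2 = n * 2 := by simp
  rw [hconst] at h2'
  have h4 := (Finset.sum_eq_sum_iff_of_le h2).1 (by rw [hconst]; omega)
  have h5 := (Finset.sum_eq_sum_iff_of_le h3).1 (by omega)
  refine ⟨fun h => ?_, fun k hk => (h4 k (Finset.mem_range.2 hk)).symm⟩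
  obtain ⟨i, hi, rfl⟩ := hF.surj h
  exact h5 i (Finset.mem_range.2 (by omega))

include htight hcov in
lemma eq_of_mem_verts (hF : FaceChain M n F) {k i : ℕ} (hk : k < n) (hi : i ≤ k) {e : G.Dart}
    (h1 : M.face e = (F k).1) (h2 : M.face e.symm = (F (k + 1)).1) {v : V}
    (hv : v ∈ M.verts (F i)) (hv' : v ∈ M.verts (F (k + 1))) : v = e.fst ∨ v = e.snd := by
  have hsub : {e.fst, e.snd} ⊆ M.verts (F (k + 1)) ∩ vertsUpTo F k := by
    intro v hv
    rw [Finset.mem_insert, Finset.mem_singleton] at hv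
    rcases hv with rfl | rfl
    · exact Finset.mem_inter.2 ⟨snd_mem_verts h2, mem_vertsUpTo.2 ⟨k, le_rfl, fst_mem_verts h1⟩⟩
    · exact Finset.mem_inter.2 ⟨fst_mem_verts h2, mem_vertsUpTo.2 ⟨k, le_rfl, snd_mem_verts h1⟩⟩
  have heq := Finset.eq_of_subset_of_card_le hsub (by
    rw [(hF.card_eq htight hcov).2 k hk, Finset.card_pair e.adj.ne])
  have : v ∈ ({e.fst, e.snd} : Finset V) := by
    rw [heq]
    exact Finset.mem_inter.2 ⟨hv', mem_vertsUpTo.2 ⟨i, hi, hv⟩⟩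
  simpa using this

-- A vertex of an earlier face can reach `F (j + 1)` only through the edge shared with `F j`, so it
-- is on `F j` too; one descends in this way from `j` to `k`.
include htight hcov in
lemma mem_verts_of_between (hF : FaceChain M n F) {i k : ℕ} (hik : i ≤ k) {v : V}
    (hv : v ∈ M.verts (F i)) : ∀ {j : ℕ}, k ≤ j → j ≤ n → v ∈ M.verts (F j) →
      v ∈ M.verts (F k) := by
  intro j hkj
  induction j, hkj using Nat.le_induction with
  | base => exact fun _ h => h
  | succ j hkj ih =>
    intro hj hvj
    obtain ⟨e, h1, h2⟩ := hF.exists_dart (k := j) (by omega)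
    refine ih (by omega) ?_
    rcases hF.eq_of_mem_verts htight hcov (by omega) (hik.trans hkj) h1 h2 hv hvj with rfl | rfl
    · exact fst_mem_verts h1
    · exact snd_mem_verts h1

include htight hcov in
/-- An initial segment of triangular faces forms a strip of triangles. -/
theorem triangleStrip (hF : FaceChain M n F) {x : V} (hx₀ : x ∈ M.verts (F 0))
    (hx : ∀ i, 0 < i → i ≤ n → x ∉ M.verts (F i)) : ∀ k < n, (∀ i ≤ k, M.len (F i) = 3) →
    ∀ e : G.Dart, M.face e = (F k).1 → M.face e.symm = (F (k + 1)).1 →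
      TriangleStrip x e.fst e.snd (vertsUpTo F k) (edgesUpTo F k) := by
  intro k
  induction k with
  | zero =>
    intro hk hlen e h1 h2
    obtain ⟨z, hz1, hz2, hverts, hedges, -⟩ := exists_triangle (hlen 0 le_rfl) h1
    have hx1 := hx 1 one_pos (by omega)
    -- As `x` is not on `F 1`, it is not on the shared edge and must be the apex of the first
    -- triangle.
    have hxz : x = z := by
      rcases (hverts x).1 hx₀ with rfl | rfl | h
      · exact absurd (snd_mem_verts h2) hx1
      · exact absurd (fst_mem_verts h2) hx1
      · exact h
    subst hxz
    convert TriangleStrip.base hz1 hz2 e.adj.ne using 1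
    · ext v
      rw [mem_vertsUpTo]
      simp only [Nat.le_zero, exists_eq_left, hverts, Finset.mem_insert, Finset.mem_singleton]
      tauto
    · ext s
      rw [mem_edgesUpTo]
      simp only [Nat.le_zero, exists_eq_left, hedges, Finset.mem_insert, Finset.mem_singleton,
        Sym2.eq_swap (a := e.snd) (b := x)]
      tauto
  | succ k ih =>
    intro hk hlen e h1 h2
    obtain ⟨d, hd1, hd2⟩ := hF.exists_dart (k := k) (by omega)
    have hstrip := ih (by omega) (fun i hi => hlen i (by omega)) d hd1 hd2
    obtain ⟨z, hz1, hz2, hverts, hedges, hdarts⟩ := exists_triangle (hlen (k + 1) le_rfl) hd2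
    have hfst : d.symm.fst = d.snd := rfl
    have hsnd : d.symm.snd = d.fst := rfl
    rw [hfst] at hz1
    rw [hsnd] at hz2
    simp only [hfst, hsnd] at hverts hedges hdarts
    have hz : z ∉ vertsUpTo F k := by
      intro hz
      obtain ⟨i, hi, hzi⟩ := mem_vertsUpTo.1 hz
      rcases hF.eq_of_mem_verts htight hcov (by omega) hi hd1 hd2 hzi ((hverts z).2 (by simp))
        with h | h
      · exact hz2 h
      · exact hz1 h
    obtain ⟨-, hm1, hm2, -, -, -, hm, -⟩ := hstrip.spec
    have hV : vertsUpTo F (k + 1) = insert z (vertsUpTo F k) := by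
      ext v
      rw [vertsUpTo_succ, Finset.mem_union, hverts, Finset.mem_insert]
      constructor
      · rintro ((rfl | rfl | rfl) | h) <;> simp [*]
      · rintro (rfl | h) <;> simp [*]
    have hE : edgesUpTo F (k + 1) =
        insert s(z, d.fst) (insert s(z, d.snd) (edgesUpTo F k)) := by
      ext s
      rw [edgesUpTo_succ, Finset.mem_union, hedges, Finset.mem_insert, Finset.mem_insert,
        Sym2.eq_swap (a := d.snd) (b := d.fst), Sym2.eq_swap (a := d.fst) (b := z)]
      constructor
      · rintro ((rfl | rfl | rfl) | h) <;> simp [*]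
      · rintro (rfl | rfl | h) <;> simp [*]
    -- The edge to the next face is not the one shared with `F k`, so it is one of the two sides at
    -- the new apex `z`; which one decides which end of the old edge is retired.
    rcases hdarts e h1 with rfl | ⟨he1, he2⟩ | ⟨he1, he2⟩
    · rw [d.symm_symm, hd1] at h2
      have := hF.inj k (by omega) (k + 1 + 1) (by omega) (InnerFace.ext M h2)
      omega
    · rw [he1, he2, hV, hE]
      exact (hstrip.step hz).swap
    · rw [he1, he2, hV, hE, Finset.insert_comm]
      exact hstrip.swap.step hz

end FaceChain

end OuterplaneEmbedding

namespace SimpleGraph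

lemma Reachable.mem_of_closed {V : Type*} {H : SimpleGraph V} {T : Set V}
    (hT : ∀ v w, H.Adj v w → v ∈ T → w ∈ T) {v w : V} (h : H.Reachable v w) (hv : v ∈ T) :
    w ∈ T := by
  obtain ⟨p⟩ := h
  induction p with
  | nil => exact hv
  | cons hadj _ ih => exact ih (hT _ _ hadj hv)

end SimpleGraph

namespace OuterplaneEmbedding

/-! ### The boundary cycle of a face -/

section Cycle

variable {V : Type*} [Fintype V] {G : SimpleGraph V} {M : OuterplaneEmbedding G}

lemma fst_injOn_of_card_verts {f : M.InnerFace} (hcard : (M.verts f).card = M.len f) :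
    Set.InjOn (fun e : G.Dart => e.fst) {e | M.face e = f.1} := by
  have h1 : (fun e : G.Dart => e.fst) '' {e | M.face e = f.1} = (M.verts f : Set V) := by
    ext v
    simp only [Set.mem_image, Finset.mem_coe, mem_verts]
    rfl
  rw [← Set.ncard_image_iff (Set.toFinite _), h1, Set.ncard_coe_finset, hcard]
  rfl

/-- The boundary of a face which visits no vertex twice is a cycle. -/
lemma exists_cycle {f : M.InnerFace} (hcard : (M.verts f).card = M.len f) {d : G.Dart}
    (hd : M.face d = f.1) :
    ∃ (N : ℕ) (u : ℕ → V), u 1 = d.snd ∧ u N = d.fst ∧ 1 ≤ N ∧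
      (∀ i j, 1 ≤ i → i ≤ N → 1 ≤ j → j ≤ N → u i = u j → i = j) ∧
      (∀ v, v ∈ M.verts f → ∃ j, 1 ≤ j ∧ j ≤ N ∧ u j = v) ∧
      (∀ s, s ∈ faceEdges f ↔ s = d.edge ∨ ∃ j, 1 ≤ j ∧ j < N ∧ s = s(u j, u (j + 1))) ∧
      ∀ j, G.Adj (u j) (u (j + 1)) := by
  obtain ⟨hpos, hN, hinj, hall⟩ := M.face_iterate d
  have hsucc : ∀ j, ((M.facePerm ^ j) d).snd = ((M.facePerm ^ (j + 1)) d).fst := by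
    intro j
    rw [pow_succ', Equiv.Perm.mul_apply, M.facePerm_fst]
  have hface : ∀ j, M.face ((M.facePerm ^ j) d) = f.1 := fun j =>
    (M.face_facePerm_pow j d).trans hd
  have hinj' : ∀ i j, 1 ≤ i → i ≤ M.faceLength (M.face d) → 1 ≤ j →
      j ≤ M.faceLength (M.face d) →
      ((M.facePerm ^ i) d).fst = ((M.facePerm ^ j) d).fst → i = j := by
    intro i j hi hi' hj hj' hij
    have h1 := fst_injOn_of_card_verts hcard (hface i) (hface j) hij
    rw [show i = i - 1 + 1 by omega, show j = j - 1 + 1 by omega, pow_succ', pow_succ',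
      Equiv.Perm.mul_apply, Equiv.Perm.mul_apply, EmbeddingLike.apply_eq_iff_eq] at h1
    have := hinj (Set.mem_Iio.2 (by omega)) (Set.mem_Iio.2 (by omega)) h1
    omega
  refine ⟨M.faceLength (M.face d), fun j => ((M.facePerm ^ j) d).fst, ?_, ?_, hpos, hinj', ?_, ?_,
    ?_⟩
  · simpa using M.facePerm_fst d
  · simp only [hN]
  · intro v hv
    obtain ⟨e, he, rfl⟩ := exists_dart_of_mem_verts hv
    obtain ⟨j, hj, rfl⟩ := (hall e).1 (he.trans hd.symm)
    rcases Nat.eq_zero_or_pos j with rfl | h0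
    · exact ⟨M.faceLength (M.face d), hpos, le_rfl, by simp only [hN]; rfl⟩
    · exact ⟨j, h0, hj.le, rfl⟩
  · intro s
    have hedge : ∀ j, ((M.facePerm ^ j) d).edge =
        s(((M.facePerm ^ j) d).fst, ((M.facePerm ^ (j + 1)) d).fst) := by
      intro j
      rw [← hsucc]
      rfl
    rw [mem_faceEdges]
    constructor
    · rintro ⟨e, he, rfl⟩
      obtain ⟨j, hj, rfl⟩ := (hall e).1 (he.trans hd.symm)
      rcases Nat.eq_zero_or_pos j with rfl | h0
      · exact Or.inl rfl
      · exact Or.inr ⟨j, h0, hj, hedge j⟩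
    · rintro (rfl | ⟨j, -, -, rfl⟩)
      · exact ⟨d, hd, rfl⟩
      · exact ⟨_, hface j, hedge j⟩
  · intro j
    have := ((M.facePerm ^ j) d).adj
    rwa [hsucc] at this

lemma connectingPaths_adj {f : M.InnerFace} {a b c d v w : V} :
    (M.connectingPaths f a b c d).Adj v w ↔
      s(v, w) ∈ faceEdges f ∧ s(v, w) ≠ s(a, b) ∧ s(v, w) ≠ s(c, d) := by
  rw [connectingPaths, SimpleGraph.deleteEdges_adj, mem_faceEdges]
  simp only [Set.mem_insert_iff, Set.mem_singleton_iff, not_or]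
  rfl

/-- The boundary of the face `f` without the edges `ab` and `cd` consists of a path from `b` to `d`
and a path from `c` to `a`. -/
lemma exists_arcs {f : M.InnerFace} (hcard : (M.verts f).card = M.len f) {e : G.Dart}
    (he : M.face e = f.1) {a b c d : V} (hea : e.fst = a) (heb : e.snd = b)
    (hcd : s(c, d) ∈ faceEdges f) (hac : a ≠ c) (had : a ≠ d) (hbc : b ≠ c) (hbd : b ≠ d)
    (hpath : (M.connectingPaths f a b c d).Reachable b d) :
    ∃ (N r : ℕ) (u : ℕ → V), 2 ≤ r ∧ r + 2 ≤ N ∧ u 1 = b ∧ u r = d ∧ u (r + 1) = c ∧ u N = a ∧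
      (∀ i j, 1 ≤ i → i ≤ N → 1 ≤ j → j ≤ N → u i = u j → i = j) ∧
      (∀ v, v ∈ M.verts f → ∃ j, 1 ≤ j ∧ j ≤ N ∧ u j = v) ∧
      (∀ s, s ∈ faceEdges f ↔ s = s(a, b) ∨ ∃ j, 1 ≤ j ∧ j < N ∧ s = s(u j, u (j + 1))) ∧
      ∀ j, G.Adj (u j) (u (j + 1)) := by
  obtain ⟨N, u, h1, hN, hpos, hinj, hverts, hedges, hadj⟩ := exists_cycle hcard he
  have hedge : e.edge = s(a, b) := by rw [← hea, ← heb]; rfl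
  rw [hedge] at hedges
  rw [heb] at h1
  rw [hea] at hN
  have hne : s(c, d) ≠ s(a, b) := by
    intro h
    rcases Sym2.eq_iff.1 h with ⟨h, -⟩ | ⟨h, -⟩
    · exact hac h.symm
    · exact hbc h.symm
  obtain ⟨r, hr1, hrN, hr⟩ := ((hedges _).1 hcd).resolve_left hne
  have hr2 : r ≠ 1 := by
    rintro rfl
    rcases Sym2.eq_iff.1 hr with ⟨h, -⟩ | ⟨-, h⟩
    · exact hbc (h1.symm.trans h.symm)
    · exact hbd (h1.symm.trans h.symm)
  have hrN' : r + 1 ≠ N := by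
    intro h
    rw [h, hN] at hr
    rcases Sym2.eq_iff.1 hr with ⟨-, h⟩ | ⟨h, -⟩
    · exact had h.symm
    · exact hac h.symm
  -- Without `ab` and `cd`, the vertices `u 1, …, u r` cannot be left. Hence `d`, being reachable
  -- from `b`, is among them, which fixes the direction in which the cycle runs through `cd`.
  have hT := hpath.mem_of_closed (T := {v | ∃ j, 1 ≤ j ∧ j ≤ r ∧ u j = v}) (by
    rintro v w hvw ⟨i, hi1, hir, rfl⟩
    obtain ⟨hf, hnab, hncd⟩ := connectingPaths_adj.1 hvw
    obtain ⟨j, hj1, hjN, hj⟩ := ((hedges _).1 hf).resolve_left hnab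
    have hjr : j ≠ r := by
      rintro rfl
      exact hncd (hj.trans hr.symm)
    rcases Sym2.eq_iff.1 hj with ⟨h2, h3⟩ | ⟨h2, h3⟩
    · have := hinj _ _ hi1 (by omega) hj1 (by omega) h2
      exact ⟨j + 1, by omega, by omega, h3.symm⟩
    · have := hinj _ _ hi1 (by omega) (by omega) (by omega) h2
      exact ⟨j, by omega, by omega, h3.symm⟩) ⟨1, le_rfl, by omega, h1⟩
  obtain ⟨i, hi1, hir, hi⟩ := hT
  rcases Sym2.eq_iff.1 hr with ⟨h2, h3⟩ | ⟨h2, h3⟩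
  · have := hinj _ _ hi1 (by omega) (by omega) (by omega) (hi.trans h3)
    omega
  · exact ⟨N, r, u, by omega, by omega, h1, h3.symm, h2.symm, hN, hinj, hverts, hedges, hadj⟩

end Cycle

/-! ### Assembling strips and paths -/

section Assembly

variable {V : Type*} [Fintype V] [LinearOrder V] {G : SimpleGraph V} {M : OuterplaneEmbedding G}

/-- Both ends of a common edge would equal `w`. This ensures that no edge factor is counted in two
pieces. -/
lemma disjoint_of_inter_subset_singleton {E₁ E₂ : Finset (Sym2 V)} {S₁ S₂ : Set V} {w : V}
    (h₁ : ∀ e ∈ E₁, ∀ v ∈ e, v ∈ S₁) (h₂ : ∀ e ∈ E₂, ∀ v ∈ e, v ∈ S₂)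
    (hw : ∀ v ∈ S₁, v ∈ S₂ → v = w) (hE : ∀ e ∈ E₂, e ∈ G.edgeSet) : Disjoint E₁ E₂ := by
  rw [Finset.disjoint_left]
  intro e he₁ he₂
  induction e with
  | h p q =>
    have hp := hw p (h₁ _ he₁ p (by simp)) (h₂ _ he₂ p (by simp))
    have hq := hw q (h₁ _ he₁ q (by simp)) (h₂ _ he₂ q (by simp))
    have hadj : G.Adj p q := hE _ he₂
    exact hadj.ne (hp.trans hq.symm)

lemma prod_image_path {k : ℕ} {u : ℕ → V} (hu : Set.InjOn u (Set.Iic k)) :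
    ∏ e ∈ (Finset.range k).image (fun j => s(u j, u (j + 1))), edgeFactor e =
      ∏ j ∈ Finset.range k, edgeFactor s(u j, u (j + 1)) := by
  refine Finset.prod_image fun i hi j hj hij => ?_
  simp only [Finset.coe_range, Set.mem_Iio] at hi hj
  rcases Sym2.eq_iff.1 hij with ⟨h, -⟩ | ⟨h, h'⟩
  · exact hu (Set.mem_Iic.2 (by omega)) (Set.mem_Iic.2 (by omega)) h
  · have h1 := hu (Set.mem_Iic.2 (by omega)) (Set.mem_Iic.2 (by omega)) h
    have h2 := hu (Set.mem_Iic.2 (by omega)) (Set.mem_Iic.2 (by omega)) h'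
    omega

/-- On the boundary cycle `u 1, …, u N` of `f`, the indices `1, …, r` run from `b` to `d` and `r +
1, …, N` from `c` to `a`. The edges `ab` and `cd`, which join these stretches, already belong to the
strips. -/
lemma exists_stripDecomposition_of_dart {f : M.InnerFace} {x y a b c d : V} {SL SR : Finset V}
    {EL ER : Finset (Sym2 V)} (hL : TriangleStrip x a b SL EL) (hR : TriangleStrip y c d SR ER)
    (hdisj : Disjoint SL SR) (hLf : ∀ v ∈ SL, v ∈ M.verts f → v = a ∨ v = b)
    (hRf : ∀ v ∈ SR, v ∈ M.verts f → v = c ∨ v = d)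
    (hcover : ∀ v, v ∈ SL ∨ v ∈ SR ∨ v ∈ M.verts f)
    (hedges : ∀ e, e ∈ G.edgeSet ↔ e ∈ EL ∨ e ∈ ER ∨ e ∈ faceEdges f)
    (hcard : (M.verts f).card = M.len f) {e : G.Dart} (he : M.face e = f.1) (hea : e.fst = a)
    (heb : e.snd = b) (hcd : s(c, d) ∈ faceEdges f)
    (hpath : (M.connectingPaths f a b c d).Reachable b d) :
    ∃ IA IB PA PB ρA ρB, StripDecomposition G x y a b c d SL SR IA IB EL ER PA PB ρA ρB := by
  classical
  obtain ⟨-, haL, hbL, -, -, hab, habE, hEL⟩ := hL.spec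
  obtain ⟨-, hcR, hdR, -, -, hcd', hcdE, hER⟩ := hR.spec
  have hlr : ∀ u ∈ SL, ∀ v ∈ SR, u ≠ v := by
    rintro u hu _ hv rfl
    exact Finset.disjoint_left.1 hdisj hu hv
  obtain ⟨N, r, u, hr2, hrN, hu1, hur, hur1, huN, hinj, hverts, hfE, hadj⟩ :=
    exists_arcs hcard he hea heb hcd (hlr a haL c hcR) (hlr a haL d hdR) (hlr b hbL c hcR)
      (hlr b hbL d hdR) hpath
  have hmemf : ∀ j, 1 ≤ j → j ≤ N → u j ∈ M.verts f := by
    intro j h1 h2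
    rcases h2.eq_or_lt with rfl | h2
    · exact mem_verts_of_mem_faceEdges ((hfE s(a, b)).2 (Or.inl rfl)) (by simp [huN])
    · exact mem_verts_of_mem_faceEdges ((hfE _).2 (Or.inr ⟨j, h1, h2, rfl⟩)) (Sym2.mem_mk_left _ _)
  have hidxL : ∀ j, 1 ≤ j → j ≤ N → u j ∈ SL → j = 1 ∨ j = N := by
    intro j h1 h2 h3
    rcases hLf _ h3 (hmemf j h1 h2) with h | h
    · exact Or.inr (hinj _ _ h1 h2 (by omega) le_rfl (h.trans huN.symm))
    · exact Or.inl (hinj _ _ h1 h2 le_rfl (by omega) (h.trans hu1.symm))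
  have hidxR : ∀ j, 1 ≤ j → j ≤ N → u j ∈ SR → j = r ∨ j = r + 1 := by
    intro j h1 h2 h3
    rcases hRf _ h3 (hmemf j h1 h2) with h | h
    · exact Or.inr (hinj _ _ h1 h2 (by omega) (by omega) (h.trans hur1.symm))
    · exact Or.inl (hinj _ _ h1 h2 (by omega) (by omega) (h.trans hur.symm))
  have hinjA : Set.InjOn (fun j => u (j + (r + 1))) (Set.Iic (N - (r + 1))) := by
    intro i hi j hj hij
    rw [Set.mem_Iic] at hi hj
    have := hinj _ _ (by omega) (by omega) (by omega) (by omega) hij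
    omega
  have hinjB : Set.InjOn (fun j => u (j + 1)) (Set.Iic (r - 1)) := by
    intro i hi j hj hij
    rw [Set.mem_Iic] at hi hj
    have := hinj _ _ (by omega) (by omega) (by omega) (by omega) hij
    omega
  obtain ⟨ρA, hρA⟩ := exists_arcReduces G (N - (r + 1)) (by omega) _ hinjA
    (fun j _ => by simpa only [add_right_comm] using hadj (j + (r + 1)))
  obtain ⟨ρB, hρB⟩ := exists_arcReduces G (r - 1) (by omega) _ hinjB
    (fun j _ => hadj (j + 1))
  simp only [show N - (r + 1) + (r + 1) = N by omega, show r - 1 + 1 = r by omega, zero_add, hu1,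
    hur, hur1, huN] at hρA hρB
  have hmemA : ∀ v, v ∈ (Finset.Ioo 0 (N - (r + 1))).image (fun j => u (j + (r + 1))) ↔
      ∃ j, r + 1 < j ∧ j < N ∧ u j = v := by
    intro v
    simp only [Finset.mem_image, Finset.mem_Ioo]
    constructor
    · rintro ⟨j, hj, rfl⟩
      exact ⟨_, by omega, by omega, rfl⟩
    · rintro ⟨j, h1, h2, rfl⟩
      exact ⟨j - (r + 1), by omega, by congr 1; omega⟩
  have hmemB : ∀ v, v ∈ (Finset.Ioo 0 (r - 1)).image (fun j => u (j + 1)) ↔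
      ∃ j, 1 < j ∧ j < r ∧ u j = v := by
    intro v
    simp only [Finset.mem_image, Finset.mem_Ioo]
    constructor
    · rintro ⟨j, hj, rfl⟩
      exact ⟨_, by omega, by omega, rfl⟩
    · rintro ⟨j, h1, h2, rfl⟩
      exact ⟨j - 1, by omega, by congr 1; omega⟩
  refine ⟨_, _, _, _, ρA, ρB, ⟨hL, hR, hρA.symm, hρB, hdisj, ?_, ?_, ?_, ?_, ?_, ?_, ?_⟩⟩
  · rw [Finset.disjoint_left]
    intro v hv hv'
    obtain ⟨j, h1, h2, rfl⟩ := (hmemA v).1 hv'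
    have := hidxL j (by omega) (by omega) hv
    omega
  · rw [Finset.disjoint_left]
    intro v hv hv'
    obtain ⟨j, h1, h2, rfl⟩ := (hmemB v).1 hv'
    have := hidxL j (by omega) (by omega) hv
    omega
  · rw [Finset.disjoint_left]
    intro v hv hv'
    obtain ⟨j, h1, h2, rfl⟩ := (hmemA v).1 hv'
    have := hidxR j (by omega) (by omega) hv
    omega
  · rw [Finset.disjoint_left]
    intro v hv hv'
    obtain ⟨j, h1, h2, rfl⟩ := (hmemB v).1 hv'
    have := hidxR j (by omega) (by omega) hv
    omega
  · rw [Finset.disjoint_left]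
    intro v hv hv'
    obtain ⟨i, h1, h2, rfl⟩ := (hmemA v).1 hv
    obtain ⟨j, h3, h4, h5⟩ := (hmemB _).1 hv'
    have := hinj _ _ (by omega) (by omega) (by omega) (by omega) h5
    omega
  · intro v
    rcases hcover v with h | h | h
    · exact Or.inl h
    · exact Or.inr (Or.inl h)
    · obtain ⟨j, h1, h2, rfl⟩ := hverts v h
      by_cases j1 : j = 1
      · subst j1; exact Or.inl (hu1 ▸ hbL)
      by_cases jN : j = N
      · subst jN; exact Or.inl (huN ▸ haL)
      by_cases jr : j = r
      · subst jr; exact Or.inr (Or.inl (hur ▸ hdR))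
      by_cases jr1 : j = r + 1
      · subst jr1; exact Or.inr (Or.inl (hur1 ▸ hcR))
      rcases lt_or_gt_of_ne jr with h | h
      · exact Or.inr (Or.inr (Or.inr ((hmemB _).2 ⟨j, by omega, h, rfl⟩)))
      · exact Or.inr (Or.inr (Or.inl ((hmemA _).2 ⟨j, by omega, by omega, rfl⟩)))
  · rw [← prod_image_path hinjA, ← prod_image_path hinjB, graphPolynomial_eq_prod_edgeFactor]
    set EA := (Finset.range (N - (r + 1))).image
      (fun j => s(u (j + (r + 1)), u (j + 1 + (r + 1)))) with hEA
    set EB := (Finset.range (r - 1)).image (fun j => s(u (j + 1), u (j + 1 + 1))) with hEB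
    have hmemEA : ∀ s, s ∈ EA ↔ ∃ j, r + 1 ≤ j ∧ j < N ∧ s = s(u j, u (j + 1)) := by
      intro s
      simp only [hEA, Finset.mem_image, Finset.mem_range]
      constructor
      · rintro ⟨j, hj, rfl⟩
        exact ⟨j + (r + 1), by omega, by omega, by rw [add_right_comm j 1]⟩
      · rintro ⟨j, h1, h2, rfl⟩
        exact ⟨j - (r + 1), by omega, by
          rw [show j - (r + 1) + (r + 1) = j by omega,
            show j - (r + 1) + 1 + (r + 1) = j + 1 by omega]⟩
    have hmemEB : ∀ s, s ∈ EB ↔ ∃ j, 1 ≤ j ∧ j < r ∧ s = s(u j, u (j + 1)) := by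
      intro s
      simp only [hEB, Finset.mem_image, Finset.mem_range]
      constructor
      · rintro ⟨j, hj, rfl⟩
        exact ⟨_, by omega, by omega, rfl⟩
      · rintro ⟨j, h1, h2, rfl⟩
        exact ⟨j - 1, by omega, by rw [show j - 1 + 1 = j by omega]⟩
    have hsubA : ∀ s ∈ EA, ∀ v ∈ s, v ∈ {v | ∃ j, r + 1 ≤ j ∧ j ≤ N ∧ u j = v} := by
      intro s hs v hv
      obtain ⟨j, h1, h2, rfl⟩ := (hmemEA s).1 hs
      rcases Sym2.mem_iff.1 hv with rfl | rfl
      · exact ⟨j, h1, by omega, rfl⟩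
      · exact ⟨j + 1, by omega, by omega, rfl⟩
    have hsubB : ∀ s ∈ EB, ∀ v ∈ s, v ∈ {v | ∃ j, 1 ≤ j ∧ j ≤ r ∧ u j = v} := by
      intro s hs v hv
      obtain ⟨j, h1, h2, rfl⟩ := (hmemEB s).1 hs
      rcases Sym2.mem_iff.1 hv with rfl | rfl
      · exact ⟨j, h1, by omega, rfl⟩
      · exact ⟨j + 1, by omega, by omega, rfl⟩
    have hGA : ∀ s ∈ EA, s ∈ G.edgeSet := by
      intro s hs
      obtain ⟨j, -, -, rfl⟩ := (hmemEA s).1 hs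
      exact hadj j
    have hGB : ∀ s ∈ EB, s ∈ G.edgeSet := by
      intro s hs
      obtain ⟨j, -, -, rfl⟩ := (hmemEB s).1 hs
      exact hadj j
    have hGR : ∀ s ∈ ER, s ∈ G.edgeSet := fun s hs => (hedges s).2 (Or.inr (Or.inl hs))
    have hunion : G.edgeFinset = ((EL ∪ ER) ∪ EA) ∪ EB := by
      ext s
      rw [SimpleGraph.mem_edgeFinset, hedges, hfE]
      simp only [Finset.mem_union, hmemEA, hmemEB]
      constructor
      · rintro (h | h | rfl | ⟨j, h1, h2, rfl⟩)
        · exact Or.inl (Or.inl (Or.inl h))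
        · exact Or.inl (Or.inl (Or.inr h))
        · exact Or.inl (Or.inl (Or.inl habE))
        · rcases lt_trichotomy j r with h | h | h
          · exact Or.inr ⟨j, h1, h, rfl⟩
          · refine Or.inl (Or.inl (Or.inr ?_))
            rw [h, hur, hur1, Sym2.eq_swap]
            exact hcdE
          · exact Or.inl (Or.inr ⟨j, h, h2, rfl⟩)
      · rintro (((h | h) | ⟨j, h1, h2, rfl⟩) | ⟨j, h1, h2, rfl⟩)
        · exact Or.inl h
        · exact Or.inr (Or.inl h)
        · exact Or.inr (Or.inr (Or.inr ⟨j, by omega, h2, rfl⟩))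
        · exact Or.inr (Or.inr (Or.inr ⟨j, h1, by omega, rfl⟩))
    have dLR : Disjoint EL ER := disjoint_of_inter_subset_singleton (w := a) (S₁ := SL) (S₂ := SR)
      hEL hER (fun v h1 h2 => absurd rfl (hlr v h1 v h2)) hGR
    have dLA : Disjoint EL EA := disjoint_of_inter_subset_singleton (w := a) hEL hsubA (by
      rintro v h1 ⟨j, h2, h3, rfl⟩
      have := hidxL j (by omega) h3 h1
      rw [← huN]; congr 1; omega) hGA
    have dLB : Disjoint EL EB := disjoint_of_inter_subset_singleton (w := b) hEL hsubB (by
      rintro v h1 ⟨j, h2, h3, rfl⟩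
      have := hidxL j (by omega) (by omega) h1
      rw [← hu1]; congr 1; omega) hGB
    have dRA : Disjoint ER EA := disjoint_of_inter_subset_singleton (w := c) hER hsubA (by
      rintro v h1 ⟨j, h2, h3, rfl⟩
      have := hidxR j (by omega) h3 h1
      rw [← hur1]; congr 1; omega) hGA
    have dRB : Disjoint ER EB := disjoint_of_inter_subset_singleton (w := d) hER hsubB (by
      rintro v h1 ⟨j, h2, h3, rfl⟩
      have := hidxR j (by omega) (by omega) h1
      rw [← hur]; congr 1; omega) hGB
    have dAB : Disjoint EA EB := disjoint_of_inter_subset_singleton (w := a) hsubA hsubB (by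
      rintro v ⟨i, h1, h2, rfl⟩ ⟨j, h3, h4, h5⟩
      have := hinj _ _ (by omega) (by omega) (by omega) (by omega) h5
      omega) hGB
    rw [hunion, Finset.prod_union, Finset.prod_union, Finset.prod_union dLR]
    · exact Finset.disjoint_union_left.2 ⟨dLA, dRA⟩
    · exact Finset.disjoint_union_left.2 ⟨Finset.disjoint_union_left.2 ⟨dLB, dRB⟩, dAB⟩

theorem exists_stripDecomposition {f : M.InnerFace} {x y a b c d : V} {SL SR : Finset V}
    {EL ER : Finset (Sym2 V)} (hL : TriangleStrip x a b SL EL) (hR : TriangleStrip y c d SR ER)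
    (hdisj : Disjoint SL SR) (hLf : ∀ v ∈ SL, v ∈ M.verts f → v = a ∨ v = b)
    (hRf : ∀ v ∈ SR, v ∈ M.verts f → v = c ∨ v = d)
    (hcover : ∀ v, v ∈ SL ∨ v ∈ SR ∨ v ∈ M.verts f)
    (hedges : ∀ e, e ∈ G.edgeSet ↔ e ∈ EL ∨ e ∈ ER ∨ e ∈ faceEdges f)
    (hcard : (M.verts f).card = M.len f) (hab : s(a, b) ∈ faceEdges f)
    (hcd : s(c, d) ∈ faceEdges f) (hac' : (M.connectingPaths f a b c d).Reachable a c)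
    (hbd' : (M.connectingPaths f a b c d).Reachable b d) :
    ∃ IA IB PA PB ρA ρB, StripDecomposition G x y a b c d SL SR IA IB EL ER PA PB ρA ρB := by
  obtain ⟨e, he, hab'⟩ := mem_faceEdges.1 hab
  -- If the boundary walk traverses `ab` in the other direction, exchanging `a` with `b` and `c`
  -- with `d` restores the first case.
  rcases Sym2.eq_iff.1 (show s(e.fst, e.snd) = s(a, b) from hab') with ⟨h1, h2⟩ | ⟨h1, h2⟩
  · exact exists_stripDecomposition_of_dart hL hR hdisj hLf hRf hcover hedges hcard he h1 h2 hcd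
      hbd'
  · have hswap : M.connectingPaths f b a d c = M.connectingPaths f a b c d := by
      rw [connectingPaths, connectingPaths, Sym2.eq_swap (a := b), Sym2.eq_swap (a := d)]
    obtain ⟨IA, IB, PA, PB, ρA, ρB, D⟩ := exists_stripDecomposition_of_dart hL.swap hR.swap hdisj
      (fun v h h' => (hLf v h h').symm) (fun v h h' => (hRf v h h').symm) hcover hedges hcard he
      h1 h2 (by rwa [Sym2.eq_swap]) (hswap ▸ hac')
    exact ⟨_, _, _, _, _, _, D.swap⟩

end Assembly

end OuterplaneEmbedding

/-! ### From the labelled face to the decomposition -/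

namespace OuterplaneEmbedding

variable {V : Type*} [Fintype V] [LinearOrder V] {G : SimpleGraph V} {M : OuterplaneEmbedding G}

lemma _root_.TriangleStrip.of_mem {x p q a b : V} {S : Finset V} {E : Finset (Sym2 V)}
    (h : TriangleStrip x p q S E) (hab : a ≠ b) (ha : a = p ∨ a = q) (hb : b = p ∨ b = q) :
    TriangleStrip x a b S E := by
  rcases ha with rfl | rfl <;> rcases hb with rfl | rfl
  · exact absurd rfl hab
  · exact h
  · exact h.swap
  · exact absurd rfl hab

/-- A sequence of faces in which all but the face `F i` are triangles consists of a strip of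
triangles on each side of `F i`. -/
lemma FaceChain.exists_two_strips {n : ℕ} {F : ℕ → M.InnerFace} (hF : FaceChain M n F)
    (htight : Fintype.card V + 2 * Fintype.card M.InnerFace = ∑ h, M.len h + 2)
    (hcov : ∀ v, ∃ h, v ∈ M.verts h) {x y : V} (hx₀ : x ∈ M.verts (F 0))
    (hx : ∀ i, 0 < i → i ≤ n → x ∉ M.verts (F i)) (hy₀ : y ∈ M.verts (F n))
    (hy : ∀ i < n, y ∉ M.verts (F i)) {i : ℕ} (hi : 0 < i) (hin : i < n)
    (htri : ∀ h, h ≠ F i → M.len h = 3) :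
    ∃ (SL SR : Finset V) (EL ER : Finset (Sym2 V)) (p q p' q' : V),
      TriangleStrip x p q SL EL ∧ TriangleStrip y p' q' SR ER ∧
      (∀ v, v ∈ SL ↔ ∃ j < i, v ∈ M.verts (F j)) ∧
      (∀ v, v ∈ SR ↔ ∃ j, i < j ∧ j ≤ n ∧ v ∈ M.verts (F j)) ∧
      (∀ s, s ∈ EL ↔ ∃ j < i, s ∈ faceEdges (F j)) ∧
      (∀ s, s ∈ ER ↔ ∃ j, i < j ∧ j ≤ n ∧ s ∈ faceEdges (F j)) ∧
      s(p, q) ∈ faceEdges (F i) ∧ s(p', q') ∈ faceEdges (F i) ∧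
      (∀ v ∈ SL, v ∈ M.verts (F i) → v = p ∨ v = q) ∧
      (∀ v ∈ SR, v ∈ M.verts (F i) → v = p' ∨ v = q') ∧
      (∀ v ∈ SL, v ∈ SR → v ∈ M.verts (F i)) := by
  obtain ⟨k, rfl⟩ : ∃ k, i = k + 1 := ⟨i - 1, by omega⟩
  have hF' := hF.reverse
  have htri' : ∀ j ≤ n, j ≠ k + 1 → M.len (F j) = 3 := fun j hj hne => htri _ fun h =>
    hne (hF.inj j hj _ (by omega) h)
  obtain ⟨e, he, he'⟩ := hF.exists_dart (k := k) (by omega)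
  -- The strip of `y` ends with the face `F (k + 2)` just beyond `F i = F (k + 1)`; in the reversed
  -- chain that face has index `n - (k + 2)`.
  obtain ⟨e₁, he₁, he₁'⟩ := hF'.exists_dart (k := n - (k + 2)) (by omega)
  have hL := hF.triangleStrip htight hcov hx₀ hx k (by omega)
    (fun j hj => htri' j (by omega) (by omega)) e he he'
  have hR := hF'.triangleStrip htight hcov (x := y) (by simpa using hy₀)
    (fun j h1 h2 => hy _ (by omega)) (n - (k + 2)) (by omega)
    (fun j hj => htri' _ (by omega) (by omega)) e₁ he₁ he₁'
  have hSL : ∀ v, v ∈ FaceChain.vertsUpTo F k ↔ ∃ j < k + 1, v ∈ M.verts (F j) := by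
    intro v
    simp only [FaceChain.mem_vertsUpTo, Nat.lt_succ_iff]
  have hSR : ∀ v, v ∈ FaceChain.vertsUpTo (fun j => F (n - j)) (n - (k + 2)) ↔
      ∃ j, k + 1 < j ∧ j ≤ n ∧ v ∈ M.verts (F j) := by
    intro v
    rw [FaceChain.mem_vertsUpTo]
    constructor
    · rintro ⟨j, hj, hv⟩
      exact ⟨n - j, by omega, by omega, hv⟩
    · rintro ⟨j, h1, h2, hv⟩
      exact ⟨n - j, by omega, by rwa [show n - (n - j) = j by omega]⟩
  have hEL : ∀ s, s ∈ FaceChain.edgesUpTo F k ↔ ∃ j < k + 1, s ∈ faceEdges (F j) := by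
    intro v
    simp only [FaceChain.mem_edgesUpTo, Nat.lt_succ_iff]
  have hER : ∀ s, s ∈ FaceChain.edgesUpTo (fun j => F (n - j)) (n - (k + 2)) ↔
      ∃ j, k + 1 < j ∧ j ≤ n ∧ s ∈ faceEdges (F j) := by
    intro v
    rw [FaceChain.mem_edgesUpTo]
    constructor
    · rintro ⟨j, hj, hv⟩
      exact ⟨n - j, by omega, by omega, hv⟩
    · rintro ⟨j, h1, h2, hv⟩
      exact ⟨n - j, by omega, by rwa [show n - (n - j) = j by omega]⟩
  have hidx : n - (n - (k + 2) + 1) = k + 1 := by omega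
  refine ⟨_, _, _, _, _, _, _, _, hL, hR, hSL, hSR, hEL, hER, ?_, ?_, ?_, ?_, ?_⟩
  · rw [mem_faceEdges]
    exact ⟨e.symm, he', by rw [SimpleGraph.Dart.edge_symm]; rfl⟩
  · rw [mem_faceEdges]
    rw [hidx] at he₁'
    exact ⟨e₁.symm, he₁', by rw [SimpleGraph.Dart.edge_symm]; rfl⟩
  · intro v hv hvi
    obtain ⟨j, hj, hvj⟩ := (hSL v).1 hv
    exact hF.eq_of_mem_verts htight hcov (by omega) (by omega) he he' hvj hvi
  · intro v hv hvi
    obtain ⟨j, hj, hjn, hvj⟩ := (hSR v).1 hv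
    refine hF'.eq_of_mem_verts htight hcov (i := n - j) (by omega) (by omega) he₁ he₁' ?_ ?_
    · simpa only [show n - (n - j) = j by omega] using hvj
    · simpa only [hidx] using hvi
  · intro v hv hv'
    obtain ⟨j, hj, hvj⟩ := (hSL v).1 hv
    obtain ⟨l, hl, hln, hvl⟩ := (hSR v).1 hv'
    exact hF.mem_verts_of_between htight hcov hj.le hvj hl.le hln hvl

/-- Two darts of one edge are equal or reverse to each other, and equal darts would lie on the same
face. -/
lemma IsSharedEdge.exists_adj {f : M.InnerFace} {a b : V} (h : M.IsSharedEdge f a b) :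
    ∃ g, M.weakDual.Adj f g ∧ s(a, b) ∈ faceEdges f ∧ s(a, b) ∈ faceEdges g := by
  obtain ⟨g, hne, ⟨d, hd, hd'⟩, ⟨e, he, he'⟩⟩ := h
  refine ⟨g, ⟨hne.symm, d, hd, ?_⟩, mem_faceEdges.2 ⟨d, hd, hd'⟩, mem_faceEdges.2 ⟨e, he, he'⟩⟩
  rcases SimpleGraph.dart_edge_eq_iff e d |>.1 (he'.trans hd'.symm) with rfl | rfl
  · exact absurd (InnerFace.ext M (he.symm.trans hd)) hne
  · exact he

theorem exists_stripDecomposition_of_isLabelling {n : ℕ} {F : ℕ → M.InnerFace}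
    (hF : FaceChain M n F)
    (htight : Fintype.card V + 2 * Fintype.card M.InnerFace = ∑ h, M.len h + 2)
    (hcov : ∀ v, ∃ h, v ∈ M.verts h) (hedge : ∀ e ∈ G.edgeSet, ∃ h : M.InnerFace, e ∈ faceEdges h)
    {x y a b c d : V} (hx₀ : x ∈ M.verts (F 0))
    (hx : ∀ i, 0 < i → i ≤ n → x ∉ M.verts (F i)) (hy₀ : y ∈ M.verts (F n))
    (hy : ∀ i < n, y ∉ M.verts (F i)) {i : ℕ} (hi : 0 < i) (hin : i < n)
    (htri : ∀ h, h ≠ F i → M.len h = 3) (hlab : M.IsLabelling (F i) x y a b c d) :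
    ∃ SL SR IA IB EL ER PA PB ρA ρB,
      StripDecomposition G x y a b c d SL SR IA IB EL ER PA PB ρA ρB ∧
      (∀ u v, s(u, v) ∈ EL → (M.sides (F i) a b c d).Adj u v) ∧
      (∀ u v, s(u, v) ∈ ER → (M.sides (F i) a b c d).Adj u v) := by
  obtain ⟨SL, SR, EL, ER, p, q, p', q', hL, hR, hSL, hSR, hEL, hER, hpq, hpq', hLf, hRf, hLR⟩ :=
    hF.exists_two_strips htight hcov hx₀ hx hy₀ hy hi hin htri
  have hnd := hlab.nodup
  simp only [List.nodup_cons, List.mem_cons, not_or, List.not_mem_nil, not_false_eq_true,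
    and_true, List.nodup_nil] at hnd
  obtain ⟨-, -, ⟨hab, hac, had⟩, ⟨hbc, hbd⟩, hcd⟩ := hnd
  obtain ⟨g, hg, hgf, hgg⟩ := hlab.shared_ab.exists_adj
  obtain ⟨g', hg', hgf', hgg'⟩ := hlab.shared_cd.exists_adj
  have haf := mem_verts_of_mem_faceEdges hgf (v := a) (by simp)
  have hbf := mem_verts_of_mem_faceEdges hgf (v := b) (by simp)
  have hcf := mem_verts_of_mem_faceEdges hgf' (v := c) (by simp)
  have hdf := mem_verts_of_mem_faceEdges hgf' (v := d) (by simp)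
  have hside : ∀ g u v, M.weakDual.Adj (F i) g → s(u, v) ∈ faceEdges g →
      (u ∈ SL ∧ v ∈ SL) ∨ (u ∈ SR ∧ v ∈ SR) := by
    intro g u v hg hgg
    obtain ⟨j, hj, rfl⟩ := hF.surj g
    have hu := mem_verts_of_mem_faceEdges hgg (v := u) (by simp)
    have hv := mem_verts_of_mem_faceEdges hgg (v := v) (by simp)
    rcases hF.of_adj i hin.le j hj hg with h | h
    · exact Or.inr ⟨(hSR u).2 ⟨j, by omega, hj, hu⟩, (hSR v).2 ⟨j, by omega, hj, hv⟩⟩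
    · exact Or.inl ⟨(hSL u).2 ⟨j, by omega, hu⟩, (hSL v).2 ⟨j, by omega, hv⟩⟩
  -- Each strip meets `F i` in at most two vertices, so it cannot contain three of `a, b, c, d`.
  have hthree : ∀ {p q u v w : V}, u ≠ v → u ≠ w → v ≠ w → (u = p ∨ u = q) → (v = p ∨ v = q) →
      (w = p ∨ w = q) → False := by
    rintro p q u v w h1 h2 h3 (rfl | rfl) (rfl | rfl) (rfl | rfl) <;> contradiction
  have hedges : ∀ e, e ∈ G.edgeSet ↔ e ∈ EL ∨ e ∈ ER ∨ e ∈ faceEdges (F i) := by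
    intro e
    constructor
    · intro he
      obtain ⟨h, hh⟩ := hedge e he
      obtain ⟨j, hj, rfl⟩ := hF.surj h
      rcases lt_trichotomy j i with h | rfl | h
      · exact Or.inl ((hEL e).2 ⟨j, h, hh⟩)
      · exact Or.inr (Or.inr hh)
      · exact Or.inr (Or.inl ((hER e).2 ⟨j, h, hj, hh⟩))
    · have : ∀ h : M.InnerFace, e ∈ faceEdges h → e ∈ G.edgeSet := by
        intro h hh
        obtain ⟨d, -, rfl⟩ := mem_faceEdges.1 hh
        exact d.edge_mem
      rintro (h | h | h)
      · obtain ⟨j, -, hj⟩ := (hEL e).1 h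
        exact this _ hj
      · obtain ⟨j, -, -, hj⟩ := (hER e).1 h
        exact this _ hj
      · exact this _ h
  -- the edge `ab` is on the side of `x`
  have habL : (a ∈ SL ∧ b ∈ SL) ∧ (c ∈ SR ∧ d ∈ SR) := by
    rcases hside g a b hg hgg with ⟨ha, hb⟩ | ⟨ha, hb⟩ <;>
      rcases hside g' c d hg' hgg' with ⟨hc, hd⟩ | ⟨hc, hd⟩
    · exact (hthree hab hac hbc (hLf a ha haf) (hLf b hb hbf) (hLf c hc hcf)).elim
    · exact ⟨⟨ha, hb⟩, hc, hd⟩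
    -- With `ab` on the side of `y` and `cd` on the side of `x`, no edge of `sides` would leave
    -- `SL`, so `a` could not be reached from `x`.
    · exfalso
      have hnaL : a ∉ SL := fun h => hthree hac had hcd (hLf a h haf) (hLf c hc hcf) (hLf d hd hdf)
      have hnbL : b ∉ SL := fun h => hthree hbc hbd hcd (hLf b h hbf) (hLf c hc hcf) (hLf d hd hdf)
      refine hnaL (hlab.side_x.mem_of_closed (T := {v | v ∈ SL}) ?_ hL.spec.1)
      intro u v huv hu
      have hu : u ∈ SL := hu
      obtain ⟨hG, hnc⟩ := (SimpleGraph.sdiff_adj _ _ _ _).1 huv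
      rcases (hedges s(u, v)).1 hG with h | h | h
      · exact hL.spec.2.2.2.2.2.2.2 _ h v (by simp)
      · exfalso
        have huR : u ∈ SR := hR.spec.2.2.2.2.2.2.2 _ h u (by simp)
        have huf := hLR u hu huR
        have h1 := hLf u hu huf
        have h2 := hRf u huR huf
        by_cases hua : u = a
        · exact hnaL (hua ▸ hu)
        · by_cases hub : u = b
          · exact hnbL (hub ▸ hu)
          · exact hthree hab (Ne.symm hua) (Ne.symm hub) (hRf a ha haf) (hRf b hb hbf) h2
      · rw [connectingPaths_adj] at hnc
        by_cases h1 : s(u, v) = s(a, b)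
        · rcases Sym2.eq_iff.1 h1 with ⟨rfl, -⟩ | ⟨rfl, -⟩
          · exact absurd hu hnaL
          · exact absurd hu hnbL
        · have h2 : s(u, v) = s(c, d) := by
            by_contra h2
            exact hnc ⟨h, h1, h2⟩
          rcases Sym2.eq_iff.1 h2 with ⟨-, rfl⟩ | ⟨-, rfl⟩
          · exact hd
          · exact hc
    · exact (hthree hab hac hbc (hRf a ha haf) (hRf b hb hbf) (hRf c hc hcf)).elim
  obtain ⟨⟨ha, hb⟩, hc, hd⟩ := habL
  have ha' := hLf a ha haf
  have hb' := hLf b hb hbf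
  have hc' := hRf c hc hcf
  have hd' := hRf d hd hdf
  have hLf' : ∀ v ∈ SL, v ∈ M.verts (F i) → v = a ∨ v = b := by
    intro v hv hvf
    by_contra hcon
    push Not at hcon
    exact hthree hab hcon.1.symm hcon.2.symm ha' hb' (hLf v hv hvf)
  have hRf' : ∀ v ∈ SR, v ∈ M.verts (F i) → v = c ∨ v = d := by
    intro v hv hvf
    by_contra hcon
    push Not at hcon
    exact hthree hcd hcon.1.symm hcon.2.symm hc' hd' (hRf v hv hvf)
  have hdisj : Disjoint SL SR := by
    rw [Finset.disjoint_left]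
    intro v hv hv'
    have hvf := hLR v hv hv'
    rcases hLf' v hv hvf with rfl | rfl
    · exact (hRf' v hv' hvf).elim hac had
    · exact (hRf' v hv' hvf).elim hbc hbd
  have hcover : ∀ v, v ∈ SL ∨ v ∈ SR ∨ v ∈ M.verts (F i) := by
    intro v
    obtain ⟨h, hh⟩ := hcov v
    obtain ⟨j, hj, rfl⟩ := hF.surj h
    rcases lt_trichotomy j i with h | rfl | h
    · exact Or.inl ((hSL v).2 ⟨j, h, hh⟩)
    · exact Or.inr (Or.inr hh)
    · exact Or.inr (Or.inl ((hSR v).2 ⟨j, h, hj, hh⟩))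
  have hL' := hL.of_mem hab ha' hb'
  have hR' := hR.of_mem hcd hc' hd'
  obtain ⟨IA, IB, PA, PB, ρA, ρB, D⟩ := exists_stripDecomposition hL' hR' hdisj hLf' hRf' hcover
    hedges ((hF.card_eq htight hcov).1 _) hgf hgf' hlab.path_ac hlab.path_bd
  have hpair : ∀ {u v p q : V}, u ≠ v → (u = p ∨ u = q) → (v = p ∨ v = q) → s(u, v) = s(p, q) := by
    rintro u v p q h (rfl | rfl) (rfl | rfl)
    · exact absurd rfl h
    · rfl
    · exact Sym2.eq_swap
    · exact absurd rfl h
  refine ⟨SL, SR, IA, IB, EL, ER, PA, PB, ρA, ρB, D, fun u v huv => ?_, fun u v huv => ?_⟩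
  · have hG : G.Adj u v := (hedges _).2 (Or.inl huv)
    refine (SimpleGraph.sdiff_adj _ _ _ _).2 ⟨hG, fun hcon => ?_⟩
    obtain ⟨h1, h2, -⟩ := connectingPaths_adj.1 hcon
    exact h2 (hpair hG.ne
      (hLf' u (hL.spec.2.2.2.2.2.2.2 _ huv u (by simp)) (mem_verts_of_mem_faceEdges h1 (by simp)))
      (hLf' v (hL.spec.2.2.2.2.2.2.2 _ huv v (by simp)) (mem_verts_of_mem_faceEdges h1 (by simp))))
  · have hG : G.Adj u v := (hedges _).2 (Or.inr (Or.inl huv))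
    refine (SimpleGraph.sdiff_adj _ _ _ _).2 ⟨hG, fun hcon => ?_⟩
    obtain ⟨h1, -, h2⟩ := connectingPaths_adj.1 hcon
    exact h2 (hpair hG.ne
      (hRf' u (hR.spec.2.2.2.2.2.2.2 _ huv u (by simp)) (mem_verts_of_mem_faceEdges h1 (by simp)))
      (hRf' v (hR.spec.2.2.2.2.2.2.2 _ huv v (by simp)) (mem_verts_of_mem_faceEdges h1 (by simp))))

/-- The combinatorial structure behind the theorem: two strips of triangles which are joined by two
paths around the face `f`. -/
theorem exists_stripDecomposition_of_isFundamental {x y a b c d : V} (hfund : M.IsFundamental x y)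
    {f : M.InnerFace} (huniq : ∀ g : M.InnerFace, g ≠ f → M.faceLength g.1 = 3)
    (hx : ¬ M.OnFace x f.1) (hy : ¬ M.OnFace y f.1) (hlab : M.IsLabelling f x y a b c d) :
    ∃ SL SR IA IB EL ER PA PB ρA ρB,
      StripDecomposition G x y a b c d SL SR IA IB EL ER PA PB ρA ρB ∧
      (∀ u v, s(u, v) ∈ EL → (M.sides f a b c d).Adj u v) ∧
      (∀ u v, s(u, v) ∈ ER → (M.sides f a b c d).Adj u v) := by
  have hnd := hlab.nodup
  simp only [List.nodup_cons, List.mem_cons, not_or, List.not_mem_nil, not_false_eq_true,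
    and_true, List.nodup_nil] at hnd
  obtain ⟨⟨hxy, hxa, -⟩, ⟨hya, -⟩, ⟨hab, hac, -⟩, ⟨hbc, -⟩, -⟩ := hnd
  have hcover : ∀ v, ∃ h, M.OnShortestPath x y h ∧ v ∈ M.verts h := by
    intro v
    have hv := congrArg SimpleGraph.Subgraph.verts hfund
    by_cases hadj : G.Adj x y
    -- The fundamental subgraph would be the edge `xy`, but `a` is a third vertex.
    · exfalso
      rw [fundamentalSubgraph, dif_pos hadj] at hv
      have : a ∈ (G.subgraphOfAdj hadj).verts := by rw [hv]; trivial
      rcases this with h | h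
      · exact hxa h.symm
      · exact hya h.symm
    · rw [fundamentalSubgraph, dif_neg hadj] at hv
      have : v ∈ (⊤ : G.Subgraph).verts := trivial
      rw [← hv] at this
      obtain ⟨s, t, p, hp, k, hk, hvk⟩ := this
      exact ⟨k, ⟨s, t, p, hp, hk⟩, M.mem_verts.2 hvk⟩
  obtain ⟨-, -, hgf, -⟩ := hlab.shared_ab.exists_adj
  obtain ⟨-, -, hgf', -⟩ := hlab.shared_cd.exists_adj
  have htri : ∀ h, h ≠ f → M.len h = 3 := huniq
  have hlen : ∀ h : M.InnerFace, 3 ≤ M.len h := by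
    intro h
    by_cases hh : h = f
    · subst hh
      refine le_trans ?_ (M.card_verts_le h)
      rw [← Finset.card_eq_three.2 ⟨a, b, c, hab, hac, hbc, rfl⟩]
      refine Finset.card_le_card fun v hv => ?_
      simp only [Finset.mem_insert, Finset.mem_singleton] at hv
      rcases hv with rfl | rfl | rfl
      · exact mem_verts_of_mem_faceEdges hgf (by simp)
      · exact mem_verts_of_mem_faceEdges hgf (by simp)
      · exact mem_verts_of_mem_faceEdges hgf' (by simp)
    · exact (htri h hh).ge
  obtain ⟨hall, hout, htight⟩ := tight_of_cover hxy hlen hcover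
  have hcov : ∀ v, ∃ h, v ∈ M.verts h := fun v => (hcover v).imp fun _ h => h.2
  have hedge : ∀ e ∈ G.edgeSet, ∃ h : M.InnerFace, e ∈ faceEdges h := by
    intro e he
    induction e with
    | h u v =>
      let e : G.Dart := ⟨(u, v), he⟩
      by_cases ho : M.face e = M.outer
      · exact ⟨⟨_, not_outer_of_outer_symm hout hcov ho⟩, mem_faceEdges.2 ⟨e.symm, rfl,
          SimpleGraph.Dart.edge_symm e⟩⟩
      · exact ⟨⟨_, ho⟩, mem_faceEdges.2 ⟨e, rfl, rfl⟩⟩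
  have hxf : x ∉ M.verts f := fun h => hx (M.mem_verts.1 h)
  have hyf : y ∉ M.verts f := fun h => hy (M.mem_verts.1 h)
  obtain ⟨s, t, p, hp, hf⟩ := hall f
  have hchain := hp.faceChain (mem_support_of_tight hall (weakDual_preconnected hout hcov) hcov
    htight htri hp hf hxf hyf)
  obtain ⟨i, hi, hi'⟩ := SimpleGraph.Walk.mem_support_iff_exists_getVert.1 hf
  have hx₀ : x ∈ M.verts (p.getVert 0) := by
    rw [SimpleGraph.Walk.getVert_zero]
    exact M.mem_verts.2 hp.1
  have hy₀ : y ∈ M.verts (p.getVert p.length) := by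
    rw [SimpleGraph.Walk.getVert_length]
    exact M.mem_verts.2 hp.2.1
  subst hi
  refine exists_stripDecomposition_of_isLabelling hchain htight hcov hedge hx₀ ?_ hy₀ ?_ ?_ ?_ htri
    hlab
  · intro j h1 h2 h3
    exact h1.ne' (hp.eq_zero h2 h3)
  · intro j h1 h2
    exact h1.ne (hp.eq_length h1.le h2)
  · refine Nat.pos_of_ne_zero ?_
    rintro rfl
    exact hxf hx₀
  · refine lt_of_le_of_ne hi' ?_
    intro h
    rw [h] at hyf
    exact hyf hy₀

end OuterplaneEmbedding

theorem theorem14 {V : Type*} [Fintype V] [LinearOrder V] (G : SimpleGraph V)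
    (hG : IsTwoConnected G) (M : OuterplaneEmbedding G) (x y a b c d : V)
    (hfund : M.IsFundamental x y)
    (f : M.InnerFace) (hf : M.faceLength f.1 ≠ 3)
    (huniq : ∀ g : M.InnerFace, g ≠ f → M.faceLength g.1 = 3)
    (hx : ¬ M.OnFace x f.1) (hy : ¬ M.OnFace y f.1)
    (hlab : M.IsLabelling f x y a b c d)
    (C : (M.sides f a b c d).Coloring (Fin 3)) :
    (((G.dist a c = 1 ∧ C x = C a ∧ C y = C c) ∨ (G.dist b d = 1 ∧ C x = C b ∧ C y = C d)) →
      HasMonomial G x y 0 1) ∧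
    (¬ ((G.dist a c = 1 ∧ C x = C a ∧ C y = C c) ∨
        (G.dist b d = 1 ∧ C x = C b ∧ C y = C d)) →
      HasMonomial G x y 0 0) := by
  obtain ⟨SL, SR, IA, IB, EL, ER, PA, PB, ρA, ρB, D, hEL, hER⟩ :=
    M.exists_stripDecomposition_of_isFundamental hfund huniq hx hy hlab
  have hκL : ∀ u v, s(u, v) ∈ EL → C u ≠ C v := fun u v h => C.valid (hEL u v h)
  have hκR : ∀ u v, s(u, v) ∈ ER → C u ≠ C v := fun u v h => C.valid (hER u v h)
  constructor
  · rintro (⟨-, h1, h2⟩ | ⟨-, h1, h2⟩)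
    · exact D.hasMonomial_zero_one C hκL hκR h1 h2
    -- Exchanging `a` with `b` and `c` with `d` turns the second alternative into the first.
    · exact D.swap.hasMonomial_zero_one C hκL hκR h1 h2
  · intro h
    refine D.hasMonomial_zero_zero C hκL hκR ?_ ?_
    · rintro ⟨hadj, h1, h2⟩
      exact h (Or.inl ⟨SimpleGraph.dist_eq_one_iff_adj.2 hadj, h1, h2⟩)
    · rintro ⟨hadj, h1, h2⟩
      exact h (Or.inr ⟨SimpleGraph.dist_eq_one_iff_adj.2 hadj, h1, h2⟩)
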